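/- **Model.** Let $p,q,d,\beta>0$ and $\underline\lambda\ge 0$ be constants, and let $F_U,F_Y$ be distributions of positive random variables with finite expectation. For $x\ge 0$ and $\lambda\ge\underline\lambda$, let $(T_k)_{k\ge1}$ be the arrival times of a Poisson process of rate $\beta$, let $(Y_k)_{k\ge1}$ be i.i.d. with law $F_Y$, independent of $(T_k)$, and set $$\lambda_t=\underline\lambda+e^{-dt}(\lambda-\underline\lambda)+\sum_{k:\,T_k\le t}Y_k e^{-d(t-T_k)} .$$ Let $N$ be a Cox process with intensity $(\lambda_t)$, i.e. conditionally on $(\lambda_t)$ an inhomogeneous Poisson process with this intensity, with arrival times $(\tau_n)$, and let the claims $(U_n)_{n\ge1}$ be i.i.d. with law $F_U$, independent of $N$ and of $(T_k,Y_k)$. The free surplus is $X_t=x+pt-\sum_{j\le N_t}U_j$. Let $\mathcal F_t$ be the complete $\sigma$-field generated by the $T_k,Y_k$ with $T_k\le t$ and the $\tau_n,U_n$ with $\tau_n\le t$. **Value function.** An admissible strategy $L\in\Pi_{x,\lambda}$ is a non-decreasing càdlàg $(\mathcal F_t)$-adapted process with $L_{0^-}=0$, $L_0\ge 0$ and $L_t\le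 X_t$ for $t<\tau^L:=\inf\{t\ge 0: X_t-L_{t^-}<0\}$. No dividend is paid at the ruin time $\tau^L$. Put $$V(x,\lambda)=\sup_{L\in\Pi_{x,\lambda}}\mathbb E\Big[\int_{[0,\tau^L)}e^{-qt}\,dL_t\Big].$$ An extended strategy is a pair $(L,\tau^F)$, where $L\in\Pi_{x,\lambda}$ and $\tau^F\in[0,\infty]$ is a stopping time at which the whole surplus is paid out and the business is closed. Its value is $$J(L,\tau^F;x,\lambda)=\mathbb E\Big[\int_{\{0\le t<\tau^L,\ t\le\tau^F\}}e^{-qt}\,dL_t+I_{\{\tau^F<\tau^L\}}e^{-q\tau^F}(X_{\tau^F}-L_{\tau^F})\Big].$$ **Grid strategies.** For $\delta>0$ let $\mathcal G_\delta=\{np\delta:n=0,1,2,\dots\}$ and $\rho^\delta(x)=\max\{y\in\mathcal G_\delta:y\le x\}$. Let $\widetilde\Pi^\delta_{x,\lambda}$ be the set of extended strategies which first pay $x-\rho^\delta(x)$ at time $0$ and then consist of a finite or infinite sequence of the following control actions, chosen in dependence on the past: * $\mathbf E_0$: pay nothing until the earliest of the next claim, the next jump of the intensity, and the lapse of time $\delta$.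 If the surplus $y$ at that moment is negative, ruin has occurred; otherwise pay $y-\rho^\delta(y)$ (which is $0$ if the full time $\delta$ has elapsed without a claim or a jump); * $\mathbf E_1$: if the current surplus is positive, pay $p\delta$ immediately; * $\mathbf E_F$: pay out the whole surplus and close the business, which ends the sequence. Put $V^\delta(x,\lambda)=\sup_{(L,\tau^F)\in\widetilde\Pi^\delta_{x,\lambda}}J(L,\tau^F;x,\lambda)$. **Theorem.** Let $\delta>0$ and $\delta_k=\delta/2^k$ for $k\ge 0$. Then $V$ is finite, $V^{\delta_k}\le V^{\delta_{k+1}}\le V$ on $[0,\infty)\times[\underline\lambda,\infty)$ for all $k\ge 0$, and $V^{\delta_k}\to V$ as $k\to\infty$, uniformly on $[0,\infty)\times[\underline\lambda,\infty)$. -/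

import Mathlib

open MeasureTheory ProbabilityTheory Filter Set
open scoped ENNReal Topology

noncomputable section

namespace ShotNoise

/-- Parameters of the compound shot-noise Cox surplus model: premium rate `p`, discount rate `q`,
decay rate `d` of the intensity, rate `β` of the catastrophes, base intensity `lamBase`, law of the
claim sizes and law of the upward jumps of the intensity. -/
structure Model where
  p : ℝ
  q : ℝ
  d : ℝ
  β : ℝ
  lamBase : ℝ
  claimLaw : Measure ℝ
  jumpLaw : Measure ℝ
  p_pos : 0 < p
  q_pos : 0 < q
  d_pos : 0 < d
  β_pos : 0 < β
  lamBase_nonneg : 0 ≤ lamBase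
  claimLaw_prob : IsProbabilityMeasure claimLaw
  jumpLaw_prob : IsProbabilityMeasure jumpLaw
  claim_pos : ∀ᵐ u ∂claimLaw, 0 < u
  jump_pos : ∀ᵐ y ∂jumpLaw, 0 < y
  claim_integrable : Integrable (fun u : ℝ => u) claimLaw
  jump_integrable : Integrable (fun y : ℝ => y) jumpLaw

/-- The sample space. The `n`-th entry of a sample `ω` is `(A, Y, E, U)`: `A` is the waiting time
between consecutive catastrophes, `Y` the jump of the intensity at the catastrophe, `E` the
increment of a unit-rate Poisson clock, and `U` the size of the claim. -/
abbrev Sample : Type := ℕ → ℝ × ℝ × ℝ × ℝ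

/-- All entries are independent, with `A ∼ Exp(β)`, `Y ∼ jumpLaw`, `E ∼ Exp(1)`,
`U ∼ claimLaw`. -/
def Model.P (M : Model) : Measure Sample :=
  haveI := M.claimLaw_prob
  haveI := M.jumpLaw_prob
  haveI := isProbabilityMeasure_expMeasure M.β_pos
  haveI := isProbabilityMeasure_expMeasure (zero_lt_one' ℝ)
  Measure.infinitePi
    (fun _ : ℕ => (expMeasure M.β).prod (M.jumpLaw.prod ((expMeasure 1).prod M.claimLaw)))

/-- Arrival time of the `k`-th catastrophe (`k = 0, 1, …`). -/
def catTime (ω : Sample) (k : ℕ) : ℝ := ∑ i ∈ Finset.range (k + 1), (ω i).1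

/-- Jump of the intensity at the `k`-th catastrophe. -/
def jumpSize (ω : Sample) (k : ℕ) : ℝ := (ω k).2.1

/-- Size of the `n`-th claim. -/
def claimSize (ω : Sample) (n : ℕ) : ℝ := (ω n).2.2.2

/-- Number of catastrophes up to time `t`. -/
def catCount (ω : Sample) (t : ℝ) : ℕ := Set.ncard {k : ℕ | catTime ω k ≤ t}

/-- The shot-noise intensity `λ_t` with initial value `lam`. -/
def Model.intensity (M : Model) (lam : ℝ) (ω : Sample) (t : ℝ) : ℝ :=
  M.lamBase + Real.exp (-M.d * t) * (lam - M.lamBase)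
    + ∑ k ∈ Finset.range (catCount ω t), jumpSize ω k * Real.exp (-M.d * (t - catTime ω k))

/-- The integrated intensity `Λ_t = ∫₀ᵗ λ_s ds`. -/
def Model.cumIntensity (M : Model) (lam : ℝ) (ω : Sample) (t : ℝ) : ℝ :=
  ∫ s in (0 : ℝ)..t, M.intensity lam ω s

/-- Arrival time of the `n`-th claim: the claim counting process is the unit-rate Poisson process
with arrival epochs `E₀ + ⋯ + Eₙ`, run with the clock `Λ`. Hence, conditionally on the intensity,
it is an inhomogeneous Poisson process with that intensity, i.e. a Cox process. -/
def Model.claimTime (M : Model) (lam : ℝ) (ω : Sample) (n : ℕ) : ℝ :=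
  sInf {t : ℝ | 0 ≤ t ∧ ∑ i ∈ Finset.range (n + 1), (ω i).2.2.1 ≤ M.cumIntensity lam ω t}

/-- Number of claims up to time `t`. -/
def Model.claimCount (M : Model) (lam : ℝ) (ω : Sample) (t : ℝ) : ℕ :=
  Set.ncard {n : ℕ | M.claimTime lam ω n ≤ t}

/-- The free surplus `X_t = x + p t - ∑_{j ≤ N_t} U_j`. -/
def Model.surplus (M : Model) (x lam : ℝ) (ω : Sample) (t : ℝ) : ℝ :=
  x + M.p * t - ∑ j ∈ Finset.range (M.claimCount lam ω t), claimSize ω j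

/-- The information at time `t`: the complete σ-field generated by the catastrophe times and
intensity jumps, and by the claim times and claim sizes, that have occurred up to time `t`. -/
@[reducible] def Model.info (M : Model) (lam t : ℝ) : MeasurableSpace Sample :=
  MeasurableSpace.generateFrom
    ({A | ∃ (k : ℕ) (s : ℝ) (B : Set ℝ), s ≤ t ∧ MeasurableSet B ∧
        A = {ω | catTime ω k ≤ s ∧ jumpSize ω k ∈ B}} ∪
     {A | ∃ (n : ℕ) (s : ℝ) (B : Set ℝ), s ≤ t ∧ MeasurableSet B ∧
        A = {ω | M.claimTime lam ω n ≤ s ∧ claimSize ω n ∈ B}} ∪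
     {A | M.P A = 0})

/-- Cumulative dividends: a non-decreasing right-continuous path for every sample (the left limits
exist by monotonicity). The value at negative times is required to be `0` in `IsAdmissible`, so the
left limit `L_{0-}` is `0` and an initial payment `L_0` is an atom at `0` of the measure `dL`. -/
abbrev Dividends : Type := Sample → StieltjesFunction ℝ

/-- The ruin time `τ^L = inf {t ≥ 0 : X_t - L_{t-} < 0}`, infinite if there is no ruin. -/
def Model.ruinTime (M : Model) (x lam : ℝ) (L : Dividends) (ω : Sample) : ℝ≥0∞ :=
  sInf {s : ℝ≥0∞ | ∃ t : ℝ, 0 ≤ t ∧ M.surplus x lam ω t - Function.leftLim (L ω) t < 0 ∧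
    s = ENNReal.ofReal t}

/-- Admissible dividend strategies (the set `Π_{x,λ}`). -/
def Model.IsAdmissible (M : Model) (x lam : ℝ) (L : Dividends) : Prop :=
  (∀ ω, ∀ t < 0, L ω t = 0) ∧
  (∀ t, 0 ≤ t → Measurable[M.info lam t] (fun ω => L ω t)) ∧
  (∀ᵐ ω ∂M.P, ∀ t, 0 ≤ t → ENNReal.ofReal t < M.ruinTime x lam L ω →
    L ω t ≤ M.surplus x lam ω t)

/-- Expected discounted dividends up to ruin. No dividend is paid at the ruin time itself, so
the integral runs over `[0, τ^L)`. -/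
def Model.J (M : Model) (x lam : ℝ) (L : Dividends) : ℝ≥0∞ :=
  ∫⁻ ω, (∫⁻ t in {t : ℝ | 0 ≤ t ∧ ENNReal.ofReal t < M.ruinTime x lam L ω},
    ENNReal.ofReal (Real.exp (-M.q * t)) ∂(L ω).measure) ∂M.P

/-- The optimal value function `V`. -/
def Model.V (M : Model) (x lam : ℝ) : ℝ≥0∞ :=
  ⨆ (L : Dividends) (_ : M.IsAdmissible x lam L), M.J x lam L

/-- Extended admissible strategies `(L, τ^F)`: `τ^F ∈ [0, ∞]` is a stopping time at which the whole
current surplus is paid out and the business is closed. -/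
def Model.IsExtAdmissible (M : Model) (x lam : ℝ) (L : Dividends) (F : Sample → ℝ≥0∞) : Prop :=
  M.IsAdmissible x lam L ∧
  ∀ t : ℝ, 0 ≤ t → MeasurableSet[M.info lam t] {ω | F ω ≤ ENNReal.ofReal t}

/-- Value of an extended strategy: expected discounted dividends up to ruin or closing (whichever
comes first), plus the discounted controlled surplus paid out at closing if this precedes ruin. -/
def Model.extJ (M : Model) (x lam : ℝ) (L : Dividends) (F : Sample → ℝ≥0∞) : ℝ≥0∞ :=
  ∫⁻ ω, ((∫⁻ t in {t : ℝ | 0 ≤ t ∧ ENNReal.ofReal t < M.ruinTime x lam L ω ∧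
        ENNReal.ofReal t ≤ F ω}, ENNReal.ofReal (Real.exp (-M.q * t)) ∂(L ω).measure)
    + {ω | F ω < M.ruinTime x lam L ω}.indicator (fun ω => ENNReal.ofReal
        (Real.exp (-M.q * (F ω).toReal) *
          (M.surplus x lam ω (F ω).toReal - L ω (F ω).toReal))) ω) ∂M.P

/-- `ρ^δ(x)`: the largest point of the grid `{n p δ : n ≥ 0}` that is at most `x` (for `x ≥ 0`). -/
def Model.gridFloor (M : Model) (δ x : ℝ) : ℝ := (⌊x / (M.p * δ)⌋₊ : ℝ) * (M.p * δ)

/-- The control actions: `wait` is `E₀`, `pay` is `E₁`, `close` is `E_F`. -/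
inductive Action : Type
  | wait
  | pay
  | close

/-- The situation just before a control action: current time, current controlled surplus (a grid
point while `active`), dividends paid so far, and whether the business is still running, i.e.
neither ruined nor closed. -/
structure GridState : Type where
  time : ℝ
  level : ℝ
  paid : ℝ
  active : Bool

/-- The end time of the action `wait` started at time `s`: the earliest of `s + δ`, the next claim
and the next catastrophe. -/
def Model.waitEnd (M : Model) (lam δ : ℝ) (ω : Sample) (s : ℝ) : ℝ :=
  sInf ({s + δ} ∪ {r : ℝ | s < r ∧ ∃ n : ℕ, r = M.claimTime lam ω n ∨ r = catTime ω n})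

open scoped Classical in
/-- The effect of one control action.
* `wait`: no dividends until `waitEnd`. If the surplus is then negative, ruin occurs; otherwise the
  minimal dividend that brings the surplus back to the grid is paid (it is zero if the full time `δ`
  has elapsed without an event).
* `pay`: the amount `p δ` is paid immediately.
* `close`: the business is closed. The final payment of the current surplus is not part of `L`; it
  is accounted for in `extJ`. -/
def Model.gridStep (M : Model) (x lam δ : ℝ) (ω : Sample) (s : GridState) (a : Action) :
    GridState :=
  if s.active then
    match a with
    | .wait =>
      let r := M.waitEnd lam δ ω s.time
      let y := s.level + (M.surplus x lam ω r - M.surplus x lam ω s.time)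
      if y < 0 then ⟨r, y, s.paid, false⟩
      else ⟨r, M.gridFloor δ y, s.paid + (y - M.gridFloor δ y), true⟩
    | .pay => ⟨s.time, s.level - M.p * δ, s.paid + M.p * δ, true⟩
    | .close => ⟨s.time, s.level, s.paid, false⟩
  else s

/-- The successive situations when the actions `a 0, a 1, …` are applied. Initially the amount
`x - ρ^δ(x)` is paid so that the surplus lies on the grid. -/
def Model.gridState (M : Model) (x lam δ : ℝ) (ω : Sample) (a : ℕ → Action) : ℕ → GridState
  | 0 => ⟨0, M.gridFloor δ x, x - M.gridFloor δ x, true⟩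
  | k + 1 => M.gridStep x lam δ ω (M.gridState x lam δ ω a k) (a k)

/-- Along the sample `ω`, the cumulative dividend path `ℓ` and the closing time `F` are obtained
by the sequence of control actions `a`. The action `pay` may be used only at a positive surplus. -/
def Model.Follows (M : Model) (x lam δ : ℝ) (ω : Sample) (a : ℕ → Action) (ℓ : ℝ → ℝ)
    (F : ℝ≥0∞) : Prop :=
  (∀ k, (M.gridState x lam δ ω a k).active = true → a k = .pay →
    0 < (M.gridState x lam δ ω a k).level) ∧
  (∀ k t, (M.gridState x lam δ ω a k).time ≤ t →
    (t < (M.gridState x lam δ ω a (k + 1)).time ∨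
      (M.gridState x lam δ ω a k).active = false) →
    ℓ t = (M.gridState x lam δ ω a k).paid) ∧
  (∀ k, (M.gridState x lam δ ω a k).active = true → a k = .close →
    F = ENNReal.ofReal (M.gridState x lam δ ω a k).time) ∧
  ((∀ k, (M.gridState x lam δ ω a k).active = true → a k ≠ .close) → F = ⊤)

/-- The grid strategies (the set `Π̃^δ_{x,λ}`): the extended admissible strategies obtained by a
sequence of control actions, which may depend on the whole past. That the choice of the actions
does not anticipate the future is expressed by the adaptedness of `L` and by `τ^F` being a stopping
time, since the actions can be read off from `L` and `τ^F`. -/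
def Model.IsGridStrategy (M : Model) (δ x lam : ℝ) (L : Dividends) (F : Sample → ℝ≥0∞) : Prop :=
  M.IsExtAdmissible x lam L F ∧
  ∀ᵐ ω ∂M.P, ∃ a : ℕ → Action, M.Follows x lam δ ω a (fun t => L ω t) (F ω)

/-- The optimal value `V^δ` among the grid strategies. -/
def Model.gridV (M : Model) (δ x lam : ℝ) : ℝ≥0∞ :=
  ⨆ (L : Dividends) (F : Sample → ℝ≥0∞) (_ : M.IsGridStrategy δ x lam L F), M.extJ x lam L F

end ShotNoise

end

open MeasureTheory ProbabilityTheory Filter Set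
open scoped ENNReal Topology

noncomputable section

namespace ShotNoise

/-! ### Paths: claims, catastrophes, epochs and rounding to the grid -/

section

/-! Discounting is killing at an independent exponential time of rate `q`: the discounted dividends
before ruin are the mean of the cumulative dividends, stopped just before ruin, at that time
(`lintegral_discount_lt`, `J_eq`). Strategies can therefore be compared path by path and time by
time. Since dividends never exceed `x + p t`, this also gives finiteness (`V_ne_top`).

Closing at `τ^F` is no better than paying out the whole surplus and carrying on, because the surplus
cannot fall before the next claim; hence `gridV_le_V`. Halving the step loses nothing: every path
produced by actions with step `δ` is produced by actions with step `δ / 2`, one coarse payment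
becoming two fine ones and one coarse wait becoming at most two fine waits (`Model.Follows.half`,
`gridV_half_le`).

The core is `exists_forall_V_le_gridV_add`, the bound `V ≤ V^δ + ε` for small `δ`, uniformly in the
initial surplus and intensity. For a large initial intensity the claims arrive so fast that `V` is
at most about `x` (`exists_forall_V_le`), while paying everything at once gives `V^δ ≥ x`
(`le_gridV`). For bounded initial intensity, an admissible `L` is imitated by a grid strategy. It
observes a target only at epochs, which are counted in steps `δ` from the last event, and keeps as
reserve the grid point below surplus minus target. The target is `L`, truncated and lowered by `b =
K p δ`, plus one grid step per event. The extra steps absorb the rounding and make the payments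
monotone (`tracking_mono`); lowering by `b` keeps the payments below those of `L` as long as at most
`K` events have occurred.

Two losses have to be controlled besides the rounding and the delay. First, the grid strategy may be
ruined by a claim that `L` survives; then the surplus after the claim lies in `[0, b)`, which is
improbable because the claim time depends smoothly on one exponential increment of the Poisson clock
(`measure_surplus_claimTime_mem_le`). Second, `L` may pay a large amount just before its ruin, which
the delayed strategy misses. A claim cannot be predicted: lengthening one clock increment by `R δ`
postpones the claim by at least `δ`, leaves the earlier information unchanged and costs only a
factor `e^{Rδ}` in the law. So the expected payment in the last `δ` before a claim is small
(`lintegral_delayedSup_sub_le`).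

The path estimate is `Model.AdmissibleAt.lintegral_paid_le`. Truncating `L` to the band from `x - B`
to `x + p t` makes all errors independent of `x`, and coupling through the common sample makes them
monotone in the initial intensity. This gives the uniformity. -/

theorem lt_ncard_le_iff {f : ℕ → ℝ} (hm : StrictMono f) (ht : Tendsto f atTop atTop) (t : ℝ)
    (n : ℕ) : n < Set.ncard {k : ℕ | f k ≤ t} ↔ f n ≤ t := by
  have hex : ∃ N, t < f N := ((ht.eventually_gt_atTop t).exists)
  classical
  have hset : {k : ℕ | f k ≤ t} = Set.Iio (Nat.find hex) := by
    ext k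
    simp only [mem_ofPred_eq, mem_Iio, Nat.lt_find_iff, not_lt]
    exact ⟨fun h m hmk => (hm.monotone hmk).trans h, fun h => h k le_rfl⟩
  have hk : n ∈ {k : ℕ | f k ≤ t} ↔ n ∈ Set.Iio (Nat.find hex) := by rw [hset]
  rw [hset, ← Finset.coe_Iio, Set.ncard_coe_finset, Nat.card_Iio]
  simpa using hk.symm

/-- The pathwise properties that hold for almost every sample: claims and catastrophes occur at
strictly increasing positive times without accumulation, and claims are positive. -/
structure Model.Regular (M : Model) (lam : ℝ) (ω : Sample) : Prop where
  claim_mono : StrictMono (M.claimTime lam ω)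
  claim_pos : ∀ n, 0 < M.claimTime lam ω n
  claim_tendsto : Tendsto (M.claimTime lam ω) atTop atTop
  cat_mono : StrictMono (catTime ω)
  cat_tendsto : Tendsto (catTime ω) atTop atTop
  size_pos : ∀ n, 0 < claimSize ω n

/-- Number of claims and catastrophes up to time `t`. -/
def Model.eventCount (M : Model) (lam : ℝ) (ω : Sample) (t : ℝ) : ℕ :=
  M.claimCount lam ω t + catCount ω t

/-- The first claim or catastrophe after time `t`. -/
def Model.nextEvent (M : Model) (lam : ℝ) (ω : Sample) (t : ℝ) : ℝ :=
  min (M.claimTime lam ω (M.claimCount lam ω t)) (catTime ω (catCount ω t))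

/-- The last of the first `n` values of `f`, with value `0` for `n = 0`. -/
def lastOf (f : ℕ → ℝ) : ℕ → ℝ
  | 0 => 0
  | n + 1 => f n

/-- The last claim or catastrophe up to time `t`, with value `0` if there is none. -/
def Model.lastEvent (M : Model) (lam : ℝ) (ω : Sample) (t : ℝ) : ℝ :=
  max (lastOf (M.claimTime lam ω) (M.claimCount lam ω t)) (lastOf (catTime ω) (catCount ω t))

/-- The last time up to `t` at which a grid strategy can act: the time is counted in steps of
length `δ` from the last event. -/
def Model.epoch (M : Model) (lam δ : ℝ) (ω : Sample) (t : ℝ) : ℝ :=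
  M.lastEvent lam ω t + (⌊(t - M.lastEvent lam ω t) / δ⌋₊ : ℝ) * δ

variable {M : Model} {lam : ℝ} {ω : Sample}

namespace Model.Regular

theorem lt_claimCount (hR : M.Regular lam ω) (t : ℝ) (n : ℕ) :
    n < M.claimCount lam ω t ↔ M.claimTime lam ω n ≤ t :=
  lt_ncard_le_iff hR.claim_mono hR.claim_tendsto t n

theorem lt_catCount (hR : M.Regular lam ω) (t : ℝ) (n : ℕ) :
    n < catCount ω t ↔ catTime ω n ≤ t :=
  lt_ncard_le_iff hR.cat_mono hR.cat_tendsto t n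

theorem claimCount_mono (hR : M.Regular lam ω) {s t : ℝ} (h : s ≤ t) :
    M.claimCount lam ω s ≤ M.claimCount lam ω t :=
  le_of_forall_lt fun n hn => (hR.lt_claimCount t n).2 (((hR.lt_claimCount s n).1 hn).trans h)

theorem catCount_mono (hR : M.Regular lam ω) {s t : ℝ} (h : s ≤ t) :
    catCount ω s ≤ catCount ω t :=
  le_of_forall_lt fun n hn => (hR.lt_catCount t n).2 (((hR.lt_catCount s n).1 hn).trans h)

theorem eventCount_mono (hR : M.Regular lam ω) {s t : ℝ} (h : s ≤ t) :
    M.eventCount lam ω s ≤ M.eventCount lam ω t :=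
  Nat.add_le_add (hR.claimCount_mono h) (hR.catCount_mono h)

theorem claimCount_eq (hR : M.Regular lam ω) {s t : ℝ} (h : s ≤ t)
    (he : M.eventCount lam ω s = M.eventCount lam ω t) :
    M.claimCount lam ω s = M.claimCount lam ω t := by
  have h1 := hR.claimCount_mono h
  have h2 := hR.catCount_mono h
  unfold Model.eventCount at he
  omega

theorem catCount_eq (hR : M.Regular lam ω) {s t : ℝ} (h : s ≤ t)
    (he : M.eventCount lam ω s = M.eventCount lam ω t) :
    catCount ω s = catCount ω t := by
  have h1 := hR.claimCount_mono h
  have h2 := hR.catCount_mono h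
  unfold Model.eventCount at he
  omega

theorem sum_claims_nonneg (hR : M.Regular lam ω) (n : ℕ) :
    0 ≤ ∑ j ∈ Finset.range n, claimSize ω j :=
  Finset.sum_nonneg fun j _ => (hR.size_pos j).le

theorem sum_claims_mono (hR : M.Regular lam ω) {m n : ℕ} (h : m ≤ n) :
    ∑ j ∈ Finset.range m, claimSize ω j ≤ ∑ j ∈ Finset.range n, claimSize ω j :=
  Finset.sum_le_sum_of_subset_of_nonneg (Finset.range_mono h) fun j _ _ => (hR.size_pos j).le

theorem surplus_le (hR : M.Regular lam ω) (x t : ℝ) : M.surplus x lam ω t ≤ x + M.p * t := by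
  have := hR.sum_claims_nonneg (M.claimCount lam ω t)
  unfold Model.surplus
  linarith

theorem surplus_le_add (hR : M.Regular lam ω) (x : ℝ) {s t : ℝ} (h : s ≤ t) :
    M.surplus x lam ω t ≤ M.surplus x lam ω s + M.p * (t - s) := by
  have := hR.sum_claims_mono (hR.claimCount_mono h)
  unfold Model.surplus
  linarith

theorem surplus_eq_add (x : ℝ) {s t : ℝ}
    (h : M.claimCount lam ω s = M.claimCount lam ω t) :
    M.surplus x lam ω t = M.surplus x lam ω s + M.p * (t - s) := by
  unfold Model.surplus
  rw [h]
  ring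

theorem surplus_le_of_claimCount_eq (x : ℝ) {s t : ℝ} (hst : s ≤ t)
    (h : M.claimCount lam ω s = M.claimCount lam ω t) :
    M.surplus x lam ω s ≤ M.surplus x lam ω t := by
  rw [surplus_eq_add x h]
  nlinarith [M.p_pos]

theorem lt_claimTime_claimCount (hR : M.Regular lam ω) (t : ℝ) :
    t < M.claimTime lam ω (M.claimCount lam ω t) := by
  by_contra! h
  exact lt_irrefl _ ((hR.lt_claimCount t _).2 h)

theorem lt_catTime_catCount (hR : M.Regular lam ω) (t : ℝ) : t < catTime ω (catCount ω t) := by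
  by_contra! h
  exact lt_irrefl _ ((hR.lt_catCount t _).2 h)

theorem lt_nextEvent (hR : M.Regular lam ω) (t : ℝ) : t < M.nextEvent lam ω t :=
  lt_min (hR.lt_claimTime_claimCount t) (hR.lt_catTime_catCount t)

theorem eventCount_of_lt_nextEvent (hR : M.Regular lam ω) {t u : ℝ} (h : t ≤ u)
    (hu : u < M.nextEvent lam ω t) : M.eventCount lam ω t = M.eventCount lam ω u := by
  have h1 := hR.claimCount_mono h
  have h2 := hR.catCount_mono h
  have h3 : ¬ M.claimCount lam ω t < M.claimCount lam ω u := by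
    rw [hR.lt_claimCount, not_le]; exact hu.trans_le (min_le_left _ _)
  have h4 : ¬ catCount ω t < catCount ω u := by
    rw [hR.lt_catCount, not_le]; exact hu.trans_le (min_le_right _ _)
  unfold Model.eventCount
  omega

theorem eventCount_lt_of_nextEvent_le (hR : M.Regular lam ω) {t u : ℝ}
    (hu : M.nextEvent lam ω t ≤ u) : M.eventCount lam ω t + 1 ≤ M.eventCount lam ω u := by
  have h : t ≤ u := (hR.lt_nextEvent t).le.trans hu
  have h1 := hR.claimCount_mono h
  have h2 := hR.catCount_mono h
  rcases min_le_iff.1 hu with h3 | h3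
  · have := (hR.lt_claimCount u _).2 h3
    unfold Model.eventCount
    omega
  · have := (hR.lt_catCount u _).2 h3
    unfold Model.eventCount
    omega

theorem lastEvent_nonneg (hR : M.Regular lam ω) (t : ℝ) : 0 ≤ M.lastEvent lam ω t := by
  unfold Model.lastEvent
  cases h : M.claimCount lam ω t with
  | zero => exact le_max_left _ _
  | succ n => exact (hR.claim_pos n).le.trans (le_max_left _ _)

theorem lastEvent_le (hR : M.Regular lam ω) {t : ℝ} (ht : 0 ≤ t) : M.lastEvent lam ω t ≤ t := by
  unfold Model.lastEvent
  apply max_le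
  · cases h : M.claimCount lam ω t with
    | zero => exact ht
    | succ n => exact (hR.lt_claimCount t n).1 (by omega)
  · cases h : catCount ω t with
    | zero => exact ht
    | succ n => exact (hR.lt_catCount t n).1 (by omega)

theorem claimTime_le_lastEvent (hR : M.Regular lam ω) {t : ℝ} {n : ℕ}
    (h : M.claimTime lam ω n ≤ t) : M.claimTime lam ω n ≤ M.lastEvent lam ω t := by
  have h1 := (hR.lt_claimCount t n).2 h
  refine le_trans ?_ (le_max_left _ _)
  cases h : M.claimCount lam ω t with
  | zero => omega
  | succ m => exact hR.claim_mono.monotone (by omega)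

theorem catTime_le_lastEvent (hR : M.Regular lam ω) {t : ℝ} {n : ℕ}
    (h : catTime ω n ≤ t) : catTime ω n ≤ M.lastEvent lam ω t := by
  have h1 := (hR.lt_catCount t n).2 h
  refine le_trans ?_ (le_max_right _ _)
  cases h : catCount ω t with
  | zero => omega
  | succ m => exact hR.cat_mono.monotone (by omega)

theorem eventCount_lastEvent (hR : M.Regular lam ω) {t : ℝ} (ht : 0 ≤ t) :
    M.eventCount lam ω (M.lastEvent lam ω t) = M.eventCount lam ω t := by
  apply le_antisymm (hR.eventCount_mono (hR.lastEvent_le ht))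
  apply Nat.add_le_add
  · exact le_of_forall_lt fun n hn =>
      (hR.lt_claimCount _ n).2 (hR.claimTime_le_lastEvent ((hR.lt_claimCount t n).1 hn))
  · exact le_of_forall_lt fun n hn =>
      (hR.lt_catCount _ n).2 (hR.catTime_le_lastEvent ((hR.lt_catCount t n).1 hn))

theorem lastEvent_congr (hR : M.Regular lam ω) {s t : ℝ} (h : s ≤ t)
    (he : M.eventCount lam ω s = M.eventCount lam ω t) :
    M.lastEvent lam ω s = M.lastEvent lam ω t := by
  unfold Model.lastEvent
  rw [hR.claimCount_eq h he, hR.catCount_eq h he]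

theorem lastEvent_nextEvent (hR : M.Regular lam ω) {t : ℝ} (ht : 0 ≤ t) :
    M.lastEvent lam ω (M.nextEvent lam ω t) = M.nextEvent lam ω t := by
  apply le_antisymm (hR.lastEvent_le (ht.trans (hR.lt_nextEvent t).le))
  rcases min_choice (M.claimTime lam ω (M.claimCount lam ω t)) (catTime ω (catCount ω t)) with h | h
  · have h' : M.nextEvent lam ω t = M.claimTime lam ω (M.claimCount lam ω t) := h
    conv_lhs => rw [h']
    exact hR.claimTime_le_lastEvent h'.ge
  · have h' : M.nextEvent lam ω t = catTime ω (catCount ω t) := h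
    conv_lhs => rw [h']
    exact hR.catTime_le_lastEvent h'.ge

/-- Events do not accumulate, so the infimum over the future events is attained, at the next claim
or the next catastrophe. -/
theorem waitEnd_eq (hR : M.Regular lam ω) {δ : ℝ} (s : ℝ) :
    M.waitEnd lam δ ω s = min (s + δ) (M.nextEvent lam ω s) := by
  unfold Model.waitEnd
  apply IsLeast.csInf_eq
  constructor
  · rcases min_choice (s + δ) (M.nextEvent lam ω s) with h | h
    · exact Or.inl h
    · right
      rw [h]
      refine ⟨hR.lt_nextEvent s, ?_⟩
      rcases min_choice (M.claimTime lam ω (M.claimCount lam ω s)) (catTime ω (catCount ω s))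
        with h | h
      · exact ⟨_, Or.inl h⟩
      · exact ⟨_, Or.inr h⟩
  · rintro r (hr | ⟨hr, n, hn | hn⟩)
    · exact (min_le_left _ _).trans hr.ge
    · refine (min_le_right _ _).trans ((min_le_left _ _).trans ?_)
      rw [hn]
      apply hR.claim_mono.monotone
      by_contra! h
      exact absurd ((hR.lt_claimCount s n).1 h) (by rw [← hn]; exact not_le.2 hr)
    · refine (min_le_right _ _).trans ((min_le_right _ _).trans ?_)
      rw [hn]
      apply hR.cat_mono.monotone
      by_contra! h
      exact absurd ((hR.lt_catCount s n).1 h) (by rw [← hn]; exact not_le.2 hr)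

theorem lt_waitEnd (hR : M.Regular lam ω) {δ : ℝ} (hδ : 0 < δ) (s : ℝ) :
    s < M.waitEnd lam δ ω s := by
  rw [hR.waitEnd_eq]
  exact lt_min (by linarith) (hR.lt_nextEvent s)

theorem eventCount_of_lt_waitEnd (hR : M.Regular lam ω) {δ t u : ℝ} (h : t ≤ u)
    (hu : u < M.waitEnd lam δ ω t) : M.eventCount lam ω t = M.eventCount lam ω u :=
  hR.eventCount_of_lt_nextEvent h (hu.trans_le (by rw [hR.waitEnd_eq]; exact min_le_right _ _))

section epoch

variable {δ : ℝ}

theorem lastEvent_le_epoch (hδ : 0 < δ) (t : ℝ) : M.lastEvent lam ω t ≤ M.epoch lam δ ω t := by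
  unfold Model.epoch
  have : (0 : ℝ) ≤ (⌊(t - M.lastEvent lam ω t) / δ⌋₊ : ℝ) * δ := by positivity
  linarith

theorem epoch_nonneg (hR : M.Regular lam ω) (hδ : 0 < δ) (t : ℝ) : 0 ≤ M.epoch lam δ ω t :=
  (hR.lastEvent_nonneg t).trans (lastEvent_le_epoch hδ t)

theorem epoch_le (hR : M.Regular lam ω) (hδ : 0 < δ) {t : ℝ} (ht : 0 ≤ t) :
    M.epoch lam δ ω t ≤ t := by
  unfold Model.epoch
  have h1 := hR.lastEvent_le ht
  have h2 := Nat.floor_le (a := (t - M.lastEvent lam ω t) / δ) (div_nonneg (by linarith) hδ.le)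
  rw [le_div_iff₀ hδ] at h2
  linarith

theorem lt_epoch_add (hδ : 0 < δ) (t : ℝ) : t < M.epoch lam δ ω t + δ := by
  unfold Model.epoch
  have h2 := Nat.lt_floor_add_one ((t - M.lastEvent lam ω t) / δ)
  rw [div_lt_iff₀ hδ] at h2
  linarith

/-- The epoch lies between the last event and `t`, so no event separates it from `t`. -/
theorem eventCount_epoch (hR : M.Regular lam ω) (hδ : 0 < δ) {t : ℝ} (ht : 0 ≤ t) :
    M.eventCount lam ω (M.epoch lam δ ω t) = M.eventCount lam ω t :=
  le_antisymm (hR.eventCount_mono (hR.epoch_le hδ ht))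
    ((hR.eventCount_lastEvent ht).symm.le.trans (hR.eventCount_mono (lastEvent_le_epoch hδ t)))

theorem epoch_congr (hR : M.Regular lam ω) (hδ : 0 < δ) {s u : ℝ} (hs0 : 0 ≤ s)
    (hs : M.epoch lam δ ω s = s)
    (hsu : s ≤ u) (hu : u < s + δ) (he : M.eventCount lam ω s = M.eventCount lam ω u) :
    M.epoch lam δ ω u = s := by
  have hl := hR.lastEvent_congr hsu he
  unfold Model.epoch at hs ⊢
  rw [← hl]
  set l := M.lastEvent lam ω s with hl'
  have hfl : ⌊(u - l) / δ⌋₊ = ⌊(s - l) / δ⌋₊ := by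
    rw [Nat.floor_eq_iff (div_nonneg (by have := hR.lastEvent_le hs0; linarith) hδ.le)]
    constructor
    · rw [le_div_iff₀ hδ]; linarith
    · rw [div_lt_iff₀ hδ]; linarith
  rw [hfl, hs]

theorem epoch_zero (hR : M.Regular lam ω) : M.epoch lam δ ω 0 = 0 := by
  have h : M.lastEvent lam ω 0 = 0 := le_antisymm (hR.lastEvent_le le_rfl) (hR.lastEvent_nonneg 0)
  simp [Model.epoch, h]

theorem epoch_nextEvent (hR : M.Regular lam ω) {t : ℝ} (ht : 0 ≤ t) :
    M.epoch lam δ ω (M.nextEvent lam ω t) = M.nextEvent lam ω t := by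
  simp [Model.epoch, hR.lastEvent_nextEvent ht]

theorem epoch_add (hR : M.Regular lam ω) (hδ : 0 < δ) {s : ℝ} (hs : M.epoch lam δ ω s = s)
    (he : M.eventCount lam ω s = M.eventCount lam ω (s + δ)) :
    M.epoch lam δ ω (s + δ) = s + δ := by
  have hl := hR.lastEvent_congr (by linarith) he
  unfold Model.epoch at hs ⊢
  rw [← hl]
  set l := M.lastEvent lam ω s with hl'
  set n := ⌊(s - l) / δ⌋₊
  have h1 : (s + δ - l) / δ = ((n + 1 : ℕ) : ℝ) := by
    rw [div_eq_iff hδ.ne']; push_cast; linarith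
  rw [h1, Nat.floor_natCast]
  push_cast
  linarith

/-- Without an event in between, both epochs are counted from the same last event. Hence the surplus
moves between them by a multiple of the grid step. -/
theorem exists_epoch_eq_add (hR : M.Regular lam ω) (hδ : 0 < δ) {u t : ℝ} (h : u ≤ t)
    (he : M.eventCount lam ω u = M.eventCount lam ω t) :
    ∃ j : ℕ, M.epoch lam δ ω t = M.epoch lam δ ω u + j * δ := by
  have hl := hR.lastEvent_congr h he
  have hle : ⌊(u - M.lastEvent lam ω u) / δ⌋₊ ≤ ⌊(t - M.lastEvent lam ω t) / δ⌋₊ := by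
    rw [hl]; exact Nat.floor_le_floor (by gcongr)
  obtain ⟨j, hj⟩ := Nat.exists_eq_add_of_le hle
  refine ⟨j, ?_⟩
  unfold Model.epoch
  rw [hj, hl]
  push_cast
  ring

theorem epoch_waitEnd (hR : M.Regular lam ω) (hδ : 0 < δ) {s : ℝ} (hs0 : 0 ≤ s)
    (hs : M.epoch lam δ ω s = s) :
    M.epoch lam δ ω (M.waitEnd lam δ ω s) = M.waitEnd lam δ ω s := by
  rw [hR.waitEnd_eq]
  rcases le_or_gt (M.nextEvent lam ω s) (s + δ) with h | h
  · rw [min_eq_right h, hR.epoch_nextEvent hs0]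
  · rw [min_eq_left h.le, hR.epoch_add hδ hs (hR.eventCount_of_lt_nextEvent (by linarith) h)]

theorem epoch_of_lt_waitEnd (hR : M.Regular lam ω) (hδ : 0 < δ) {s u : ℝ} (hs0 : 0 ≤ s)
    (hs : M.epoch lam δ ω s = s) (hsu : s ≤ u) (hu : u < M.waitEnd lam δ ω s) :
    M.epoch lam δ ω u = s :=
  hR.epoch_congr hδ hs0 hs hsu (hu.trans_le (by rw [hR.waitEnd_eq]; exact min_le_left _ _))
    (hR.eventCount_of_lt_waitEnd hsu hu)

theorem surplus_epoch (hR : M.Regular lam ω) (hδ : 0 < δ) (x : ℝ) {t : ℝ} (ht : 0 ≤ t) :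
    M.surplus x lam ω t
      = M.surplus x lam ω (M.epoch lam δ ω t) + M.p * (t - M.epoch lam δ ω t) :=
  surplus_eq_add x (hR.claimCount_eq (hR.epoch_le hδ ht) (hR.eventCount_epoch hδ ht))

end epoch

end Model.Regular

section gridFloor

variable {δ : ℝ}

theorem gridFloor_nonneg (hδ : 0 < δ) (y : ℝ) : 0 ≤ M.gridFloor δ y := by
  have := M.p_pos
  unfold Model.gridFloor
  positivity

theorem gridFloor_le (hδ : 0 < δ) {y : ℝ} (hy : 0 ≤ y) : M.gridFloor δ y ≤ y := by
  have hg : 0 < M.p * δ := mul_pos M.p_pos hδ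
  have := Nat.floor_le (a := y / (M.p * δ)) (by positivity)
  unfold Model.gridFloor
  rwa [le_div_iff₀ hg] at this

theorem lt_gridFloor_add (hδ : 0 < δ) (y : ℝ) : y < M.gridFloor δ y + M.p * δ := by
  have hg : 0 < M.p * δ := mul_pos M.p_pos hδ
  have := Nat.lt_floor_add_one (y / (M.p * δ))
  unfold Model.gridFloor
  rw [div_lt_iff₀ hg] at this
  linarith

theorem gridFloor_mono (hδ : 0 < δ) {y z : ℝ} (h : y ≤ z) : M.gridFloor δ y ≤ M.gridFloor δ z := by
  have hg : 0 < M.p * δ := mul_pos M.p_pos hδ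
  unfold Model.gridFloor
  gcongr

theorem gridFloor_of_nonpos (hδ : 0 < δ) {y : ℝ} (h : y ≤ 0) : M.gridFloor δ y = 0 := by
  have hg : 0 < M.p * δ := mul_pos M.p_pos hδ
  unfold Model.gridFloor
  rw [Nat.floor_of_nonpos (div_nonpos_of_nonpos_of_nonneg h hg.le)]
  simp

theorem gridFloor_natCast_mul (hδ : 0 < δ) (j : ℕ) : M.gridFloor δ (j * (M.p * δ)) = j * (M.p * δ) := by
  have hg : 0 < M.p * δ := mul_pos M.p_pos hδ
  unfold Model.gridFloor
  rw [mul_div_cancel_right₀ _ hg.ne', Nat.floor_natCast]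

/-- Only an inequality, since the natural-number floor replaces negative values by `0`; for `y ≥ 0`
equality holds. -/
theorem gridFloor_add_natCast_mul_le (hδ : 0 < δ) (y : ℝ) (j : ℕ) :
    M.gridFloor δ (y + j * (M.p * δ)) ≤ M.gridFloor δ y + j * (M.p * δ) := by
  have hg : 0 < M.p * δ := mul_pos M.p_pos hδ
  rcases le_total 0 y with hy | hy
  · unfold Model.gridFloor
    have h1 : (y + j * (M.p * δ)) / (M.p * δ) = y / (M.p * δ) + j := by
      rw [add_div, mul_div_cancel_right₀ _ hg.ne']
    rw [h1, Nat.floor_add_natCast (by positivity)]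
    push_cast
    linarith
  · calc M.gridFloor δ (y + j * (M.p * δ)) ≤ M.gridFloor δ (j * (M.p * δ)) :=
        gridFloor_mono hδ (by linarith)
      _ = j * (M.p * δ) := gridFloor_natCast_mul hδ j
      _ ≤ _ := by linarith [gridFloor_nonneg (M := M) hδ y]

end gridFloor

end

/-! ### The strategy that tracks a target, stopped at ruin -/

section

/-- The target `G` raised by one grid step per event, evaluated at the last epoch. -/
def Model.gridTarget (M : Model) (lam δ : ℝ) (G : ℝ → ℝ) (ω : Sample) (t : ℝ) : ℝ :=
  G (M.epoch lam δ ω t) + M.eventCount lam ω t * (M.p * δ)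

/-- The cumulative dividends which leave, at every epoch, the grid point below the difference of
the surplus and the target. -/
def Model.tracking (M : Model) (x lam δ : ℝ) (G : ℝ → ℝ) (ω : Sample) (t : ℝ) : ℝ :=
  M.surplus x lam ω (M.epoch lam δ ω t) -
    M.gridFloor δ (M.surplus x lam ω (M.epoch lam δ ω t) - M.gridTarget lam δ G ω t)

/-- The surplus has dropped below the dividends paid before. -/
def Model.Overdrawn (M : Model) (x lam δ : ℝ) (G : ℝ → ℝ) (ω : Sample) (t : ℝ) : Prop :=
  ∃ u v, 0 ≤ u ∧ u < v ∧ v ≤ t ∧ M.surplus x lam ω v < M.tracking x lam δ G ω u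

/-- The dividends `tracking`, stopped at ruin. -/
def Model.gridPath (M : Model) (x lam δ : ℝ) (G : ℝ → ℝ) (ω : Sample) (t : ℝ) : ℝ :=
  sSup {c | ∃ u, 0 ≤ u ∧ u ≤ t ∧ ¬ M.Overdrawn x lam δ G ω u ∧ c = M.tracking x lam δ G ω u}

variable {M : Model} {x lam δ : ℝ} {ω : Sample} {G : ℝ → ℝ}

theorem Model.Overdrawn.mono {s t : ℝ} (h : M.Overdrawn x lam δ G ω s) (hst : s ≤ t) :
    M.Overdrawn x lam δ G ω t := by
  obtain ⟨u, v, h0, huv, hv, hlt⟩ := h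
  exact ⟨u, v, h0, huv, hv.trans hst, hlt⟩

namespace Model.Regular

theorem tracking_le_surplus_epoch (hδ : 0 < δ) (t : ℝ) :
    M.tracking x lam δ G ω t ≤ M.surplus x lam ω (M.epoch lam δ ω t) := by
  unfold Model.tracking
  linarith [gridFloor_nonneg (M := M) hδ
    (M.surplus x lam ω (M.epoch lam δ ω t) - M.gridTarget lam δ G ω t)]

theorem tracking_le_surplus (hR : M.Regular lam ω) (hδ : 0 < δ) {t : ℝ} (ht : 0 ≤ t) :
    M.tracking x lam δ G ω t ≤ M.surplus x lam ω t := by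
  have h1 := tracking_le_surplus_epoch (x := x) (M := M) (G := G) (lam := lam) (ω := ω) hδ t
  have h2 := hR.surplus_epoch hδ x ht
  have h3 := hR.epoch_le hδ ht
  nlinarith [M.p_pos]

theorem tracking_lt (hδ : 0 < δ) (t : ℝ) :
    M.tracking x lam δ G ω t < M.gridTarget lam δ G ω t + M.p * δ := by
  unfold Model.tracking
  linarith [lt_gridFloor_add (M := M) hδ
    (M.surplus x lam ω (M.epoch lam δ ω t) - M.gridTarget lam δ G ω t)]

/-- If the surplus exceeds the target, the reserve is at most their difference; otherwise the
reserve is `0` and everything is paid. With `tracking_lt` this confines the payments to one grid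
step above the target. -/
theorem min_le_tracking (hδ : 0 < δ) (t : ℝ) :
    min (M.gridTarget lam δ G ω t) (M.surplus x lam ω (M.epoch lam δ ω t))
      ≤ M.tracking x lam δ G ω t := by
  unfold Model.tracking
  rcases le_total 0 (M.surplus x lam ω (M.epoch lam δ ω t) - M.gridTarget lam δ G ω t) with h | h
  · exact (min_le_left _ _).trans (by linarith [gridFloor_le (M := M) hδ h])
  · rw [gridFloor_of_nonpos hδ h]
    exact (min_le_right _ _).trans (by linarith)

theorem tracking_congr {s t : ℝ}
    (he : M.eventCount lam ω s = M.eventCount lam ω t)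
    (hep : M.epoch lam δ ω s = M.epoch lam δ ω t) :
    M.tracking x lam δ G ω s = M.tracking x lam δ G ω t := by
  unfold Model.tracking Model.gridTarget
  rw [hep, he]

/-- This is the purpose of the term proportional to `eventCount`: each event lifts the target by as
much as rounding can have overpaid before. -/
theorem gridTarget_step (hR : M.Regular lam ω) (hδ : 0 < δ) (hG : MonotoneOn G (Ici 0)) {u t : ℝ}
    (hu : 0 ≤ u) (hut : u ≤ t) (he : M.eventCount lam ω u < M.eventCount lam ω t) :
    M.gridTarget lam δ G ω u + M.p * δ ≤ M.gridTarget lam δ G ω t := by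
  have hep : M.epoch lam δ ω u ≤ M.epoch lam δ ω t := by
    by_contra! hlt
    have h1 := hR.epoch_le hδ hu
    have h2 := hR.eventCount_mono hlt.le
    rw [hR.eventCount_epoch hδ hu, hR.eventCount_epoch hδ (hu.trans hut)] at h2
    omega
  have h1 := hG (hR.epoch_nonneg hδ u) (hR.epoch_nonneg hδ t) hep
  have h2 : (M.eventCount lam ω u : ℝ) + 1 ≤ M.eventCount lam ω t := by exact_mod_cast he
  have h3 : 0 < M.p * δ := mul_pos M.p_pos hδ
  unfold Model.gridTarget
  nlinarith

/-- Without an event the surplus at epochs rises by `j` grid steps and the target does not fall, so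
the rounded reserve rises by at most `j` steps. Across an event the target passes everything paid
before, and only a surplus below the earlier payments, that is ruin, could prevent paying as much
again. -/
theorem tracking_mono (hR : M.Regular lam ω) (hδ : 0 < δ) (hG : MonotoneOn G (Ici 0)) {u t : ℝ}
    (hu : 0 ≤ u) (hut : u ≤ t) (ht : ¬ M.Overdrawn x lam δ G ω t) :
    M.tracking x lam δ G ω u ≤ M.tracking x lam δ G ω t := by
  rcases (hR.eventCount_mono hut).eq_or_lt with he | he
  · obtain ⟨j, hj⟩ := hR.exists_epoch_eq_add hδ hut he
    have hX : M.surplus x lam ω (M.epoch lam δ ω t)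
        = M.surplus x lam ω (M.epoch lam δ ω u) + j * (M.p * δ) := by
      rw [surplus_eq_add (s := M.epoch lam δ ω u) (t := M.epoch lam δ ω t), hj]
      · ring
      · have h1 : M.epoch lam δ ω u ≤ M.epoch lam δ ω t := by
          rw [hj]; have : 0 ≤ (j : ℝ) * δ := by positivity
          linarith
        exact hR.claimCount_eq h1
          (by rw [hR.eventCount_epoch hδ hu, hR.eventCount_epoch hδ (hu.trans hut), he])
    have hGle : M.gridTarget lam δ G ω u ≤ M.gridTarget lam δ G ω t := by
      unfold Model.gridTarget
      rw [he]
      have := hG (hR.epoch_nonneg hδ u) (hR.epoch_nonneg hδ t)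
        (by rw [hj]; have : 0 ≤ (j : ℝ) * δ := by positivity
            linarith)
      linarith
    have h1 := gridFloor_add_natCast_mul_le (M := M) hδ
      (M.surplus x lam ω (M.epoch lam δ ω u) - M.gridTarget lam δ G ω u) j
    have h2 := gridFloor_mono (M := M) hδ (y := M.surplus x lam ω (M.epoch lam δ ω t)
      - M.gridTarget lam δ G ω t) (z := M.surplus x lam ω (M.epoch lam δ ω u)
      - M.gridTarget lam δ G ω u + j * (M.p * δ)) (by linarith)
    unfold Model.tracking
    linarith
  · have ht0 : 0 ≤ t := hu.trans hut
    have h1 := tracking_lt (x := x) (M := M) (G := G) (lam := lam) (ω := ω) hδ u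
    have h2 := hR.gridTarget_step hδ hG hu hut he
    refine le_trans (le_min (by linarith) ?_) (min_le_tracking hδ t)
    by_contra! hlt
    refine ht ⟨u, M.epoch lam δ ω t, hu, ?_, hR.epoch_le hδ ht0, hlt⟩
    by_contra! hle
    have := hR.eventCount_mono hle
    rw [hR.eventCount_epoch hδ ht0] at this
    omega

theorem gridPath_set_bddAbove (hR : M.Regular lam ω) (hδ : 0 < δ) (t : ℝ) :
    BddAbove {c | ∃ u, 0 ≤ u ∧ u ≤ t ∧ ¬ M.Overdrawn x lam δ G ω u
      ∧ c = M.tracking x lam δ G ω u} := by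
  refine ⟨x + M.p * t, ?_⟩
  rintro c ⟨u, h0, hut, -, rfl⟩
  refine (hR.tracking_le_surplus hδ h0).trans ((hR.surplus_le x u).trans ?_)
  nlinarith [M.p_pos]

theorem le_gridPath (hR : M.Regular lam ω) (hδ : 0 < δ) {u t : ℝ} (hu : 0 ≤ u) (hut : u ≤ t)
    (h : ¬ M.Overdrawn x lam δ G ω u) :
    M.tracking x lam δ G ω u ≤ M.gridPath x lam δ G ω t :=
  le_csSup (hR.gridPath_set_bddAbove hδ t) ⟨u, hu, hut, h, rfl⟩

theorem not_overdrawn_zero : ¬ M.Overdrawn x lam δ G ω 0 := by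
  rintro ⟨u, v, h0, huv, hv, -⟩
  linarith

theorem gridPath_le {t c : ℝ} (ht : 0 ≤ t)
    (h : ∀ u, 0 ≤ u → u ≤ t → ¬ M.Overdrawn x lam δ G ω u → M.tracking x lam δ G ω u ≤ c) :
    M.gridPath x lam δ G ω t ≤ c := by
  refine csSup_le ⟨M.tracking x lam δ G ω 0, 0, le_rfl, ht, not_overdrawn_zero, rfl⟩ ?_
  rintro b ⟨u, h0, hut, hu, rfl⟩
  exact h u h0 hut hu

/-- Taking the running supremum matters only after ruin: it freezes the payments there and is
invisible before, where `tracking` is already monotone. -/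
theorem gridPath_eq (hR : M.Regular lam ω) (hδ : 0 < δ) (hG : MonotoneOn G (Ici 0)) {t : ℝ}
    (ht : 0 ≤ t) (h : ¬ M.Overdrawn x lam δ G ω t) :
    M.gridPath x lam δ G ω t = M.tracking x lam δ G ω t :=
  le_antisymm (gridPath_le ht fun _ h0 hut _ => hR.tracking_mono hδ hG h0 hut h)
    (hR.le_gridPath hδ ht le_rfl h)

theorem gridPath_mono (hR : M.Regular lam ω) (hδ : 0 < δ) {s t : ℝ} (hs : 0 ≤ s) (hst : s ≤ t) :
    M.gridPath x lam δ G ω s ≤ M.gridPath x lam δ G ω t :=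
  gridPath_le hs fun _ h0 hus hu => hR.le_gridPath hδ h0 (hus.trans hst) hu

theorem gridPath_eq_of_overdrawn (hR : M.Regular lam ω) (hδ : 0 < δ) {s t : ℝ} (hs : 0 ≤ s)
    (hst : s ≤ t) (h : M.Overdrawn x lam δ G ω s) :
    M.gridPath x lam δ G ω t = M.gridPath x lam δ G ω s := by
  refine le_antisymm (gridPath_le (hs.trans hst) fun u h0 _ hu => ?_) (hR.gridPath_mono hδ hs hst)
  refine hR.le_gridPath hδ h0 ?_ hu
  by_contra! hlt
  exact hu (h.mono hlt.le)

/-- Ruin occurs at a claim. -/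
theorem Overdrawn.exists_claim (hR : M.Regular lam ω) (hδ : 0 < δ) {t : ℝ}
    (h : M.Overdrawn x lam δ G ω t) :
    ∃ n, M.claimTime lam ω n ≤ t ∧ ∃ u, 0 ≤ u ∧ u < M.claimTime lam ω n ∧
      M.surplus x lam ω (M.claimTime lam ω n) < M.tracking x lam δ G ω u := by
  obtain ⟨u, v, h0, huv, hv, hlt⟩ := h
  have hcount : M.claimCount lam ω u < M.claimCount lam ω v := by
    by_contra! hle
    have := surplus_le_of_claimCount_eq x huv.le (le_antisymm (hR.claimCount_mono huv.le) hle)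
    linarith [hR.tracking_le_surplus (x := x) (G := G) hδ h0]
  obtain ⟨m, hm⟩ : ∃ m, M.claimCount lam ω v = m + 1 := Nat.exists_eq_succ_of_ne_zero (by omega)
  have hmv : M.claimTime lam ω m ≤ v := (hR.lt_claimCount v m).1 (by omega)
  have hum : u < M.claimTime lam ω m := by
    by_contra! hle
    have := (hR.lt_claimCount u m).2 hle
    omega
  refine ⟨m, hmv.trans hv, u, h0, hum, lt_of_le_of_lt ?_ hlt⟩
  apply surplus_le_of_claimCount_eq x hmv
  have h1 := (hR.lt_claimCount (M.claimTime lam ω m) m).2 le_rfl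
  have h2 := hR.claimCount_mono hmv
  omega

/-- Either there is no ruin, or the ruin time is a claim time. -/
theorem overdrawn_dichotomy (hR : M.Regular lam ω) (hδ : 0 < δ) (x : ℝ) (G : ℝ → ℝ) :
    (∀ t, ¬ M.Overdrawn x lam δ G ω t) ∨
    ∃ n, (∀ t, M.Overdrawn x lam δ G ω t ↔ M.claimTime lam ω n ≤ t) ∧
      ∃ u, 0 ≤ u ∧ u < M.claimTime lam ω n ∧
        M.surplus x lam ω (M.claimTime lam ω n) < M.tracking x lam δ G ω u := by
  by_cases hex : ∃ n, ∃ u, 0 ≤ u ∧ u < M.claimTime lam ω n ∧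
      M.surplus x lam ω (M.claimTime lam ω n) < M.tracking x lam δ G ω u
  · classical
    right
    refine ⟨Nat.find hex, fun t => ⟨fun h => ?_, fun h => ?_⟩, Nat.find_spec hex⟩
    · obtain ⟨n, hn, hu⟩ := Overdrawn.exists_claim hR hδ h
      exact (hR.claim_mono.monotone (Nat.find_le hu)).trans hn
    · obtain ⟨u, h0, hlt, hX⟩ := Nat.find_spec hex
      exact ⟨u, _, h0, hlt, h, hX⟩
  · left
    intro t h
    obtain ⟨n, -, hu⟩ := Overdrawn.exists_claim hR hδ h
    exact hex ⟨n, hu⟩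

/-- `tracking` is locally constant on the right. -/
theorem exists_tracking_const (hR : M.Regular lam ω) (hδ : 0 < δ) {t : ℝ} (ht : 0 ≤ t) :
    ∃ t', t < t' ∧ ∀ u, t ≤ u → u < t' →
      M.tracking x lam δ G ω u = M.tracking x lam δ G ω t := by
  refine ⟨min (M.nextEvent lam ω t) (M.epoch lam δ ω t + δ),
    lt_min (hR.lt_nextEvent t) (lt_epoch_add hδ t), fun u htu hu => ?_⟩
  have he := hR.eventCount_of_lt_nextEvent htu (hu.trans_le (min_le_left _ _))
  refine (tracking_congr he ?_).symm
  have hle := hR.epoch_le hδ ht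
  have h0 := hR.epoch_nonneg hδ t
  have hec := hR.eventCount_epoch hδ ht
  -- An epoch is its own epoch: otherwise the two would differ by at least `δ`, contrary to
  -- `lt_epoch_add`.
  have hself : M.epoch lam δ ω (M.epoch lam δ ω t) = M.epoch lam δ ω t := by
    obtain ⟨j, hj⟩ := hR.exists_epoch_eq_add hδ hle hec
    have h1 := hR.epoch_le hδ h0
    rcases Nat.eq_zero_or_pos j with rfl | hj0
    · simpa using hj.symm
    · have h2 := lt_epoch_add (M := M) (lam := lam) (ω := ω) hδ (M.epoch lam δ ω t)
      have : (1 : ℝ) ≤ j := by exact_mod_cast hj0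
      nlinarith
  exact (hR.epoch_congr hδ h0 hself (hle.trans htu) (hu.trans_le (min_le_right _ _))
    (hec.trans he)).symm

/-- Supplies the right-continuity needed for a Stieltjes function. Ruin occurs exactly at a claim,
so a path not yet ruined stays so for a while. -/
theorem exists_gridPath_const (hR : M.Regular lam ω) (hδ : 0 < δ) (hG : MonotoneOn G (Ici 0))
    {t : ℝ} (ht : 0 ≤ t) :
    ∃ t', t < t' ∧ ∀ u, t ≤ u → u < t' →
      M.gridPath x lam δ G ω u = M.gridPath x lam δ G ω t := by
  by_cases h : M.Overdrawn x lam δ G ω t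
  · exact ⟨t + 1, by linarith, fun u htu _ => hR.gridPath_eq_of_overdrawn hδ ht htu h⟩
  obtain ⟨t', htt', hconst⟩ := hR.exists_tracking_const (x := x) (G := G) hδ ht
  rcases hR.overdrawn_dichotomy hδ x G with hn | ⟨n, hn, -⟩
  · refine ⟨t', htt', fun u htu hu => ?_⟩
    rw [hR.gridPath_eq hδ hG ht h, hR.gridPath_eq hδ hG (ht.trans htu) (hn u), hconst u htu hu]
  · refine ⟨min t' (M.claimTime lam ω n), lt_min htt' (not_le.1 fun hle => h ((hn t).2 hle)),
      fun u htu hu => ?_⟩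
    have hu' : ¬ M.Overdrawn x lam δ G ω u := fun hu' =>
      absurd ((hn u).1 hu') (not_le.2 (hu.trans_le (min_le_right _ _)))
    rw [hR.gridPath_eq hδ hG ht h, hR.gridPath_eq hδ hG (ht.trans htu) hu',
      hconst u htu (hu.trans_le (min_le_left _ _))]

theorem gridPath_zero_nonneg (hR : M.Regular lam ω) (hδ : 0 < δ) (hx : 0 ≤ x)
    (hG0 : ∀ t, 0 ≤ t → 0 ≤ G t) : 0 ≤ M.gridPath x lam δ G ω 0 := by
  refine le_trans ?_ (hR.le_gridPath hδ le_rfl le_rfl not_overdrawn_zero)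
  refine le_trans (le_min ?_ ?_) (min_le_tracking hδ 0)
  · have := M.p_pos
    have := hG0 _ (hR.epoch_nonneg hδ 0)
    unfold Model.gridTarget
    positivity
  · rw [hR.epoch_zero]
    have h0 : M.claimCount lam ω 0 = 0 := by
      by_contra h
      have := (hR.lt_claimCount 0 0).1 (Nat.pos_of_ne_zero h)
      linarith [hR.claim_pos 0]
    simpa [Model.surplus, h0]

end Model.Regular

open scoped Classical in
/-- The grid strategy `gridPath` as a right-continuous path; zero on the exceptional samples. -/
def Model.gridDividends (M : Model) (x lam δ : ℝ) (hx : 0 ≤ x) (hδ : 0 < δ) (G : Sample → ℝ → ℝ)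
    (hG : ∀ ω, MonotoneOn (G ω) (Ici 0)) (hG0 : ∀ ω t, 0 ≤ t → 0 ≤ G ω t) : Dividends := fun ω =>
  if hR : M.Regular lam ω then
    { toFun := fun t => if t < 0 then 0 else M.gridPath x lam δ (G ω) ω t
      mono' := by
        intro s t hst
        dsimp only
        split_ifs with h1 h2 h2
        · exact le_rfl
        · exact (hR.gridPath_zero_nonneg hδ hx (hG0 ω)).trans
            (hR.gridPath_mono hδ le_rfl (not_lt.1 h2))
        · linarith
        · exact hR.gridPath_mono hδ (not_lt.1 h1) hst
      right_continuous' := by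
        intro t
        by_cases ht : t < 0
        · refine (continuousWithinAt_const (b := (0 : ℝ))).congr_of_eventuallyEq ?_ (if_pos ht)
          filter_upwards [mem_nhdsWithin_of_mem_nhds (Iio_mem_nhds ht)] with u hu
          exact if_pos hu
        · obtain ⟨t', htt', hc⟩ := hR.exists_gridPath_const (x := x) hδ (hG ω) (not_lt.1 ht)
          refine (continuousWithinAt_const (b := M.gridPath x lam δ (G ω) ω t)).congr_of_eventuallyEq
            ?_ (if_neg ht)
          filter_upwards [mem_nhdsWithin_of_mem_nhds (Iio_mem_nhds htt'), self_mem_nhdsWithin]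
            with u hu hu'
          have hu'' : t ≤ u := hu'
          rw [if_neg (by linarith [not_lt.1 ht] : ¬ u < 0), hc u hu'' hu] }
  else 0

section gridDividends

variable {hx : 0 ≤ x} {hδ : 0 < δ} {G : Sample → ℝ → ℝ} {hG : ∀ ω, MonotoneOn (G ω) (Ici 0)}
  {hG0 : ∀ ω t, 0 ≤ t → 0 ≤ G ω t}

theorem gridDividends_apply (hR : M.Regular lam ω) {t : ℝ} (ht : 0 ≤ t) :
    M.gridDividends x lam δ hx hδ G hG hG0 ω t = M.gridPath x lam δ (G ω) ω t := by
  unfold Model.gridDividends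
  rw [dif_pos hR]
  exact if_neg (not_lt.2 ht)

theorem gridDividends_of_neg {t : ℝ} (ht : t < 0) :
    M.gridDividends x lam δ hx hδ G hG hG0 ω t = 0 := by
  unfold Model.gridDividends
  split_ifs with hR
  · exact if_pos ht
  · rfl

end gridDividends

end

/-! ### Realising the tracking strategy by control actions -/

section

variable {M : Model} {x lam δ : ℝ} {ω : Sample} {G : ℝ → ℝ}

open scoped Classical in
/-- Pay as long as the dividends are below `tracking`, otherwise wait. -/
def Model.trackingAction (M : Model) (x lam δ : ℝ) (G : ℝ → ℝ) (ω : Sample) (s : GridState) :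
    Action :=
  if s.paid < M.tracking x lam δ G ω s.time then .pay else .wait

/-- The situations along the actions `trackingAction`. -/
def Model.trackingState (M : Model) (x lam δ : ℝ) (G : ℝ → ℝ) (ω : Sample) : ℕ → GridState
  | 0 => ⟨0, M.gridFloor δ x, x - M.gridFloor δ x, true⟩
  | k + 1 => M.gridStep x lam δ ω (M.trackingState x lam δ G ω k)
      (M.trackingAction x lam δ G ω (M.trackingState x lam δ G ω k))

theorem gridState_trackingAction (k : ℕ) :
    M.gridState x lam δ ω
      (fun k => M.trackingAction x lam δ G ω (M.trackingState x lam δ G ω k)) k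
      = M.trackingState x lam δ G ω k := by
  induction k with
  | zero => rfl
  | succ k ih => rw [Model.gridState, ih, Model.trackingState]

/-- The invariant of the situations along `trackingAction`. -/
structure Model.IsTracking (M : Model) (x lam δ : ℝ) (G : ℝ → ℝ) (ω : Sample) (s : GridState) :
    Prop where
  time_nonneg : 0 ≤ s.time
  epoch_eq : s.active = true → M.epoch lam δ ω s.time = s.time
  not_overdrawn : s.active = true → ¬ M.Overdrawn x lam δ G ω s.time
  level_eq : s.active = true → s.level = M.surplus x lam ω s.time - s.paid
  level_grid : s.active = true → ∃ j : ℕ, s.level = j * (M.p * δ)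
  paid_le : s.active = true → s.paid ≤ M.tracking x lam δ G ω s.time
  gridPath_eq : s.active = false → ∀ t, s.time ≤ t → M.gridPath x lam δ G ω t = s.paid

namespace Model.Regular

theorem claimCount_zero (hR : M.Regular lam ω) : M.claimCount lam ω 0 = 0 := by
  by_contra h
  have := (hR.lt_claimCount 0 0).1 (Nat.pos_of_ne_zero h)
  linarith [hR.claim_pos 0]

theorem surplus_zero (hR : M.Regular lam ω) : M.surplus x lam ω 0 = x := by
  simp [Model.surplus, hR.claimCount_zero]

theorem gridTarget_nonneg (hR : M.Regular lam ω) (hδ : 0 < δ) (hG0 : ∀ t, 0 ≤ t → 0 ≤ G t)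
    (t : ℝ) : 0 ≤ M.gridTarget lam δ G ω t := by
  have := M.p_pos
  have := hG0 _ (hR.epoch_nonneg hδ t)
  unfold Model.gridTarget
  positivity

theorem isTracking_init (hR : M.Regular lam ω) (hδ : 0 < δ) (hG0 : ∀ t, 0 ≤ t → 0 ≤ G t) :
    M.IsTracking x lam δ G ω ⟨0, M.gridFloor δ x, x - M.gridFloor δ x, true⟩ where
  time_nonneg := le_rfl
  epoch_eq _ := hR.epoch_zero
  not_overdrawn _ := not_overdrawn_zero
  level_eq _ := by simp [hR.surplus_zero]
  level_grid _ := ⟨_, rfl⟩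
  paid_le _ := by
    have h := hR.gridTarget_nonneg hδ hG0 0
    simp only [Model.tracking, hR.epoch_zero, hR.surplus_zero]
    linarith [gridFloor_mono (M := M) hδ (y := x - M.gridTarget lam δ G ω 0) (z := x)
      (by linarith)]
  gridPath_eq h := by simp at h

theorem tracking_of_epoch_eq {s : ℝ} (hs : M.epoch lam δ ω s = s) :
    M.tracking x lam δ G ω s = M.surplus x lam ω s -
      M.gridFloor δ (M.surplus x lam ω s - M.gridTarget lam δ G ω s) := by
  simp only [Model.tracking, hs]

/-- The level and the reserve wanted by `tracking` are both grid points. Paying too little means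
that the level is larger, hence larger by at least one grid step, so one more payment neither
overshoots nor uses an empty surplus. -/
theorem isTracking_pay (hδ : 0 < δ) {s : GridState}
    (hs : M.IsTracking x lam δ G ω s) (ha : s.active = true)
    (hlt : s.paid < M.tracking x lam δ G ω s.time) :
    0 < s.level ∧ M.IsTracking x lam δ G ω ⟨s.time, s.level - M.p * δ, s.paid + M.p * δ, true⟩ := by
  have hg : 0 < M.p * δ := mul_pos M.p_pos hδ
  have hle := hs.level_eq ha
  obtain ⟨j, hj⟩ := hs.level_grid ha
  have htr := tracking_of_epoch_eq (x := x) (G := G) (hs.epoch_eq ha)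
  obtain ⟨i, hi⟩ : ∃ i : ℕ, M.gridFloor δ (M.surplus x lam ω s.time
    - M.gridTarget lam δ G ω s.time) = i * (M.p * δ) := ⟨_, rfl⟩
  have hij : (i : ℝ) < j := by
    have : (i : ℝ) * (M.p * δ) < j * (M.p * δ) := by linarith
    exact lt_of_mul_lt_mul_right this hg.le
  have hij' : i + 1 ≤ j := by exact_mod_cast hij
  have hij'' : (i : ℝ) + 1 ≤ j := by exact_mod_cast hij'
  have hi0 : (0 : ℝ) ≤ i := by positivity
  refine ⟨by rw [hj]; nlinarith, hs.time_nonneg, fun _ => hs.epoch_eq ha,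
    fun _ => hs.not_overdrawn ha, fun _ => ?_, fun _ => ⟨j - 1, ?_⟩, fun _ => ?_, fun h => ?_⟩
  · simp only [hle]; ring
  · rw [Nat.cast_sub (by omega)]; simp only [hj]; push_cast; ring
  · have : (i : ℝ) * (M.p * δ) + M.p * δ ≤ j * (M.p * δ) := by nlinarith
    simp only
    linarith
  · simp at h

theorem tracking_of_lt_waitEnd (hR : M.Regular lam ω) (hδ : 0 < δ) {s u : ℝ} (hs0 : 0 ≤ s)
    (hs : M.epoch lam δ ω s = s) (hsu : s ≤ u) (hu : u < M.waitEnd lam δ ω s) :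
    M.tracking x lam δ G ω u = M.tracking x lam δ G ω s :=
  (tracking_congr (hR.eventCount_of_lt_waitEnd hsu hu)
    (by rw [hs, hR.epoch_of_lt_waitEnd hδ hs0 hs hsu hu])).symm

/-- While waiting, the surplus only grows and `tracking` is constant, so ruin can appear only at the
end of the wait. -/
theorem not_overdrawn_of_lt_waitEnd (hR : M.Regular lam ω) (hδ : 0 < δ)
    (hG : MonotoneOn G (Ici 0)) {s t : ℝ}
    (hs0 : 0 ≤ s) (hs : M.epoch lam δ ω s = s) (hn : ¬ M.Overdrawn x lam δ G ω s)
    (ht : t < M.waitEnd lam δ ω s) : ¬ M.Overdrawn x lam δ G ω t := by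
  rintro ⟨u, v, hu, huv, hvt, hlt⟩
  rcases le_or_gt v s with hvs | hsv
  · exact hn ⟨u, v, hu, huv, hvs, hlt⟩
  have hv : v < M.waitEnd lam δ ω s := hvt.trans_lt ht
  have hX := surplus_le_of_claimCount_eq x hsv.le
    (hR.claimCount_eq hsv.le (hR.eventCount_of_lt_waitEnd hsv.le hv))
  have hC := hR.tracking_le_surplus (x := x) (G := G) hδ hs0
  rcases le_or_gt u s with hus | hsu
  · linarith [hR.tracking_mono hδ hG hu hus hn]
  · rw [hR.tracking_of_lt_waitEnd hδ hs0 hs hsu.le (huv.trans hv)] at hlt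
    linarith

/-- A wait ends in ruin, after which the path is frozen at the amount paid, or at a new epoch. There
the compulsory rounding payment must not exceed what `tracking` pays; further `pay` actions can make
up a shortfall but cannot undo an excess. -/
theorem isTracking_wait (hR : M.Regular lam ω) (hδ : 0 < δ) (hG : MonotoneOn G (Ici 0))
    {s : GridState} (hs : M.IsTracking x lam δ G ω s) (ha : s.active = true)
    (hpaid : s.paid = M.tracking x lam δ G ω s.time) :
    M.IsTracking x lam δ G ω (M.gridStep x lam δ ω s .wait) := by
  have hg : 0 < M.p * δ := mul_pos M.p_pos hδ
  have hs0 := hs.time_nonneg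
  have hep := hs.epoch_eq ha
  have hn := hs.not_overdrawn ha
  have hle := hs.level_eq ha
  have hlt := hR.lt_waitEnd hδ s.time
  have htr := tracking_of_epoch_eq (x := x) (G := G) hep
  have hC := hR.tracking_le_surplus (x := x) (G := G) hδ hs0
  unfold Model.gridStep
  rw [if_pos ha]
  set r := M.waitEnd lam δ ω s.time with hr
  have hy : s.level + (M.surplus x lam ω r - M.surplus x lam ω s.time)
      = M.surplus x lam ω r - s.paid := by rw [hle]; ring
  have hr0 : 0 ≤ r := hs0.trans hlt.le
  have hCu : ∀ u, 0 ≤ u → u < r → M.tracking x lam δ G ω u ≤ s.paid := by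
    intro u hu hur
    rw [hpaid]
    rcases le_or_gt u s.time with h | h
    · exact hR.tracking_mono hδ hG hu h hn
    · exact (hR.tracking_of_lt_waitEnd hδ hs0 hep h.le hur).le
  dsimp only
  rw [hy]
  split_ifs with h
  · refine ⟨hr0, by simp, by simp, by simp, by simp, by simp, fun _ t ht => ?_⟩
    simp only at ht ⊢
    have hover : M.Overdrawn x lam δ G ω r := ⟨s.time, r, hs0, hlt, le_rfl, by linarith⟩
    apply le_antisymm
    · refine gridPath_le (hr0.trans ht) fun u hu _ hun => hCu u hu ?_
      by_contra! hru
      exact hun (hover.mono hru)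
    · rw [hpaid]
      exact hR.le_gridPath hδ hs0 (hlt.le.trans ht) hn
  · have h' : 0 ≤ M.surplus x lam ω r - s.paid := not_lt.1 h
    refine ⟨hr0, fun _ => hR.epoch_waitEnd hδ hs0 hep, fun _ => ?_, fun _ => ?_,
      fun _ => ⟨_, rfl⟩, fun _ => ?_, by simp⟩
    · rintro ⟨u, v, hu, huv, hvt, hXv⟩
      rcases lt_or_eq_of_le hvt with hvr | hvr
      · exact hR.not_overdrawn_of_lt_waitEnd hδ hG hs0 hep hn hvr ⟨u, v, hu, huv, le_rfl, hXv⟩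
      · rw [hvr] at hXv huv
        linarith [hCu u hu huv]
    · simp only
      ring
    · simp only
      rw [tracking_of_epoch_eq (hR.epoch_waitEnd hδ hs0 hep)]
      suffices hfl : M.gridFloor δ (M.surplus x lam ω r - M.gridTarget lam δ G ω r)
          ≤ M.gridFloor δ (M.surplus x lam ω r - s.paid) by linarith
      -- If the full time `δ` elapses, the level rises by exactly one grid step and nothing is paid,
      -- while the wanted reserve rises by at most that step. If an event occurs, the target has
      -- risen above all earlier payments, so the wanted reserve is at most the rounded level.
      rcases (hR.eventCount_mono hlt.le).eq_or_lt with he | he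
      · have hnext : ¬ M.nextEvent lam ω s.time ≤ r := fun hc => by
          have := hR.eventCount_lt_of_nextEvent_le hc
          omega
        have hrd : r = s.time + δ := by
          have h1 := hR.waitEnd_eq (δ := δ) s.time
          rcases min_choice (s.time + δ) (M.nextEvent lam ω s.time) with h2 | h2
          · rw [hr, h1, h2]
          · exact absurd (h2.symm.trans h1.symm).le hnext
        have hX : M.surplus x lam ω r = M.surplus x lam ω s.time + M.p * δ := by
          rw [surplus_eq_add x (hR.claimCount_eq hlt.le he), hrd]; ring
        have hGle : M.gridTarget lam δ G ω s.time ≤ M.gridTarget lam δ G ω r := by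
          unfold Model.gridTarget
          rw [he, hep, hR.epoch_waitEnd hδ hs0 hep]
          linarith [hG hs0 hr0 hlt.le]
        have e1 : M.surplus x lam ω r - s.paid = (⌊(M.surplus x lam ω s.time
            - M.gridTarget lam δ G ω s.time) / (M.p * δ)⌋₊ + 1 : ℕ) * (M.p * δ) := by
          rw [hX, hpaid, htr, Model.gridFloor]; push_cast; ring
        have h1 := gridFloor_add_natCast_mul_le (M := M) hδ (M.surplus x lam ω s.time
            - M.gridTarget lam δ G ω s.time) 1
        have h2 := gridFloor_mono (M := M) hδ (y := M.surplus x lam ω r - M.gridTarget lam δ G ω r)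
          (z := M.surplus x lam ω s.time - M.gridTarget lam δ G ω s.time + (1 : ℕ) * (M.p * δ))
          (by push_cast; linarith)
        rw [e1, gridFloor_natCast_mul hδ, ← e1, hX, hpaid, htr]
        rw [hX] at h2
        push_cast at h1 h2
        linarith
      · have h1 := hR.gridTarget_step hδ hG hs0 hlt.le he
        have h2 := tracking_lt (x := x) (M := M) (G := G) (lam := lam) (ω := ω) hδ s.time
        exact gridFloor_mono hδ (by linarith)

theorem isTracking_step (hR : M.Regular lam ω) (hδ : 0 < δ) (hG : MonotoneOn G (Ici 0))
    {s : GridState} (hs : M.IsTracking x lam δ G ω s) :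
    M.IsTracking x lam δ G ω (M.gridStep x lam δ ω s (M.trackingAction x lam δ G ω s)) := by
  by_cases ha : s.active = true
  · unfold Model.trackingAction
    split_ifs with h
    · have := (isTracking_pay hδ hs ha h).2
      unfold Model.gridStep
      rwa [if_pos ha]
    · exact hR.isTracking_wait hδ hG hs ha (le_antisymm (hs.paid_le ha) (not_lt.1 h))
  · unfold Model.gridStep
    rwa [if_neg ha]

theorem isTracking_trackingState (hR : M.Regular lam ω) (hδ : 0 < δ) (hG : MonotoneOn G (Ici 0))
    (hG0 : ∀ t, 0 ≤ t → 0 ≤ G t) (k : ℕ) :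
    M.IsTracking x lam δ G ω (M.trackingState x lam δ G ω k) := by
  induction k with
  | zero => exact hR.isTracking_init hδ hG0
  | succ k ih => exact hR.isTracking_step hδ hG ih

/-- A `pay` takes no time and so imposes no condition on the path. A `wait` starts only once the
amount paid equals `tracking`, which then stays constant until the wait ends. The business is never
closed, hence the closing time `⊤`. -/
theorem follows_gridPath (hR : M.Regular lam ω) (hδ : 0 < δ)
    (hG : MonotoneOn G (Ici 0)) (hG0 : ∀ t, 0 ≤ t → 0 ≤ G t) {ℓ : ℝ → ℝ}
    (hℓ : ∀ t, 0 ≤ t → ℓ t = M.gridPath x lam δ G ω t) :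
    M.Follows x lam δ ω (fun k => M.trackingAction x lam δ G ω (M.trackingState x lam δ G ω k))
      ℓ ⊤ := by
  have hno : ∀ s, M.trackingAction x lam δ G ω s ≠ .close := fun s => by
    unfold Model.trackingAction
    split_ifs <;> simp
  simp only [Model.Follows, gridState_trackingAction]
  refine ⟨fun k ha hk => ?_, fun k t hkt hlt => ?_, fun k _ hk => absurd hk (hno _), fun _ => trivial⟩
  · have hs := hR.isTracking_trackingState (x := x) hδ hG hG0 k
    refine (isTracking_pay hδ hs ha ?_).1
    by_contra h
    simp [Model.trackingAction, h] at hk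
  · have hs := hR.isTracking_trackingState (x := x) hδ hG hG0 k
    rw [hℓ t (hs.time_nonneg.trans hkt)]
    by_cases ha : (M.trackingState x lam δ G ω k).active = true
    · simp only [Model.trackingState, ha, Bool.true_eq_false, or_false] at hlt
      unfold Model.gridStep at hlt
      rw [if_pos ha] at hlt
      unfold Model.trackingAction at hlt
      split_ifs at hlt with h
      · simp only at hlt
        linarith
      · simp only at hlt
        have hlt' : t < M.waitEnd lam δ ω (M.trackingState x lam δ G ω k).time := by
          split_ifs at hlt <;> exact hlt
        rw [hR.gridPath_eq hδ hG (hs.time_nonneg.trans hkt)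
          (hR.not_overdrawn_of_lt_waitEnd hδ hG hs.time_nonneg (hs.epoch_eq ha)
            (hs.not_overdrawn ha) hlt'),
          hR.tracking_of_lt_waitEnd hδ hs.time_nonneg (hs.epoch_eq ha) hkt hlt']
        exact le_antisymm (not_lt.1 h) (hs.paid_le ha)
    · exact hs.gridPath_eq (by simpa using ha) t hkt

end Model.Regular

section gridDividends

variable {hx : 0 ≤ x} {hδ : 0 < δ} {G : Sample → ℝ → ℝ} {hG : ∀ ω, MonotoneOn (G ω) (Ici 0)}
  {hG0 : ∀ ω t, 0 ≤ t → 0 ≤ G ω t}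

/-- Ties the pathwise ruin to the ruin time of the model, which uses left limits. At the ruinous
claim the left limit dominates an earlier payment; conversely, before it the payments never exceed
the surplus. -/
theorem overdrawn_iff_ruinTime_le (hR : M.Regular lam ω) {t : ℝ} (ht : 0 ≤ t) :
    M.Overdrawn x lam δ (G ω) ω t ↔
      M.ruinTime x lam (M.gridDividends x lam δ hx hδ G hG hG0) ω ≤ ENNReal.ofReal t := by
  constructor
  · intro h
    rcases hR.overdrawn_dichotomy hδ x (G ω) with hn | ⟨n, hn, u, hu, huv, hlt⟩
    · exact absurd h (hn t)
    · have hnu : ¬ M.Overdrawn x lam δ (G ω) ω u := fun hc => absurd ((hn u).1 hc) (not_le.2 huv)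
      have h1 := (M.gridDividends x lam δ hx hδ G hG hG0 ω).mono.le_leftLim huv
      rw [gridDividends_apply hR hu, hR.gridPath_eq hδ (hG ω) hu hnu] at h1
      have h2 : M.ruinTime x lam (M.gridDividends x lam δ hx hδ G hG hG0) ω
          ≤ ENNReal.ofReal (M.claimTime lam ω n) :=
        sInf_le ⟨_, (hR.claim_pos n).le, by linarith, rfl⟩
      exact h2.trans (ENNReal.ofReal_le_ofReal ((hn t).1 h))
  · intro h
    by_contra hno
    -- The ruin time is an infimum, so excluding ruin up to `t` would not exclude that it equals
    -- `t`; since ruin starts at a claim, there is room to the right of `t`.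
    obtain ⟨t', htt', ht'⟩ : ∃ t', t < t' ∧ ¬ M.Overdrawn x lam δ (G ω) ω t' := by
      rcases hR.overdrawn_dichotomy hδ x (G ω) with hn | ⟨n, hn, -⟩
      · exact ⟨t + 1, by linarith, hn _⟩
      · obtain ⟨t', h1, h2⟩ := exists_between (not_le.1 fun hle => hno ((hn t).2 hle))
        exact ⟨t', h1, fun hc => absurd ((hn t').1 hc) (not_le.2 h2)⟩
    have hle : ENNReal.ofReal t' ≤
        M.ruinTime x lam (M.gridDividends x lam δ hx hδ G hG hG0) ω := by
      apply le_sInf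
      rintro _ ⟨v, hv, hlt, rfl⟩
      apply ENNReal.ofReal_le_ofReal
      by_contra! hvt
      have hnv : ¬ M.Overdrawn x lam δ (G ω) ω v := fun hc => ht' (hc.mono hvt.le)
      have h1 := (M.gridDividends x lam δ hx hδ G hG hG0 ω).mono.leftLim_le (le_refl v)
      rw [gridDividends_apply hR hv, hR.gridPath_eq hδ (hG ω) hv hnv] at h1
      linarith [hR.tracking_le_surplus (x := x) (G := G ω) hδ hv]
    have := (ENNReal.ofReal_lt_ofReal_iff_of_nonneg ht).2 htt'
    exact absurd (hle.trans h) (not_le.2 this)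

end gridDividends

end

/-! ### Halving the grid step -/

section

variable {M : Model} {x lam δ : ℝ} {ω : Sample} {G : ℝ → ℝ}

theorem exists_seq_of_step {E : Type*} {I : E → Prop} {R : E → E → Prop}
    (h : ∀ e, I e → ∃ e', I e' ∧ R e e') {e₀ : E} (h₀ : I e₀) :
    ∃ s : ℕ → E, s 0 = e₀ ∧ ∀ n, I (s n) ∧ R (s n) (s (n + 1)) := by
  choose! f hf using h
  refine ⟨fun n => f^[n] e₀, rfl, fun n => ?_⟩
  have hI : ∀ n, I (f^[n] e₀) := fun n => by
    induction n with
    | zero => exact h₀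
    | succ n ih => rw [Function.iterate_succ_apply']; exact (hf _ ih).1
  exact ⟨hI n, by simpa only [Function.iterate_succ_apply'] using (hf _ (hI n)).2⟩

theorem Model.gridStep_pay {s : GridState} (h : s.active = true) :
    M.gridStep x lam δ ω s .pay = ⟨s.time, s.level - M.p * δ, s.paid + M.p * δ, true⟩ := by
  unfold Model.gridStep
  rw [if_pos h]

theorem Model.gridStep_close {s : GridState} (h : s.active = true) :
    M.gridStep x lam δ ω s .close = ⟨s.time, s.level, s.paid, false⟩ := by
  unfold Model.gridStep
  rw [if_pos h]

theorem Model.gridStep_of_not_active {s : GridState} (h : s.active = false) (a : Action) :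
    M.gridStep x lam δ ω s a = s := by
  unfold Model.gridStep
  rw [if_neg (by simp [h])]

theorem Model.gridStep_wait_time {s : GridState} (h : s.active = true) :
    (M.gridStep x lam δ ω s .wait).time = M.waitEnd lam δ ω s.time := by
  unfold Model.gridStep
  rw [if_pos h]
  dsimp only
  split_ifs <;> rfl

theorem Model.gridStep_wait_of_neg {s : GridState} {r y : ℝ} (h : s.active = true)
    (hr : M.waitEnd lam δ ω s.time = r)
    (hy : s.level + (M.surplus x lam ω r - M.surplus x lam ω s.time) = y) (hy0 : y < 0) :
    M.gridStep x lam δ ω s .wait = ⟨r, y, s.paid, false⟩ := by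
  unfold Model.gridStep
  rw [if_pos h]
  dsimp only
  rw [hr, hy, if_pos hy0]

theorem Model.gridStep_wait_of_nonneg {s : GridState} {r y : ℝ} (h : s.active = true)
    (hr : M.waitEnd lam δ ω s.time = r)
    (hy : s.level + (M.surplus x lam ω r - M.surplus x lam ω s.time) = y) (hy0 : 0 ≤ y) :
    M.gridStep x lam δ ω s .wait
      = ⟨r, M.gridFloor δ y, s.paid + (y - M.gridFloor δ y), true⟩ := by
  unfold Model.gridStep
  rw [if_pos h]
  dsimp only
  rw [hr, hy, if_neg (not_lt.2 hy0)]

theorem gridState_not_active_of_le {a : ℕ → Action} {j k : ℕ} (hjk : j ≤ k)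
    (h : (M.gridState x lam δ ω a j).active = false) :
    M.gridState x lam δ ω a k = M.gridState x lam δ ω a j := by
  induction k, hjk using Nat.le_induction with
  | base => rfl
  | succ k _ ih => rw [Model.gridState, ih, Model.gridStep_of_not_active h]

theorem gridState_not_active_of_close {a : ℕ → Action} {j k : ℕ} (hjk : j < k)
    (h : (M.gridState x lam δ ω a j).active = true) (ha : a j = .close) :
    (M.gridState x lam δ ω a k).active = false := by
  have h1 : (M.gridState x lam δ ω a (j + 1)).active = false := by
    rw [Model.gridState, ha, Model.gridStep_close h]
  rw [gridState_not_active_of_le hjk h1, h1]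

/-- The fine grid contains the coarse one, so the fine rounding retains at least as much, and the
difference is a multiple of the fine step. -/
theorem exists_gridFloor_half (hδ : 0 < δ) (y : ℝ) :
    ∃ j : ℕ, M.gridFloor (δ / 2) y = M.gridFloor δ y + j * (M.p * (δ / 2)) := by
  have hg : 0 < M.p * δ := mul_pos M.p_pos hδ
  have h1 : 2 * ⌊y / (M.p * δ)⌋₊ ≤ ⌊y / (M.p * (δ / 2))⌋₊ := by
    rcases le_total 0 y with hy | hy
    · apply Nat.le_floor
      have := Nat.floor_le (a := y / (M.p * δ)) (by positivity)
      rw [le_div_iff₀ hg] at this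
      rw [le_div_iff₀ (by linarith)]
      push_cast
      linarith
    · rw [Nat.floor_of_nonpos (div_nonpos_of_nonpos_of_nonneg hy hg.le)]
      simp
  obtain ⟨j, hj⟩ := Nat.exists_eq_add_of_le h1
  refine ⟨j, ?_⟩
  unfold Model.gridFloor
  rw [hj]
  push_cast
  ring

section follows

variable {a : ℕ → Action} {ℓ : ℝ → ℝ} {F : ℝ≥0∞}

theorem Model.Follows.exists_level (hF : M.Follows x lam δ ω a ℓ F) (hδ : 0 < δ) (k : ℕ)
    (hk : (M.gridState x lam δ ω a k).active = true) :
    ∃ j : ℕ, (M.gridState x lam δ ω a k).level = j * (M.p * δ) := by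
  have hg : 0 < M.p * δ := mul_pos M.p_pos hδ
  induction k with
  | zero => exact ⟨_, rfl⟩
  | succ k ih =>
    have hak : (M.gridState x lam δ ω a k).active = true := by
      by_contra h
      have h' : (M.gridState x lam δ ω a k).active = false := by simpa using h
      rw [gridState_not_active_of_le (Nat.le_succ k) h', h'] at hk
      exact absurd hk (by simp)
    rw [Model.gridState] at hk ⊢
    cases hact : a k with
    | wait =>
      rw [hact] at hk
      rcases lt_or_ge ((M.gridState x lam δ ω a k).level +
        (M.surplus x lam ω (M.waitEnd lam δ ω (M.gridState x lam δ ω a k).time)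
          - M.surplus x lam ω (M.gridState x lam δ ω a k).time)) 0 with h | h
      · rw [Model.gridStep_wait_of_neg hak rfl rfl h] at hk
        exact absurd hk (by simp)
      · rw [Model.gridStep_wait_of_nonneg hak rfl rfl h]
        exact ⟨_, rfl⟩
    | pay =>
      obtain ⟨j, hj⟩ := ih hak
      have h0 := hF.1 k hak hact
      rw [Model.gridStep_pay hak]
      have hj0 : 1 ≤ j := by
        by_contra hc
        have : j = 0 := by omega
        rw [hj, this] at h0
        simp at h0
      refine ⟨j - 1, ?_⟩
      simp only [hj]
      rw [Nat.cast_sub hj0]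
      push_cast
      ring
    | close =>
      rw [hact, Model.gridStep_close hak] at hk
      exact absurd hk (by simp)

/-- After finitely many payments the next action is not a payment. -/
theorem Model.Follows.exists_not_pay (hF : M.Follows x lam δ ω a ℓ F) (hδ : 0 < δ) {k : ℕ}
    (hk : (M.gridState x lam δ ω a k).active = true) :
    ∃ k' i : ℕ, k ≤ k' ∧ a k' ≠ .pay ∧ M.gridState x lam δ ω a k' =
      ⟨(M.gridState x lam δ ω a k).time, (M.gridState x lam δ ω a k).level - i * (M.p * δ),
        (M.gridState x lam δ ω a k).paid + i * (M.p * δ), true⟩ := by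
  have hg : 0 < M.p * δ := mul_pos M.p_pos hδ
  obtain ⟨j, hj⟩ := hF.exists_level hδ k hk
  induction j generalizing k with
  | zero =>
    refine ⟨k, 0, le_rfl, fun hc => ?_, ?_⟩
    · have := hF.1 k hk hc
      rw [hj] at this
      simp at this
    · rw [← hk]; simp
  | succ j ih =>
    by_cases hc : a k = .pay
    · have hs : M.gridState x lam δ ω a (k + 1) = ⟨(M.gridState x lam δ ω a k).time,
          (M.gridState x lam δ ω a k).level - M.p * δ,
          (M.gridState x lam δ ω a k).paid + M.p * δ, true⟩ := by
        rw [Model.gridState, hc, Model.gridStep_pay hk]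
      obtain ⟨k', i, hkk', hne, h⟩ := ih (k := k + 1) (by rw [hs])
        (by rw [hs]; simp only [hj]; push_cast; ring)
      refine ⟨k', i + 1, by omega, hne, ?_⟩
      rw [h, hs]
      simp only [GridState.mk.injEq, true_and, and_true]
      push_cast
      constructor <;> ring
    · exact ⟨k, 0, le_rfl, hc, by rw [← hk]; simp⟩

/-- The relation between the situations of the grid strategy with step `δ` and the situations of
its simulation with step `δ / 2`: `s` is the fine situation, `k` the index of the coarse one, and
`j` decreases while `k` is unchanged. -/
def Model.Linked (M : Model) (x lam δ : ℝ) (ω : Sample) (a : ℕ → Action) (ℓ : ℝ → ℝ)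
    (e : GridState × ℕ × ℕ) : Prop :=
  (∃ j : ℕ, (M.gridState x lam δ ω a e.2.1).active = true ∧ a e.2.1 ≠ .pay ∧ e.2.2 = j + 1 ∧
    e.1 = ⟨(M.gridState x lam δ ω a e.2.1).time,
      (M.gridState x lam δ ω a e.2.1).level + j * (M.p * (δ / 2)),
      (M.gridState x lam δ ω a e.2.1).paid - j * (M.p * (δ / 2)), true⟩) ∨
  ((M.gridState x lam δ ω a e.2.1).active = true ∧ a e.2.1 = .wait ∧ e.2.2 = 0 ∧
    (M.gridState x lam δ ω a e.2.1).time + δ / 2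
      < M.waitEnd lam δ ω (M.gridState x lam δ ω a e.2.1).time ∧
    e.1 = ⟨(M.gridState x lam δ ω a e.2.1).time + δ / 2,
      (M.gridState x lam δ ω a e.2.1).level + M.p * (δ / 2),
      (M.gridState x lam δ ω a e.2.1).paid, true⟩) ∨
  (e.1.active = false ∧ ∀ t, e.1.time ≤ t → ℓ t = e.1.paid)

/-- The requirements on one step of the simulation. -/
def Model.LinkedStep (M : Model) (x lam δ : ℝ) (ω : Sample) (ℓ : ℝ → ℝ)
    (F : ℝ≥0∞) (e e' : GridState × ℕ × ℕ) : Prop :=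
  ∃ b : Action, e'.1 = M.gridStep x lam (δ / 2) ω e.1 b ∧
    (e.1.active = true → b = .pay → 0 < e.1.level) ∧
    (∀ t, e.1.time ≤ t → (t < e'.1.time ∨ e.1.active = false) → ℓ t = e.1.paid) ∧
    (e.1.active = true → b = .close → F = ENNReal.ofReal e.1.time) ∧
    (e.1.active = true → b ≠ .close → F ≠ ⊤ → e'.1.active = true ∧
      (e.2.1 < e'.2.1 ∨ e.2.1 = e'.2.1 ∧ e'.2.2 < e.2.2))

/-- After rounding, the fine strategy still holds `j` fine steps more than the coarse one. The `i`
coarse payments that follow at the same instant become `2 * i` fine ones, so `j + 2 * i` fine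
payments are outstanding. -/
theorem Model.Follows.linked_of_gridFloor (hF : M.Follows x lam δ ω a ℓ F) (hδ : 0 < δ) {k : ℕ}
    {r y c : ℝ} (hk : M.gridState x lam δ ω a k
      = ⟨r, M.gridFloor δ y, c + (y - M.gridFloor δ y), true⟩) :
    ∃ k' i : ℕ, k ≤ k' ∧ M.Linked x lam δ ω a ℓ
      (⟨r, M.gridFloor (δ / 2) y, c + (y - M.gridFloor (δ / 2) y), true⟩, k', i) := by
  obtain ⟨k', i, hkk', hne, h⟩ := hF.exists_not_pay hδ (k := k) (by rw [hk])
  obtain ⟨j, hj⟩ := exists_gridFloor_half (M := M) hδ y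
  refine ⟨k', _, hkk', Or.inl ⟨j + 2 * i, by rw [h], hne, rfl, ?_⟩⟩
  rw [h, hk]
  simp only [GridState.mk.injEq, true_and, and_true, hj]
  push_cast
  constructor <;> ring

theorem Model.Follows.eq_top_of_ruin (hF : M.Follows x lam δ ω a ℓ F) {k : ℕ}
    (hak : (M.gridState x lam δ ω a k).active = true)
    (hk : a k ≠ .close) (h : (M.gridState x lam δ ω a (k + 1)).active = false) : F = ⊤ := by
  refine hF.2.2.2 fun j hj hc => ?_
  rcases lt_trichotomy j k with hlt | rfl | hlt
  · rw [gridState_not_active_of_close hlt hj hc] at hak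
    exact absurd hak (by simp)
  · exact hk hc
  · rw [gridState_not_active_of_le hlt h, h] at hj
    exact absurd hj (by simp)

/-- If a fine and a coarse wait end at the same time with the same unrounded level, either both are
ruined, or both round and the fine strategy then has finitely many payments to make up. -/
theorem Model.Follows.linked_of_wait (hF : M.Follows x lam δ ω a ℓ F) (hδ : 0 < δ) {k : ℕ}
    (hk : (M.gridState x lam δ ω a k).active = true) (hak : a k = .wait) {s : GridState} {r : ℝ}
    (hs : s.active = true) (hr : M.waitEnd lam δ ω (M.gridState x lam δ ω a k).time = r)
    (hr' : M.waitEnd lam (δ / 2) ω s.time = r)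
    (hlevel : s.level + (M.surplus x lam ω r - M.surplus x lam ω s.time)
      = (M.gridState x lam δ ω a k).level
        + (M.surplus x lam ω r - M.surplus x lam ω (M.gridState x lam δ ω a k).time))
    (hpaid : s.paid = (M.gridState x lam δ ω a k).paid) :
    ∃ k' i : ℕ, M.Linked x lam δ ω a ℓ (M.gridStep x lam (δ / 2) ω s .wait, k', i) ∧
      (F ≠ ⊤ → (M.gridStep x lam (δ / 2) ω s .wait).active = true ∧ k < k') := by
  have hstep : M.gridState x lam δ ω a (k + 1)
      = M.gridStep x lam δ ω (M.gridState x lam δ ω a k) .wait := by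
    rw [Model.gridState, hak]
  rcases lt_or_ge (s.level + (M.surplus x lam ω r - M.surplus x lam ω s.time)) 0 with h | h
  · rw [Model.gridStep_wait_of_neg hs hr' rfl h]
    rw [Model.gridStep_wait_of_neg hk hr hlevel.symm h] at hstep
    refine ⟨k + 1, 0, Or.inr (Or.inr ⟨rfl, fun t ht => ?_⟩), fun hne => ?_⟩
    · have := hF.2.1 (k + 1) t (by rw [hstep]; exact ht) (Or.inr (by rw [hstep]))
      rw [this, hstep, hpaid]
    · exact absurd (hF.eq_top_of_ruin hk (by simp [hak]) (by rw [hstep])) hne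
  · rw [Model.gridStep_wait_of_nonneg hs hr' rfl h]
    rw [Model.gridStep_wait_of_nonneg hk hr hlevel.symm h, ← hpaid] at hstep
    obtain ⟨k', i, hkk', hl⟩ := hF.linked_of_gridFloor hδ hstep
    exact ⟨k', i, hl, fun _ => ⟨rfl, hkk'⟩⟩

/-- The fine strategy first makes its outstanding payments, then copies the coarse action. A coarse
wait is copied by one fine wait if this ends at the same time; otherwise the half step comes first
and a second fine wait completes it. -/
theorem Model.Follows.exists_linkedStep (hF : M.Follows x lam δ ω a ℓ F) (hR : M.Regular lam ω)
    (hδ : 0 < δ) (e : GridState × ℕ × ℕ) (he : M.Linked x lam δ ω a ℓ e) :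
    ∃ e', M.Linked x lam δ ω a ℓ e' ∧ M.LinkedStep x lam δ ω ℓ F e e' := by
  have hg : 0 < M.p * δ := mul_pos M.p_pos hδ
  obtain ⟨s, k, i⟩ := e
  rcases he with ⟨j, hk, hne, hij, hs⟩ | ⟨hk, hak, hi, hlt, hs⟩ | ⟨hs, hℓ⟩
  · simp only at hk hne hij hs
    have hsa : s.active = true := by rw [hs]
    obtain ⟨m, hm⟩ := hF.exists_level hδ k hk
    cases j with
    | succ j =>
      refine ⟨(M.gridStep x lam (δ / 2) ω s .pay, k, i - 1),
        Or.inl ⟨j, hk, hne, by simp [hij], ?_⟩, .pay, rfl, ?_, ?_, ?_, ?_⟩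
      · simp only
        rw [Model.gridStep_pay hsa, hs]
        simp only [GridState.mk.injEq, true_and, and_true]
        push_cast
        constructor <;> ring
      · intro _ _
        rw [hs]
        simp only [hm]
        push_cast
        have : 0 ≤ (m : ℝ) * (M.p * δ) := by positivity
        have : 0 ≤ (j : ℝ) * (M.p * δ) := by positivity
        nlinarith
      · simp only [Model.gridStep_pay hsa, hsa, Bool.true_eq_false, or_false]
        intro t h1 h2
        linarith
      · simp
      · intro _ _ _
        simp only [Model.gridStep_pay hsa]
        exact ⟨trivial, Or.inr ⟨trivial, by omega⟩⟩
    | zero =>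
      have hs' : s = M.gridState x lam δ ω a k := by
        rw [hs, ← hk]; simp
      cases hak : a k with
      | pay => exact absurd hak hne
      | close =>
        have hstep : M.gridState x lam δ ω a (k + 1)
            = M.gridStep x lam δ ω (M.gridState x lam δ ω a k) .close := by
          rw [Model.gridState, hak]
        rw [Model.gridStep_close hk] at hstep
        refine ⟨(M.gridStep x lam (δ / 2) ω s .close, k, i), Or.inr (Or.inr ⟨?_, fun t ht => ?_⟩),
          .close, rfl, by simp, ?_, ?_, by simp⟩
        · rw [Model.gridStep_close hsa]
        · simp only [Model.gridStep_close hsa] at ht ⊢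
          rw [hF.2.1 (k + 1) t (by rw [hstep, ← hs']; exact ht) (Or.inr (by rw [hstep])), hstep,
            ← hs']
        · simp only [Model.gridStep_close hsa, hsa, Bool.true_eq_false, or_false]
          intro t h1 h2
          linarith
        · intro _ _
          rw [hF.2.2.1 k hk hak, hs']
      | wait =>
        have hstep : M.gridState x lam δ ω a (k + 1)
            = M.gridStep x lam δ ω (M.gridState x lam δ ω a k) .wait := by
          rw [Model.gridState, hak]
        have htime : (M.gridState x lam δ ω a (k + 1)).time = M.waitEnd lam δ ω s.time := by
          rw [hstep, Model.gridStep_wait_time hk, hs']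
        have hle : M.waitEnd lam (δ / 2) ω s.time ≤ M.waitEnd lam δ ω s.time := by
          rw [hR.waitEnd_eq, hR.waitEnd_eq]
          exact min_le_min_right _ (by linarith)
        have hpath : ∀ t, s.time ≤ t → (t < (M.gridStep x lam (δ / 2) ω s .wait).time
            ∨ s.active = false) → ℓ t = s.paid := by
          simp only [Model.gridStep_wait_time hsa, hsa, Bool.true_eq_false, or_false]
          intro t h1 h2
          rw [hF.2.1 k t (by rw [← hs']; exact h1)
            (Or.inl (by rw [htime]; exact h2.trans_le hle)), hs']
        rcases hle.eq_or_lt with heq | hlt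
        · obtain ⟨k', i', hl, hp⟩ := hF.linked_of_wait hδ hk hak hsa (r := M.waitEnd lam δ ω s.time)
            (by rw [hs']) heq (by rw [hs']) (by rw [hs'])
          exact ⟨_, hl, .wait, rfl, by simp, hpath, by simp,
            fun _ _ hFt => ⟨(hp hFt).1, Or.inl (hp hFt).2⟩⟩
        · have hend : M.waitEnd lam (δ / 2) ω s.time = s.time + δ / 2 := by
            rw [hR.waitEnd_eq] at hlt ⊢
            rw [hR.waitEnd_eq] at hlt
            rcases min_choice (s.time + δ / 2) (M.nextEvent lam ω s.time) with h | h
            · exact h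
            · rw [h] at hlt
              exact absurd hlt (not_lt.2 (min_le_right _ _))
          rw [hend] at hlt
          have he := hR.eventCount_of_lt_waitEnd (u := s.time + δ / 2) (by linarith) hlt
          -- The coarse level is `m` coarse steps, so after half a step it is an odd number of fine
          -- steps: a fine grid point, where rounding pays nothing.
          have hy : s.level + (M.surplus x lam ω (s.time + δ / 2) - M.surplus x lam ω s.time)
              = (2 * m + 1 : ℕ) * (M.p * (δ / 2)) := by
            rw [Model.Regular.surplus_eq_add x (hR.claimCount_eq (by linarith) he), hs', hm]
            push_cast
            ring
          have hst := Model.gridStep_wait_of_nonneg hsa hend hy (by have := M.p_pos; positivity)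
          rw [gridFloor_natCast_mul (by linarith)] at hst
          refine ⟨(M.gridStep x lam (δ / 2) ω s .wait, k, 0), Or.inr (Or.inl ⟨hk, hak, rfl, ?_, ?_⟩),
            .wait, rfl, by simp, hpath, by simp, fun _ _ _ => ⟨?_, Or.inr ⟨rfl, by simp [hij]⟩⟩⟩
          · simp only
            rwa [← hs']
          · simp only
            rw [hst, ← hs']
            simp only [GridState.mk.injEq, true_and, and_true, sub_self, add_zero]
            rw [hs', hm]
            push_cast
            ring
          · simp only
            rw [hst]
  · simp only at hk hak hi hlt hs
    have hsa : s.active = true := by rw [hs]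
    set c := M.gridState x lam δ ω a k with hc
    have hstep : M.gridState x lam δ ω a (k + 1) = M.gridStep x lam δ ω c .wait := by
      rw [Model.gridState, hak]
    have he := hR.eventCount_of_lt_waitEnd (t := c.time) (by linarith) hlt
    have hst : s.time = c.time + δ / 2 := by rw [hs]
    have hnext : M.nextEvent lam ω s.time = M.nextEvent lam ω c.time := by
      unfold Model.nextEvent
      rw [hst, hR.claimCount_eq (by linarith) he, hR.catCount_eq (by linarith) he]
    have hend : M.waitEnd lam (δ / 2) ω s.time = M.waitEnd lam δ ω c.time := by
      rw [hR.waitEnd_eq, hR.waitEnd_eq, hnext, hst, add_assoc, add_halves]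
    obtain ⟨k', i', hl, hp⟩ := hF.linked_of_wait hδ hk hak hsa rfl hend
      (by
        rw [hs]
        simp only
        rw [Model.Regular.surplus_eq_add x (s := c.time) (t := c.time + δ / 2)
          (hR.claimCount_eq (by linarith) he), hc]
        ring) (by rw [hs])
    refine ⟨_, hl, .wait, rfl, by simp, ?_, by simp,
      fun _ _ hFt => ⟨(hp hFt).1, Or.inl (hp hFt).2⟩⟩
    simp only [Model.gridStep_wait_time hsa, hsa, Bool.true_eq_false, or_false, hend]
    intro t h1 h2
    rw [hF.2.1 k t (by rw [← hc]; linarith)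
      (Or.inl (by rw [hstep, Model.gridStep_wait_time hk]; exact h2)), hs]
  · simp only at hs hℓ
    exact ⟨(s, k, i), Or.inr (Or.inr ⟨hs, hℓ⟩), .wait, by rw [Model.gridStep_of_not_active hs],
      by simp [hs], fun t ht _ => hℓ t ht, by simp [hs], by simp [hs]⟩

/-- A path obtained from control actions with step `δ` is obtained from actions with step
`δ / 2`. -/
theorem Model.Follows.half (hF : M.Follows x lam δ ω a ℓ F) (hR : M.Regular lam ω)
    (hδ : 0 < δ) : ∃ b, M.Follows x lam (δ / 2) ω b ℓ F := by
  obtain ⟨k₀, i₀, -, h₀⟩ := hF.linked_of_gridFloor (k := 0) (r := 0) (y := x) (c := 0) hδ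
    (by rw [zero_add]; rfl)
  obtain ⟨s, hs0, hs⟩ := exists_seq_of_step (hF.exists_linkedStep hR hδ) h₀
  have hI := fun n => (hs n).1
  choose b hb using fun n => (hs n).2
  have hst : ∀ n, M.gridState x lam (δ / 2) ω b n = (s n).1 := by
    intro n
    induction n with
    | zero => rw [hs0, zero_add]; rfl
    | succ n ih => rw [Model.gridState, ih, (hb n).1]
  refine ⟨b, ?_⟩
  simp only [Model.Follows, hst]
  refine ⟨fun n => (hb n).2.1, fun n => (hb n).2.2.1, fun n => (hb n).2.2.2.1, fun hno => ?_⟩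
  -- If the coarse strategy closes, at index `K` say, the simulation must also close. Otherwise it
  -- would stay active for ever with coarse index at most `K`, while each step raises the index or
  -- lowers the number of outstanding fine actions: an infinite lexicographic descent.
  by_contra hFt
  obtain ⟨K, hK, hKc⟩ : ∃ K, (M.gridState x lam δ ω a K).active = true ∧ a K = .close := by
    by_contra! hc
    exact hFt (hF.2.2.2 hc)
  have hact : ∀ n, (s n).1.active = true := by
    intro n
    induction n with
    | zero => rw [hs0]
    | succ n ih => exact ((hb n).2.2.2.2 ih (hno n ih) hFt).1
  have hprog := fun n => ((hb n).2.2.2.2 (hact n) (hno n (hact n)) hFt).2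
  have hkK : ∀ n, (s n).2.1 ≤ K := by
    intro n
    by_contra! hlt
    have h1 := gridState_not_active_of_close hlt hK hKc
    rcases hI n with ⟨j, h2, -⟩ | ⟨h2, -⟩ | ⟨h2, -⟩
    · rw [h1] at h2; exact absurd h2 (by simp)
    · rw [h1] at h2; exact absurd h2 (by simp)
    · rw [hact n] at h2; exact absurd h2 (by simp)
  refine not_strictAnti_of_wellFoundedLT
    (fun n => toLex ((K - (s n).2.1, (s n).2.2) : ℕ × ℕ)) (strictAnti_nat_of_succ_lt fun n => ?_)
  rw [Prod.Lex.toLex_lt_toLex]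
  have h1 := hkK n
  have h2 := hkK (n + 1)
  rcases hprog n with h | ⟨h, h'⟩
  · left; simp only; omega
  · right; simp only; omega

end follows
end

/-! ### Exponential laws, and discounting as killing -/

section

section exponential

variable {r : ℝ}

theorem lintegral_expMeasure (f : ℝ → ℝ≥0∞) (hf : Measurable f) :
    ∫⁻ t, f t ∂(expMeasure r) = ∫⁻ t, exponentialPDF r t * f t :=
  lintegral_withDensity_eq_lintegral_mul _
    (measurable_exponentialPDFReal r).ennreal_ofReal hf

theorem ae_expMeasure_pos (hr : 0 < r) : ∀ᵐ t ∂(expMeasure r), 0 < t := by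
  have h : expMeasure r (Iic 0) = 0 := by
    rw [expMeasure, gammaMeasure, withDensity_apply _ measurableSet_Iic]
    exact (lintegral_exponentialPDF_eq_antiDeriv hr 0).trans (by simp)
  rw [ae_iff]
  simp only [not_lt]
  exact h

/-- The exponential distribution has no memory. -/
theorem lintegral_Ici_expMeasure {c : ℝ} (hc : 0 ≤ c) {f : ℝ → ℝ≥0∞} (hf : Measurable f) :
    ∫⁻ t in Ici c, f t ∂(expMeasure r)
      = ENNReal.ofReal (Real.exp (-r * c)) * ∫⁻ t, f (t + c) ∂(expMeasure r) := by
  rw [← lintegral_indicator measurableSet_Ici,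
    lintegral_expMeasure _ (hf.indicator measurableSet_Ici),
    lintegral_expMeasure (fun t => f (t + c)) (hf.comp (measurable_id.add_const c)),
    ← lintegral_add_right_eq_self _ c, ← lintegral_const_mul]
  · refine lintegral_congr fun t => ?_
    by_cases ht : 0 ≤ t
    · rw [indicator_of_mem (by simpa using ht), exponentialPDF_of_nonneg ht,
        exponentialPDF_of_nonneg (by linarith), ← mul_assoc,
        ← ENNReal.ofReal_mul (Real.exp_nonneg _)]
      congr 2
      rw [mul_left_comm, ← Real.exp_add]
      ring_nf
    · rw [indicator_of_notMem (by simpa using ht), exponentialPDF_of_neg (not_le.1 ht)]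
      simp
  · exact ((measurable_exponentialPDFReal r).ennreal_ofReal).mul
      (hf.comp (measurable_id.add_const c))

theorem expMeasure_Ici (hr : 0 < r) {c : ℝ} (hc : 0 ≤ c) :
    expMeasure r (Ici c) = ENNReal.ofReal (Real.exp (-r * c)) := by
  have := isProbabilityMeasure_expMeasure hr
  have h := lintegral_Ici_expMeasure (r := r) hc (measurable_const (a := (1 : ℝ≥0∞)))
  simpa using h

/-- The density is at most `1`. This bounds the chance that a resampled clock increment falls into a
short interval by its length. -/
theorem expMeasure_one_le_volume : expMeasure 1 ≤ (volume : Measure ℝ) := by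
  intro s
  have h : expMeasure 1 ≤ (volume : Measure ℝ).withDensity 1 := by
    refine withDensity_mono (ae_of_all _ fun t => ?_)
    change exponentialPDF 1 t ≤ 1
    rw [exponentialPDF_eq, ← ENNReal.ofReal_one]
    apply ENNReal.ofReal_le_ofReal
    split_ifs with ht
    · rw [one_mul, Real.exp_le_one_iff]; linarith
    · norm_num
  rw [withDensity_one] at h
  exact h s

theorem lintegral_id_expMeasure (hr : 0 < r) :
    ∫⁻ t, ENNReal.ofReal t ∂(expMeasure r) = ENNReal.ofReal (1 / r) := by
  have hpos : ∀ᵐ t ∂(expMeasure r), (0 : ℝ) ≤ t := (ae_expMeasure_pos hr).mono fun _ h => h.le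
  rw [lintegral_eq_lintegral_meas_le _ hpos measurable_id.aemeasurable]
  have h1 : ∫⁻ t in Ioi (0 : ℝ), expMeasure r {a | t ≤ a}
      = ∫⁻ t in Ioi (0 : ℝ), ENNReal.ofReal (Real.exp (-r * t)) := by
    refine setLIntegral_congr_fun measurableSet_Ioi fun t ht => ?_
    exact expMeasure_Ici hr (le_of_lt ht)
  rw [h1]
  have h2 : ∫⁻ t in Ioi (0 : ℝ), ENNReal.ofReal (r * Real.exp (-r * t)) = 1 := by
    have h3 := lintegral_exponentialPDF_eq_one hr
    have h4 : ∫⁻ t, exponentialPDF r t = ∫⁻ t in Ici 0, exponentialPDF r t := by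
      rw [← lintegral_indicator measurableSet_Ici]
      refine lintegral_congr fun t => ?_
      by_cases ht : 0 ≤ t
      · rw [indicator_of_mem (by simpa using ht)]
      · rw [indicator_of_notMem (by simpa using ht), exponentialPDF_of_neg (not_le.1 ht)]
    rw [h4, ← restrict_Ioi_eq_restrict_Ici] at h3
    rw [← h3]
    refine setLIntegral_congr_fun measurableSet_Ioi fun t ht => ?_
    rw [exponentialPDF_of_nonneg (le_of_lt ht), neg_mul]
  have h5 : ∀ t, ENNReal.ofReal (r * Real.exp (-r * t))
      = ENNReal.ofReal r * ENNReal.ofReal (Real.exp (-r * t)) := fun t => ENNReal.ofReal_mul hr.le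
  simp_rw [h5] at h2
  rw [lintegral_const_mul _ (by fun_prop)] at h2
  rw [one_div, ENNReal.ofReal_inv_of_pos hr]
  exact ENNReal.eq_inv_of_mul_eq_one_left (by rwa [mul_comm])

end exponential

section discount

variable {M : Model} {x lam : ℝ} {ω : Sample}

/-- The law of an exponential time with rate `q`; discounting is killing at such a time. -/
def Model.killing (M : Model) : Measure ℝ := expMeasure M.q

instance : IsProbabilityMeasure M.killing := isProbabilityMeasure_expMeasure M.q_pos

theorem ae_killing_pos : ∀ᵐ t ∂M.killing, 0 < t := ae_expMeasure_pos M.q_pos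

/-- The factor `e^{-qt}` is the probability that the killing time is at least `t`; exchange the two
integrals. -/
theorem lintegral_discount (f : StieltjesFunction ℝ) {S : Set ℝ} (hS : MeasurableSet S)
    (hS0 : S ⊆ Ici 0) :
    ∫⁻ t in S, ENNReal.ofReal (Real.exp (-M.q * t)) ∂f.measure
      = ∫⁻ s, f.measure (S ∩ Iic s) ∂M.killing := by
  have hD : MeasurableSet {z : ℝ × ℝ | z.1 ≤ z.2} := measurableSet_le measurable_fst measurable_snd
  have h1 : ∫⁻ t in S, ENNReal.ofReal (Real.exp (-M.q * t)) ∂f.measure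
      = ∫⁻ t in S, M.killing (Prod.mk t ⁻¹' {z : ℝ × ℝ | z.1 ≤ z.2}) ∂f.measure := by
    refine setLIntegral_congr_fun hS fun t ht => ?_
    exact (expMeasure_Ici M.q_pos (hS0 ht)).symm
  rw [h1, ← Measure.prod_apply hD, Measure.prod_apply_symm hD]
  refine lintegral_congr fun s => ?_
  exact (Measure.restrict_apply (measurableSet_Iic (a := s))).trans (by rw [inter_comm])

/-- The path `f` stopped just before the time `τ`. -/
def stoppedPath (f : ℝ → ℝ) (τ : ℝ≥0∞) (t : ℝ) : ℝ :=
  open scoped Classical in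
  if ENNReal.ofReal t < τ then f t else Function.leftLim f τ.toReal

theorem leftLim_eq_zero {f : ℝ → ℝ} (hf : ∀ t < 0, f t = 0) : Function.leftLim f 0 = 0 := by
  refine leftLim_eq_of_tendsto ?_
  refine tendsto_const_nhds.congr' ?_
  filter_upwards [self_mem_nhdsWithin] with t ht
  exact (hf t ht).symm

/-- The mass of `[0, τ)` up to the killing time `s` is `f s` if `s < τ` and the left limit at `τ`
otherwise. The normalisation at negative times makes an initial payment count as an atom at `0`. -/
theorem lintegral_discount_lt (f : StieltjesFunction ℝ) (hf : ∀ t < 0, f t = 0) (τ : ℝ≥0∞) :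
    ∫⁻ t in {t : ℝ | 0 ≤ t ∧ ENNReal.ofReal t < τ}, ENNReal.ofReal (Real.exp (-M.q * t)) ∂f.measure
      = ∫⁻ s, ENNReal.ofReal (stoppedPath f τ s) ∂M.killing := by
  have hS : MeasurableSet {t : ℝ | 0 ≤ t ∧ ENNReal.ofReal t < τ} :=
    (measurableSet_le measurable_const measurable_id).inter
      (measurableSet_lt ENNReal.measurable_ofReal measurable_const)
  rw [lintegral_discount f hS fun t ht => ht.1]
  refine lintegral_congr_ae ?_
  filter_upwards [ae_killing_pos] with s hs
  unfold stoppedPath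
  split_ifs with h
  · have : {t : ℝ | 0 ≤ t ∧ ENNReal.ofReal t < τ} ∩ Iic s = Icc 0 s := by
      ext t
      constructor
      · rintro ⟨⟨h1, -⟩, h2⟩
        exact ⟨h1, h2⟩
      · rintro ⟨h1, h2⟩
        exact ⟨⟨h1, (ENNReal.ofReal_le_ofReal h2).trans_lt h⟩, h2⟩
    rw [this, f.measure_Icc, leftLim_eq_zero hf, sub_zero]
  · have hτ : τ ≠ ⊤ := fun hc => h (hc ▸ ENNReal.ofReal_lt_top)
    have : {t : ℝ | 0 ≤ t ∧ ENNReal.ofReal t < τ} ∩ Iic s = Ico 0 τ.toReal := by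
      ext t
      constructor
      · rintro ⟨⟨h1, h2⟩, h3⟩
        exact ⟨h1, (ENNReal.ofReal_lt_iff_lt_toReal h1 hτ).1 h2⟩
      · rintro ⟨h1, h2⟩
        have h2' := (ENNReal.ofReal_lt_iff_lt_toReal h1 hτ).2 h2
        refine ⟨⟨h1, h2'⟩, ?_⟩
        by_contra! hlt
        exact h ((ENNReal.ofReal_le_ofReal (le_of_not_ge (fun hc => absurd (hlt : ¬ t ≤ s)
          (by simpa using hc)))).trans_lt h2')
    rw [this, f.measure_Ico, leftLim_eq_zero hf, sub_zero]

theorem lintegral_discount_le (f : StieltjesFunction ℝ) (hf : ∀ t < 0, f t = 0) (c : ℝ) :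
    ∫⁻ t in Icc 0 c, ENNReal.ofReal (Real.exp (-M.q * t)) ∂f.measure
      = ∫⁻ s, ENNReal.ofReal (f (min c s)) ∂M.killing := by
  rw [lintegral_discount f measurableSet_Icc fun t ht => ht.1]
  refine lintegral_congr_ae ?_
  filter_upwards [ae_killing_pos] with s hs
  have : Icc 0 c ∩ Iic s = Icc 0 (min c s) := by
    ext t; simp [and_assoc]
  rw [this, f.measure_Icc, leftLim_eq_zero hf, sub_zero]

theorem lintegral_Ici_killing_const {c : ℝ} (hc : 0 ≤ c) (a : ℝ) :
    ∫⁻ s, (Ici c).indicator (fun _ => ENNReal.ofReal a) s ∂M.killing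
      = ENNReal.ofReal (Real.exp (-M.q * c) * a) := by
  rw [lintegral_indicator measurableSet_Ici, lintegral_const, Measure.restrict_apply_univ,
    Model.killing, expMeasure_Ici M.q_pos hc, mul_comm, ← ENNReal.ofReal_mul (Real.exp_nonneg _)]

end discount

end

/-! ### Good samples: the integrated intensity and the claim times -/

section

/-- All entries of the sample are positive and have divergent sums. -/
structure Good (ω : Sample) : Prop where
  pos : ∀ i, 0 < (ω i).1 ∧ 0 < (ω i).2.1 ∧ 0 < (ω i).2.2.1 ∧ 0 < (ω i).2.2.2
  sum_wait : Tendsto (fun n => ∑ i ∈ Finset.range n, (ω i).1) atTop atTop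
  sum_jump : Tendsto (fun n => ∑ i ∈ Finset.range n, (ω i).2.1) atTop atTop
  sum_clock : Tendsto (fun n => ∑ i ∈ Finset.range n, (ω i).2.2.1) atTop atTop
  sum_claim : Tendsto (fun n => ∑ i ∈ Finset.range n, (ω i).2.2.2) atTop atTop

/-- The epochs of the unit-rate Poisson clock. -/
def clockTime (ω : Sample) (n : ℕ) : ℝ := ∑ i ∈ Finset.range (n + 1), (ω i).2.2.1

/-- `∫₀ᵘ e^{-ds} ds` for `u ≥ 0`, and `0` for `u ≤ 0`. -/
def Model.ramp (M : Model) (u : ℝ) : ℝ := (1 - Real.exp (-M.d * max u 0)) / M.d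

/-- The integrated intensity with the first `m` catastrophes taken into account. -/
def Model.clock (M : Model) (lam : ℝ) (ω : Sample) (m : ℕ) (t : ℝ) : ℝ :=
  M.lamBase * t + (lam - M.lamBase) * M.ramp t
    + ∑ k ∈ Finset.range m, jumpSize ω k * M.ramp (t - catTime ω k)

/-- A bound for the intensity on `[0, T]`. -/
def rateBound (lam : ℝ) (ω : Sample) (T : ℝ) : ℝ :=
  lam + ∑ k ∈ Finset.range (catCount ω T), jumpSize ω k

variable {M : Model} {lam : ℝ} {ω : Sample}

theorem ramp_of_nonpos {u : ℝ} (hu : u ≤ 0) : M.ramp u = 0 := by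
  simp [Model.ramp, max_eq_right hu]

theorem ramp_mono : Monotone M.ramp := by
  intro u v huv
  have := M.d_pos
  unfold Model.ramp
  gcongr ?_ / _
  have : max u 0 ≤ max v 0 := max_le_max_right 0 huv
  have : Real.exp (-M.d * max v 0) ≤ Real.exp (-M.d * max u 0) := by
    apply Real.exp_le_exp.2
    nlinarith
  linarith

theorem ramp_nonneg (u : ℝ) : 0 ≤ M.ramp u := by
  rcases le_total u 0 with h | h
  · rw [ramp_of_nonpos h]
  · rw [← ramp_of_nonpos (M := M) le_rfl]
    exact ramp_mono h

theorem ramp_pos {u : ℝ} (hu : 0 < u) : 0 < M.ramp u := by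
  have := M.d_pos
  unfold Model.ramp
  rw [max_eq_left hu.le]
  apply div_pos _ this
  have : Real.exp (-M.d * u) < 1 := by
    rw [Real.exp_lt_one_iff]
    nlinarith
  linarith

theorem ramp_sub_le {u v : ℝ} (huv : u ≤ v) : M.ramp v - M.ramp u ≤ v - u := by
  have hd := M.d_pos
  have key : ∀ a b : ℝ, 0 ≤ a → a ≤ b → Real.exp (-M.d * a) - Real.exp (-M.d * b)
      ≤ M.d * (b - a) := by
    intro a b ha hab
    have h1 : Real.exp (-M.d * b) = Real.exp (-M.d * a) * Real.exp (-M.d * (b - a)) := by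
      rw [← Real.exp_add]; ring_nf
    have h2 := Real.add_one_le_exp (-M.d * (b - a))
    have h3 : Real.exp (-M.d * a) ≤ 1 := by rw [Real.exp_le_one_iff]; nlinarith
    have h4 := Real.exp_pos (-M.d * a)
    have h5 : 0 ≤ M.d * (b - a) := by nlinarith
    rw [h1]
    nlinarith
  have h := key (max u 0) (max v 0) (le_max_right _ _) (max_le_max_right 0 huv)
  have h' : max v 0 - max u 0 ≤ v - u := by
    rcases le_total u 0 with hu | hu <;> rcases le_total v 0 with hv | hv <;>
      simp only [max_eq_left, max_eq_right, hu, hv] <;> linarith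
  unfold Model.ramp
  rw [← sub_div, div_le_iff₀ hd]
  nlinarith

theorem continuous_ramp : Continuous M.ramp := by
  unfold Model.ramp
  fun_prop

/-- Only a right derivative: the ramp has a corner at `T`, where the intensity jumps. -/
theorem hasDerivWithinAt_ramp (T s : ℝ) :
    HasDerivWithinAt (fun s => M.ramp (s - T)) (if T ≤ s then Real.exp (-M.d * (s - T)) else 0)
      (Ioi s) s := by
  have hd := M.d_pos.ne'
  split_ifs with h
  · have h1 : HasDerivAt (fun s => (1 - Real.exp (-M.d * (s - T))) / M.d)
        (Real.exp (-M.d * (s - T))) s := by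
      have h2 : HasDerivAt (fun s => -M.d * (s - T)) (-M.d) s := by
        simpa using ((hasDerivAt_id s).sub_const T).const_mul (-M.d)
      refine ((h2.exp.const_sub 1).div_const M.d).congr_deriv ?_
      rw [div_eq_iff hd]
      ring
    refine h1.hasDerivWithinAt.congr (fun u hu => ?_) ?_
    · have hu' : s < u := hu
      simp only [Model.ramp]
      rw [max_eq_left (by linarith)]
    · simp only [Model.ramp]
      rw [max_eq_left (by linarith)]
  · have h1 : HasDerivAt (fun _ : ℝ => (0 : ℝ)) 0 s := hasDerivAt_const s 0
    refine (h1.congr_of_eventuallyEq ?_).hasDerivWithinAt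
    filter_upwards [Iio_mem_nhds (not_le.1 h)] with u hu
    have hu' : u < T := hu
    exact ramp_of_nonpos (by linarith)

namespace Good

theorem catTime_strictMono (h : Good ω) : StrictMono (catTime ω) := by
  refine strictMono_nat_of_lt_succ fun n => ?_
  unfold catTime
  rw [Finset.sum_range_succ _ (n + 1)]
  linarith [(h.pos (n + 1)).1]

theorem catTime_pos (h : Good ω) (n : ℕ) : 0 < catTime ω n :=
  Finset.sum_pos (fun i _ => (h.pos i).1) ⟨0, by simp⟩

theorem catTime_tendsto (h : Good ω) : Tendsto (catTime ω) atTop atTop :=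
  h.sum_wait.comp (tendsto_add_atTop_nat 1)

theorem clockTime_strictMono (h : Good ω) : StrictMono (clockTime ω) := by
  refine strictMono_nat_of_lt_succ fun n => ?_
  unfold clockTime
  rw [Finset.sum_range_succ _ (n + 1)]
  linarith [(h.pos (n + 1)).2.2.1]

theorem clockTime_pos (h : Good ω) (n : ℕ) : 0 < clockTime ω n :=
  Finset.sum_pos (fun i _ => (h.pos i).2.2.1) ⟨0, by simp⟩

theorem clockTime_tendsto (h : Good ω) : Tendsto (clockTime ω) atTop atTop :=
  h.sum_clock.comp (tendsto_add_atTop_nat 1)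

theorem jumpSize_pos (h : Good ω) (k : ℕ) : 0 < jumpSize ω k := (h.pos k).2.1

theorem lt_catCount (h : Good ω) (t : ℝ) (n : ℕ) : n < catCount ω t ↔ catTime ω n ≤ t :=
  lt_ncard_le_iff h.catTime_strictMono h.catTime_tendsto t n

theorem intensity_eq (h : Good ω) {s : ℝ} {m : ℕ} (hm : catCount ω s ≤ m) :
    M.intensity lam ω s = M.lamBase + (lam - M.lamBase) * Real.exp (-M.d * s)
      + ∑ k ∈ Finset.range m, jumpSize ω k *
        (if catTime ω k ≤ s then Real.exp (-M.d * (s - catTime ω k)) else 0) := by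
  unfold Model.intensity
  congr 1
  · ring
  · rw [← Finset.sum_subset (Finset.range_mono hm)]
    · refine Finset.sum_congr rfl fun k hk => ?_
      rw [if_pos ((h.lt_catCount s k).1 (Finset.mem_range.1 hk))]
    · intro k _ hk
      rw [if_neg, mul_zero]
      rw [← h.lt_catCount]
      simpa using hk

theorem intensity_nonneg (h : Good ω) (hlam : M.lamBase ≤ lam) (s : ℝ) :
    0 ≤ M.intensity lam ω s := by
  unfold Model.intensity
  have h1 := M.lamBase_nonneg
  have h2 : 0 ≤ Real.exp (-M.d * s) * (lam - M.lamBase) :=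
    mul_nonneg (Real.exp_nonneg _) (by linarith)
  have h3 : 0 ≤ ∑ k ∈ Finset.range (catCount ω s),
      jumpSize ω k * Real.exp (-M.d * (s - catTime ω k)) :=
    Finset.sum_nonneg fun k _ => mul_nonneg (h.jumpSize_pos k).le (Real.exp_nonneg _)
  linarith

theorem catCount_mono (h : Good ω) {s t : ℝ} (hst : s ≤ t) : catCount ω s ≤ catCount ω t :=
  le_of_forall_lt fun n hn => (h.lt_catCount t n).2 (((h.lt_catCount s n).1 hn).trans hst)

/-- The fundamental theorem with right derivatives. Shots that have not yet occurred contribute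
nothing to `clock`, so a fixed number `m` may replace the random count; this makes the clock an
explicit function of the sample. -/
theorem cumIntensity_eq (h : Good ω) (hlam : M.lamBase ≤ lam) {t : ℝ} (ht : 0 ≤ t) {m : ℕ}
    (hm : catCount ω t ≤ m) : M.cumIntensity lam ω t = M.clock lam ω m t := by
  have hcont : Continuous (M.clock lam ω m) := by
    have := continuous_ramp (M := M)
    unfold Model.clock
    fun_prop
  have hderiv : ∀ s ∈ Ioo 0 t,
      HasDerivWithinAt (M.clock lam ω m) (M.intensity lam ω s) (Ioi s) s := by
    intro s hs
    rw [h.intensity_eq ((h.catCount_mono hs.2.le).trans hm)]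
    unfold Model.clock
    refine HasDerivWithinAt.add (HasDerivWithinAt.add ?_ ?_) ?_
    · simpa using ((hasDerivAt_id s).const_mul M.lamBase).hasDerivWithinAt
    · have := hasDerivWithinAt_ramp (M := M) 0 s
      simp only [sub_zero, if_pos hs.1.le] at this
      exact this.const_mul _
    · exact HasDerivWithinAt.fun_sum fun k _ => (hasDerivWithinAt_ramp (catTime ω k) s).const_mul _
  -- Integrability of the intensity comes for free, as it is a nonnegative right derivative of a
  -- continuous function.
  have hint := intervalIntegral.integrableOn_deriv_right_of_nonneg hcont.continuousOn hderiv
    fun s _ => h.intensity_nonneg hlam s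
  unfold Model.cumIntensity
  rw [intervalIntegral.integral_eq_sub_of_hasDeriv_right_of_le ht hcont.continuousOn hderiv
    ((intervalIntegrable_iff_integrableOn_Ioc_of_le ht).2 hint)]
  have h0 : M.clock lam ω m 0 = 0 := by
    unfold Model.clock
    rw [ramp_of_nonpos le_rfl, Finset.sum_eq_zero]
    · ring
    · intro k _
      rw [ramp_of_nonpos (by linarith [h.catTime_pos k]), mul_zero]
  rw [h0, sub_zero]

theorem clock_mono (h : Good ω) (hlam : M.lamBase ≤ lam) (m : ℕ) :
    Monotone (M.clock lam ω m) := by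
  intro s t hst
  unfold Model.clock
  have h1 : ∑ k ∈ Finset.range m, jumpSize ω k * M.ramp (s - catTime ω k)
      ≤ ∑ k ∈ Finset.range m, jumpSize ω k * M.ramp (t - catTime ω k) :=
    Finset.sum_le_sum fun k _ =>
      mul_le_mul_of_nonneg_left (ramp_mono (by linarith)) (h.jumpSize_pos k).le
  have h2 := mul_le_mul_of_nonneg_left (ramp_mono (M := M) hst) (sub_nonneg.2 hlam)
  have h3 := mul_le_mul_of_nonneg_left hst M.lamBase_nonneg
  linarith

theorem clock_le_clock (h : Good ω) {m m' : ℕ} (hm : m ≤ m') (t : ℝ) :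
    M.clock lam ω m t ≤ M.clock lam ω m' t := by
  unfold Model.clock
  have := Finset.sum_le_sum_of_subset_of_nonneg (Finset.range_mono hm)
    (f := fun k => jumpSize ω k * M.ramp (t - catTime ω k))
    fun k _ _ => mul_nonneg (h.jumpSize_pos k).le (ramp_nonneg _)
  linarith

theorem clock_sub_le (h : Good ω) (hlam : M.lamBase ≤ lam) {s t : ℝ} (hst : s ≤ t) (m : ℕ) :
    M.clock lam ω m t - M.clock lam ω m s
      ≤ (lam + ∑ k ∈ Finset.range m, jumpSize ω k) * (t - s) := by
  have h1 : ∑ k ∈ Finset.range m, jumpSize ω k * M.ramp (t - catTime ω k)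
      - ∑ k ∈ Finset.range m, jumpSize ω k * M.ramp (s - catTime ω k)
      ≤ (∑ k ∈ Finset.range m, jumpSize ω k) * (t - s) := by
    rw [← Finset.sum_sub_distrib, Finset.sum_mul]
    refine Finset.sum_le_sum fun k _ => ?_
    rw [← mul_sub]
    refine mul_le_mul_of_nonneg_left ?_ (h.jumpSize_pos k).le
    have := ramp_sub_le (M := M) (u := s - catTime ω k) (v := t - catTime ω k) (by linarith)
    linarith
  have h2 := mul_le_mul_of_nonneg_left (ramp_sub_le (M := M) hst) (sub_nonneg.2 hlam)
  unfold Model.clock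
  linarith

theorem cumIntensity_mono (h : Good ω) (hlam : M.lamBase ≤ lam) {s t : ℝ} (hs : 0 ≤ s)
    (hst : s ≤ t) : M.cumIntensity lam ω s ≤ M.cumIntensity lam ω t := by
  rw [h.cumIntensity_eq hlam hs (h.catCount_mono hst),
    h.cumIntensity_eq hlam (hs.trans hst) le_rfl]
  exact h.clock_mono hlam _ hst

theorem cumIntensity_sub_le (h : Good ω) (hlam : M.lamBase ≤ lam) {s t T : ℝ} (hs : 0 ≤ s)
    (hst : s ≤ t) (htT : t ≤ T) :
    M.cumIntensity lam ω t - M.cumIntensity lam ω s ≤ rateBound lam ω T * (t - s) := by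
  rw [h.cumIntensity_eq hlam hs (h.catCount_mono (hst.trans htT)),
    h.cumIntensity_eq hlam (hs.trans hst) (h.catCount_mono htT)]
  exact h.clock_sub_le hlam hst _

theorem cumIntensity_continuousOn (h : Good ω) (hlam : M.lamBase ≤ lam) (T : ℝ) :
    ContinuousOn (M.cumIntensity lam ω) (Icc 0 T) := by
  have hcont : Continuous (M.clock lam ω (catCount ω T)) := by
    have := continuous_ramp (M := M)
    unfold Model.clock
    fun_prop
  exact hcont.continuousOn.congr fun t ht => h.cumIntensity_eq hlam ht.1 (h.catCount_mono ht.2)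

theorem cumIntensity_zero : M.cumIntensity lam ω 0 = 0 := by simp [Model.cumIntensity]

/-- The base intensity may vanish, so divergence must come from the shots: one unit of time after
the `m`-th catastrophe each shot before it has contributed at least its jump times `ramp 1`, and the
sum of the jumps diverges. -/
theorem exists_le_cumIntensity (h : Good ω) (hlam : M.lamBase ≤ lam) (c : ℝ) :
    ∃ t, 0 ≤ t ∧ c ≤ M.cumIntensity lam ω t := by
  have hr := ramp_pos (M := M) one_pos
  obtain ⟨m, hm⟩ := (h.sum_jump.eventually_ge_atTop (c / M.ramp 1)).exists
  have h0 : 0 ≤ catTime ω m + 1 := by linarith [h.catTime_pos m]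
  refine ⟨catTime ω m + 1, h0, ?_⟩
  rw [h.cumIntensity_eq hlam h0 le_rfl]
  have hmc : m ≤ catCount ω (catTime ω m + 1) := ((h.lt_catCount _ m).2 (by linarith)).le
  refine le_trans ?_ (h.clock_le_clock hmc _)
  unfold Model.clock
  have h1 : (∑ i ∈ Finset.range m, (ω i).2.1) * M.ramp 1
      ≤ ∑ k ∈ Finset.range m, jumpSize ω k * M.ramp (catTime ω m + 1 - catTime ω k) := by
    rw [Finset.sum_mul]
    refine Finset.sum_le_sum fun k hk => mul_le_mul_of_nonneg_left (ramp_mono ?_) (h.pos k).2.1.le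
    have := h.catTime_strictMono (Finset.mem_range.1 hk)
    linarith
  rw [div_le_iff₀ hr] at hm
  have h2 := mul_nonneg (sub_nonneg.2 hlam) (ramp_nonneg (M := M) (catTime ω m + 1))
  have h3 := mul_nonneg M.lamBase_nonneg h0
  linarith

/-- The clock is continuous, starts at `0` and diverges, so it attains each level; by compactness
there is a first time. -/
theorem isLeast_claimTime (h : Good ω) (hlam : M.lamBase ≤ lam) (n : ℕ) :
    IsLeast {t : ℝ | 0 ≤ t ∧ clockTime ω n ≤ M.cumIntensity lam ω t} (M.claimTime lam ω n) ∧
      M.cumIntensity lam ω (M.claimTime lam ω n) = clockTime ω n := by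
  obtain ⟨T, hT, hTc⟩ := h.exists_le_cumIntensity hlam (clockTime ω n)
  obtain ⟨t, ht, htc⟩ : clockTime ω n ∈ M.cumIntensity lam ω '' Icc 0 T :=
    intermediate_value_Icc hT (h.cumIntensity_continuousOn hlam T)
      ⟨by rw [cumIntensity_zero]; exact (h.clockTime_pos n).le, hTc⟩
  have hclosed : IsClosed (Icc 0 T ∩ M.cumIntensity lam ω ⁻¹' {clockTime ω n}) :=
    (h.cumIntensity_continuousOn hlam T).preimage_isClosed_of_isClosed isClosed_Icc
      isClosed_singleton
  obtain ⟨t₀, ⟨ht₀, ht₀c⟩, hmin⟩ := (isCompact_Icc.of_isClosed_subset hclosed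
    inter_subset_left).exists_isLeast ⟨t, ht, htc⟩
  have hleast : IsLeast {t : ℝ | 0 ≤ t ∧ clockTime ω n ≤ M.cumIntensity lam ω t} t₀ := by
    refine ⟨⟨ht₀.1, (show M.cumIntensity lam ω t₀ = clockTime ω n from ht₀c).ge⟩, ?_⟩
    rintro u ⟨hu, huc⟩
    by_contra! hlt
    have h1 : M.cumIntensity lam ω u = clockTime ω n :=
      le_antisymm ((h.cumIntensity_mono hlam hu hlt.le).trans_eq ht₀c) huc
    exact absurd (hmin ⟨⟨hu, hlt.le.trans ht₀.2⟩, h1⟩) (not_le.2 hlt)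
  have heq : M.claimTime lam ω n = t₀ := hleast.csInf_eq
  rw [heq]
  exact ⟨hleast, ht₀c⟩

theorem claimTime_nonneg (h : Good ω) (hlam : M.lamBase ≤ lam) (n : ℕ) :
    0 ≤ M.claimTime lam ω n := (h.isLeast_claimTime hlam n).1.1.1

theorem cumIntensity_claimTime (h : Good ω) (hlam : M.lamBase ≤ lam) (n : ℕ) :
    M.cumIntensity lam ω (M.claimTime lam ω n) = clockTime ω n :=
  (h.isLeast_claimTime hlam n).2

theorem claimTime_le_iff (h : Good ω) (hlam : M.lamBase ≤ lam) (n : ℕ) {t : ℝ} (ht : 0 ≤ t) :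
    M.claimTime lam ω n ≤ t ↔ clockTime ω n ≤ M.cumIntensity lam ω t := by
  constructor
  · intro hle
    rw [← h.cumIntensity_claimTime hlam n]
    exact h.cumIntensity_mono hlam (h.claimTime_nonneg hlam n) hle
  · exact fun hle => (h.isLeast_claimTime hlam n).1.2 ⟨ht, hle⟩

theorem regular (h : Good ω) (hlam : M.lamBase ≤ lam) : M.Regular lam ω where
  claim_mono := strictMono_nat_of_lt_succ fun n => by
    by_contra! hle
    have h1 := (h.claimTime_le_iff hlam (n + 1) (h.claimTime_nonneg hlam n)).1 hle
    rw [h.cumIntensity_claimTime hlam n] at h1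
    exact absurd h1 (not_le.2 (h.clockTime_strictMono (Nat.lt_succ_self n)))
  claim_pos n := by
    refine lt_of_le_of_ne (h.claimTime_nonneg hlam n) fun h0 => ?_
    have h1 := h.cumIntensity_claimTime hlam n
    rw [← h0, cumIntensity_zero] at h1
    linarith [h.clockTime_pos n]
  claim_tendsto := by
    refine tendsto_atTop.2 fun t => ?_
    filter_upwards [h.clockTime_tendsto.eventually_gt_atTop (M.cumIntensity lam ω (max t 0))]
      with n hn
    have h1 : ¬ M.claimTime lam ω n ≤ max t 0 := by
      rw [h.claimTime_le_iff hlam n (le_max_right _ _)]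
      exact not_le.2 hn
    exact (le_max_left _ _).trans (not_le.1 h1).le
  cat_mono := h.catTime_strictMono
  cat_tendsto := h.catTime_tendsto
  size_pos n := (h.pos n).2.2.2

/-- On the same sample a larger initial intensity runs the clock faster. This coupling lets the
error terms for all initial intensities below `lam₀` be bounded by those at `lam₀`. -/
theorem claimTime_anti (h : Good ω) (hlam : M.lamBase ≤ lam) {lam' : ℝ} (hle : lam ≤ lam')
    (n : ℕ) : M.claimTime lam' ω n ≤ M.claimTime lam ω n := by
  have h0 := h.claimTime_nonneg hlam n
  rw [h.claimTime_le_iff (hlam.trans hle) n h0, ← h.cumIntensity_claimTime hlam n,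
    h.cumIntensity_eq hlam h0 le_rfl, h.cumIntensity_eq (hlam.trans hle) h0 le_rfl]
  have := mul_le_mul_of_nonneg_right (sub_le_sub_right hle M.lamBase)
    (ramp_nonneg (M := M) (M.claimTime lam ω n))
  unfold Model.clock
  linarith

theorem claimCount_mono_right (h : Good ω) (hlam : M.lamBase ≤ lam) {lam' : ℝ} (hle : lam ≤ lam')
    (t : ℝ) : M.claimCount lam ω t ≤ M.claimCount lam' ω t :=
  le_of_forall_lt fun n hn => ((h.regular (hlam.trans hle)).lt_claimCount t n).2
    ((h.claimTime_anti hlam hle n).trans (((h.regular hlam).lt_claimCount t n).1 hn))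

theorem ramp_le_cumIntensity (h : Good ω) (hlam : M.lamBase ≤ lam) {t : ℝ} (ht : 0 ≤ t) :
    (lam - M.lamBase) * M.ramp t ≤ M.cumIntensity lam ω t := by
  rw [h.cumIntensity_eq hlam ht le_rfl]
  refine le_trans ?_ (h.clock_le_clock (Nat.zero_le _) t)
  simp only [Model.clock, Finset.range_zero, Finset.sum_empty, add_zero]
  linarith [mul_nonneg M.lamBase_nonneg ht]

end Good

end

/-! ### Almost all samples are good; the completed filtration -/

section

variable {M : Model} {lam : ℝ} {ω : Sample}

/-- The law of one entry of the sample. -/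
def Model.entryLaw (M : Model) : Measure (ℝ × ℝ × ℝ × ℝ) :=
  (expMeasure M.β).prod (M.jumpLaw.prod ((expMeasure 1).prod M.claimLaw))

instance : IsProbabilityMeasure M.claimLaw := M.claimLaw_prob
instance : IsProbabilityMeasure M.jumpLaw := M.jumpLaw_prob
instance : IsProbabilityMeasure (expMeasure M.β) := isProbabilityMeasure_expMeasure M.β_pos
instance : IsProbabilityMeasure (expMeasure 1) := isProbabilityMeasure_expMeasure zero_lt_one

instance : IsProbabilityMeasure M.entryLaw := by unfold Model.entryLaw; infer_instance

theorem Model.P_eq : M.P = Measure.infinitePi (fun _ : ℕ => M.entryLaw) := rfl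

instance : IsProbabilityMeasure M.P := by rw [Model.P_eq]; infer_instance

theorem measurePreserving_entry (i : ℕ) :
    MeasurePreserving (fun ω : Sample => ω i) M.P M.entryLaw :=
  measurePreserving_eval_infinitePi (fun _ : ℕ => M.entryLaw) i

theorem measurePreserving_wait :
    MeasurePreserving (fun z : ℝ × ℝ × ℝ × ℝ => z.1) M.entryLaw (expMeasure M.β) :=
  measurePreserving_fst

theorem measurePreserving_jump :
    MeasurePreserving (fun z : ℝ × ℝ × ℝ × ℝ => z.2.1) M.entryLaw M.jumpLaw :=
  measurePreserving_fst.comp measurePreserving_snd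

theorem measurePreserving_clock :
    MeasurePreserving (fun z : ℝ × ℝ × ℝ × ℝ => z.2.2.1) M.entryLaw (expMeasure 1) :=
  measurePreserving_fst.comp (measurePreserving_snd.comp measurePreserving_snd)

theorem measurePreserving_claim :
    MeasurePreserving (fun z : ℝ × ℝ × ℝ × ℝ => z.2.2.2) M.entryLaw M.claimLaw :=
  measurePreserving_snd.comp (measurePreserving_snd.comp measurePreserving_snd)

theorem integrable_id_expMeasure {r : ℝ} (hr : 0 < r) :
    Integrable (fun t : ℝ => t) (expMeasure r) := by
  refine ⟨measurable_id.aestronglyMeasurable, ?_⟩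
  rw [hasFiniteIntegral_iff_ofReal ((ae_expMeasure_pos hr).mono fun _ h => h.le),
    lintegral_id_expMeasure hr]
  exact ENNReal.ofReal_lt_top

/-- Sums of i.i.d. positive integrable variables diverge. -/
theorem ae_tendsto_sum {ν : Measure ℝ} [IsProbabilityMeasure ν] (hpos : ∀ᵐ t ∂ν, 0 < t)
    (hint : Integrable (fun t : ℝ => t) ν) {g : ℝ × ℝ × ℝ × ℝ → ℝ}
    (hg : MeasurePreserving g M.entryLaw ν) :
    ∀ᵐ ω ∂M.P, Tendsto (fun n => ∑ i ∈ Finset.range n, g (ω i)) atTop atTop := by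
  have hmp : ∀ i, MeasurePreserving (fun ω : Sample => g (ω i)) M.P ν :=
    fun i => hg.comp (measurePreserving_entry i)
  have hindep : iIndepFun (fun (i : ℕ) (ω : Sample) => g (ω i)) M.P :=
    iIndepFun_infinitePi (P := fun _ : ℕ => M.entryLaw) (X := fun _ => g) fun _ => hg.measurable
  have hI : Integrable (fun ω : Sample => g (ω 0)) M.P := by
    have := (hmp 0).integrable_comp_of_integrable hint
    exact this
  have hslln := strong_law_ae_real (μ := M.P) (fun i ω => g (ω i)) hI
    (fun i j hij => hindep.indepFun hij)
    (fun i => ⟨(hmp i).measurable.aemeasurable, (hmp 0).measurable.aemeasurable,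
      by rw [(hmp i).map_eq, (hmp 0).map_eq]⟩)
  have hmean : 0 < ∫ ω, g (ω 0) ∂M.P := by
    have hp : ∀ᵐ ω ∂M.P, 0 < g (ω 0) := (hmp 0).quasiMeasurePreserving.ae hpos
    rw [integral_pos_iff_support_of_nonneg_ae (hp.mono fun _ h => h.le) hI]
    rw [pos_iff_ne_zero]
    intro h0
    have h1 : ∀ᵐ ω ∂M.P, ω ∉ Function.support fun ω : Sample => g (ω 0) :=
      measure_eq_zero_iff_ae_notMem.1 h0
    obtain ⟨ω, h2, h3⟩ := (hp.and h1).exists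
    exact h3 h2.ne'
  filter_upwards [hslln] with ω hω
  have h1 : Tendsto (fun n : ℕ => (n : ℝ)) atTop atTop := tendsto_natCast_atTop_atTop
  refine (h1.atTop_mul_pos hmean hω).congr' ?_
  filter_upwards [eventually_gt_atTop 0] with n hn
  have : (n : ℝ) ≠ 0 := by positivity
  field_simp

theorem ae_good : ∀ᵐ ω ∂M.P, Good ω := by
  have h1 : ∀ᵐ ω ∂M.P, ∀ i, 0 < (ω i).1 := ae_all_iff.2 fun i =>
    (measurePreserving_wait.comp (measurePreserving_entry i)).quasiMeasurePreserving.ae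
      (ae_expMeasure_pos M.β_pos)
  have h2 : ∀ᵐ ω ∂M.P, ∀ i, 0 < (ω i).2.1 := ae_all_iff.2 fun i =>
    (measurePreserving_jump.comp (measurePreserving_entry i)).quasiMeasurePreserving.ae
      M.jump_pos
  have h3 : ∀ᵐ ω ∂M.P, ∀ i, 0 < (ω i).2.2.1 := ae_all_iff.2 fun i =>
    (measurePreserving_clock.comp (measurePreserving_entry i)).quasiMeasurePreserving.ae
      (ae_expMeasure_pos zero_lt_one)
  have h4 : ∀ᵐ ω ∂M.P, ∀ i, 0 < (ω i).2.2.2 := ae_all_iff.2 fun i =>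
    (measurePreserving_claim.comp (measurePreserving_entry i)).quasiMeasurePreserving.ae
      M.claim_pos
  filter_upwards [h1, h2, h3, h4,
    ae_tendsto_sum (ae_expMeasure_pos M.β_pos) (integrable_id_expMeasure M.β_pos)
      measurePreserving_wait,
    ae_tendsto_sum M.jump_pos M.jump_integrable measurePreserving_jump,
    ae_tendsto_sum (ae_expMeasure_pos zero_lt_one) (integrable_id_expMeasure zero_lt_one)
      measurePreserving_clock,
    ae_tendsto_sum M.claim_pos M.claim_integrable measurePreserving_claim]
    with ω p1 p2 p3 p4 t1 t2 t3 t4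
  exact ⟨fun i => ⟨p1 i, p2 i, p3 i, p4 i⟩, t1, t2, t3, t4⟩

@[fun_prop]
theorem measurable_catTime (k : ℕ) : Measurable fun ω : Sample => catTime ω k := by
  unfold catTime; fun_prop

@[fun_prop]
theorem measurable_clockTime (k : ℕ) : Measurable fun ω : Sample => clockTime ω k := by
  unfold clockTime; fun_prop

@[fun_prop]
theorem measurable_jumpSize (k : ℕ) : Measurable fun ω : Sample => jumpSize ω k := by
  unfold jumpSize; fun_prop

@[fun_prop]
theorem measurable_claimSize (k : ℕ) : Measurable fun ω : Sample => claimSize ω k := by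
  unfold claimSize; fun_prop

@[fun_prop]
theorem measurable_clock (m : ℕ) (t : ℝ) : Measurable fun ω : Sample => M.clock lam ω m t := by
  unfold Model.clock Model.ramp; fun_prop

theorem measurableSet_good : MeasurableSet {ω | Good ω} := by
  have : {ω | Good ω} = {ω : Sample | ∀ i, 0 < (ω i).1 ∧ 0 < (ω i).2.1 ∧ 0 < (ω i).2.2.1 ∧
      0 < (ω i).2.2.2} ∩ {ω | Tendsto (fun n => ∑ i ∈ Finset.range n, (ω i).1) atTop atTop} ∩
      {ω | Tendsto (fun n => ∑ i ∈ Finset.range n, (ω i).2.1) atTop atTop} ∩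
      {ω | Tendsto (fun n => ∑ i ∈ Finset.range n, (ω i).2.2.1) atTop atTop} ∩
      {ω | Tendsto (fun n => ∑ i ∈ Finset.range n, (ω i).2.2.2) atTop atTop} := by
    ext ω
    exact ⟨fun h => ⟨⟨⟨⟨h.pos, h.sum_wait⟩, h.sum_jump⟩, h.sum_clock⟩, h.sum_claim⟩,
      fun ⟨⟨⟨⟨h1, h2⟩, h3⟩, h4⟩, h5⟩ => ⟨h1, h2, h3, h4, h5⟩⟩
  rw [this]
  refine ((((MeasurableSet.inter ?_ ?_).inter ?_).inter ?_).inter ?_)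
  · have : ∀ g : ℝ × ℝ × ℝ × ℝ → ℝ, Measurable g → ∀ i, MeasurableSet {ω : Sample | 0 < g (ω i)} :=
      fun g hg i => measurableSet_lt measurable_const (hg.comp (measurable_pi_apply i))
    simp only [ofPred_forall]
    refine MeasurableSet.iInter fun i => ?_
    exact (this _ (by fun_prop) i).inter ((this (fun z => z.2.1) (by fun_prop) i).inter
      ((this (fun z => z.2.2.1) (by fun_prop) i).inter
        (this (fun z => z.2.2.2) (by fun_prop) i)))
  all_goals exact measurableSet_tendsto atTop fun n => by fun_prop

/-- The clocks with `m` shots increase with `m` and reach the integrated intensity once `m` is the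
number of catastrophes, so the event is a countable union of explicit ones. -/
theorem measurableSet_claimTime_le (hlam : M.lamBase ≤ lam) (n : ℕ) (t : ℝ) :
    MeasurableSet {ω | Good ω ∧ M.claimTime lam ω n ≤ t} := by
  by_cases ht : 0 ≤ t
  · have : {ω | Good ω ∧ M.claimTime lam ω n ≤ t}
        = {ω | Good ω} ∩ ⋃ m, {ω | clockTime ω n ≤ M.clock lam ω m t} := by
      ext ω
      simp only [mem_inter_iff, mem_iUnion]
      refine and_congr_right fun h => ?_
      rw [h.claimTime_le_iff hlam n ht]
      constructor
      · intro hle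
        exact ⟨catCount ω t, by rwa [h.cumIntensity_eq hlam ht le_rfl] at hle⟩
      · rintro ⟨m, hm⟩
        have hm' : clockTime ω n ≤ M.clock lam ω m t := hm
        rw [h.cumIntensity_eq hlam ht (le_max_left _ m)]
        exact hm'.trans (h.clock_le_clock (le_max_right _ _) t)
    rw [this]
    exact measurableSet_good.inter (MeasurableSet.iUnion fun m =>
      measurableSet_le (measurable_clockTime n) (measurable_clock m t))
  · have : {ω | Good ω ∧ M.claimTime lam ω n ≤ t} = ∅ := by
      ext ω
      simp only [mem_empty_iff_false, iff_false]
      rintro ⟨h, hle⟩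
      exact ht ((h.claimTime_nonneg hlam n).trans hle)
    rw [this]
    exact MeasurableSet.empty

section info

theorem info_mono {s t : ℝ} (hst : s ≤ t) : M.info lam s ≤ M.info lam t := by
  refine MeasurableSpace.generateFrom_mono ?_
  rintro A ((⟨k, u, B, hu, hB, rfl⟩ | ⟨k, u, B, hu, hB, rfl⟩) | h)
  · exact Or.inl (Or.inl ⟨k, u, B, hu.trans hst, hB, rfl⟩)
  · exact Or.inl (Or.inr ⟨k, u, B, hu.trans hst, hB, rfl⟩)
  · exact Or.inr h

theorem info_of_null {t : ℝ} {A : Set Sample} (h : M.P A = 0) : MeasurableSet[M.info lam t] A :=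
  MeasurableSpace.measurableSet_generateFrom (Or.inr h)

theorem info_catTime {s t : ℝ} (hst : s ≤ t) (k : ℕ) {B : Set ℝ} (hB : MeasurableSet B) :
    MeasurableSet[M.info lam t] {ω | catTime ω k ≤ s ∧ jumpSize ω k ∈ B} :=
  MeasurableSpace.measurableSet_generateFrom (Or.inl (Or.inl ⟨k, s, B, hst, hB, rfl⟩))

theorem info_claimTime {s t : ℝ} (hst : s ≤ t) (k : ℕ) {B : Set ℝ} (hB : MeasurableSet B) :
    MeasurableSet[M.info lam t] {ω | M.claimTime lam ω k ≤ s ∧ claimSize ω k ∈ B} :=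
  MeasurableSpace.measurableSet_generateFrom (Or.inl (Or.inr ⟨k, s, B, hst, hB, rfl⟩))

/-- Completeness of the σ-field: adaptedness need be checked only after a change on a null set, in
particular only on good samples. -/
theorem info_congr {t : ℝ} {A B : Set Sample} (hA : MeasurableSet[M.info lam t] A)
    (h : ∀ᵐ ω ∂M.P, ω ∈ A ↔ ω ∈ B) : MeasurableSet[M.info lam t] B := by
  have hnull : ∀ C ⊆ {ω | ¬ (ω ∈ A ↔ ω ∈ B)}, MeasurableSet[M.info lam t] C :=
    fun C hC => info_of_null (measure_mono_null hC (ae_iff.1 h))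
  have : B = (A ∪ (B \ A)) \ (A \ B) := by
    ext ω; simp only [Set.mem_sdiff, mem_union]; tauto
  rw [this]
  refine @MeasurableSet.diff _ (M.info lam t) _ _
    (@MeasurableSet.union _ (M.info lam t) _ _ hA (hnull _ ?_)) (hnull _ ?_)
  · rintro ω ⟨h1, h2⟩ h3; exact h2 (h3.2 h1)
  · rintro ω ⟨h1, h2⟩ h3; exact h2 (h3.1 h1)

theorem info_measurable_congr {β : Type*} [MeasurableSpace β] {t : ℝ} {f g : Sample → β}
    (hf : Measurable[M.info lam t] f) (h : ∀ᵐ ω ∂M.P, f ω = g ω) :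
    Measurable[M.info lam t] g := fun B hB =>
  info_congr (hf hB) (h.mono fun ω hω => by simp only [mem_preimage, hω])

/-- The generators are measurable up to null sets. The path of a strategy at a fixed time is thus
almost everywhere measurable and can be integrated. -/
theorem nullMeasurableSet_of_info (hlam : M.lamBase ≤ lam) {t : ℝ} {A : Set Sample}
    (hA : MeasurableSet[M.info lam t] A) : NullMeasurableSet A M.P := by
  have hle : M.info lam t ≤ (inferInstance : MeasurableSpace (NullMeasurableSpace Sample M.P)) := by
    refine MeasurableSpace.generateFrom_le ?_
    rintro A ((⟨k, u, B, hu, hB, rfl⟩ | ⟨k, u, B, hu, hB, rfl⟩) | h)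
    · exact ((measurableSet_le (measurable_catTime k) measurable_const).inter
        (measurable_jumpSize k hB)).nullMeasurableSet
    · refine ((measurableSet_claimTime_le hlam k u).inter
        (measurable_claimSize k hB)).nullMeasurableSet.congr ?_
      filter_upwards [ae_good (M := M)] with ω hω
      exact propext ⟨fun ⟨h1, h2⟩ => ⟨h1.2, h2⟩, fun ⟨h1, h2⟩ => ⟨⟨hω, h1⟩, h2⟩⟩
    · exact NullMeasurableSet.of_null h
  exact hle A hA

theorem aemeasurable_of_info (hlam : M.lamBase ≤ lam) {t : ℝ} {f : Sample → ℝ}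
    (hf : Measurable[M.info lam t] f) : AEMeasurable f M.P := by
  have : NullMeasurable f M.P := fun B hB => nullMeasurableSet_of_info hlam (hf hB)
  exact this.aemeasurable

end info

end

/-! ### Adaptedness of the grid strategies; monotonicity under halving -/

section

theorem measurable_apply_nat {Ω β : Type*} {m : MeasurableSpace Ω} [MeasurableSpace β]
    {f : ℕ → Ω → β} (hf : ∀ n, Measurable (f n)) {k : Ω → ℕ} (hk : Measurable k) :
    Measurable fun ω => f (k ω) ω := by
  have h : Measurable fun z : ℕ × Ω => f z.1 z.2 :=
    measurable_from_prod_countable_right fun n => hf n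
  exact h.comp (hk.prodMk measurable_id)

/-- A right-continuous process evaluated at a random time that is bounded by `t`. -/
theorem measurable_apply_of_rightContinuous {Ω : Type*} {m : MeasurableSpace Ω} {t : ℝ}
    {Z : Ω → ℝ → ℝ} {S : Ω → ℝ} (hZ : ∀ u, 0 ≤ u → u ≤ t → Measurable fun ω => Z ω u)
    (hc : ∀ ω u, 0 ≤ u → ContinuousWithinAt (Z ω) (Ici u) u) (hS : Measurable S)
    (hS0 : ∀ ω, 0 ≤ S ω) (hSt : ∀ ω, S ω ≤ t) : Measurable fun ω => Z ω (S ω) := by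
  set a : ℕ → Ω → ℝ := fun k ω => min t (((⌊S ω * (k + 1)⌋₊ : ℝ) + 1) / (k + 1)) with ha
  have hle : ∀ k ω, S ω ≤ a k ω := fun k ω => by
    refine le_min (hSt ω) ?_
    rw [le_div_iff₀ (by positivity)]
    exact (Nat.lt_floor_add_one _).le
  have hlim : ∀ ω, Tendsto (fun k => a k ω) atTop (𝓝 (S ω)) := fun ω => by
    have h1 : Tendsto (fun k : ℕ => S ω + 1 / ((k : ℝ) + 1)) atTop (𝓝 (S ω)) := by
      simpa using tendsto_const_nhds.add (tendsto_one_div_add_atTop_nhds_zero_nat (𝕜 := ℝ))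
    refine tendsto_of_tendsto_of_tendsto_of_le_of_le tendsto_const_nhds h1 (fun k => hle k ω)
      fun k => (min_le_right _ _).trans ?_
    have h2 := Nat.floor_le (a := S ω * (k + 1)) (mul_nonneg (hS0 ω) (by positivity))
    rw [div_le_iff₀ (by positivity), add_mul, div_mul_cancel₀ _ (by positivity)]
    linarith
  refine measurable_of_tendsto_metrizable (f := fun k ω => Z ω (a k ω)) (fun k => ?_)
    (tendsto_pi_nhds.2 fun ω => ?_)
  · refine measurable_apply_nat (f := fun n ω => Z ω (min t (((n : ℝ) + 1) / (k + 1))))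
      (k := fun ω => ⌊S ω * (k + 1)⌋₊) (fun n => ?_)
      (Nat.measurable_floor.comp (hS.mul_const _))
    rcases isEmpty_or_nonempty Ω with h | ⟨⟨ω⟩⟩
    · exact measurable_of_empty _
    · exact hZ _ (le_min ((hS0 ω).trans (hSt ω)) (by positivity)) (min_le_left _ _)
  · exact (hc ω (S ω) (hS0 ω)).tendsto.comp
      (tendsto_nhdsWithin_iff.2 ⟨hlim ω, Eventually.of_forall fun k => hle k ω⟩)

variable {M : Model} {x lam δ t : ℝ} {ω : Sample}

theorem info_claimCount (hlam : M.lamBase ≤ lam) (t : ℝ) :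
    Measurable[M.info lam t] fun ω => M.claimCount lam ω t := by
  refine measurable_of_Ioi fun n => info_congr (info_claimTime le_rfl n MeasurableSet.univ) ?_
  filter_upwards [ae_good (M := M)] with ω hω
  simpa using ((hω.regular hlam).lt_claimCount t n).symm

theorem info_catCount (t : ℝ) : Measurable[M.info lam t] fun ω => catCount ω t := by
  refine measurable_of_Ioi fun n => info_congr (info_catTime le_rfl n MeasurableSet.univ) ?_
  filter_upwards [ae_good (M := M)] with ω hω
  simpa using (hω.lt_catCount t n).symm

theorem info_eventCount (hlam : M.lamBase ≤ lam) (t : ℝ) :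
    Measurable[M.info lam t] fun ω => M.eventCount lam ω t :=
  (info_claimCount hlam t).add (info_catCount t)

theorem info_min_claimTime (n : ℕ) (t : ℝ) :
    Measurable[M.info lam t] fun ω => min (M.claimTime lam ω n) t := by
  refine measurable_of_Iic fun a => ?_
  rcases le_or_gt t a with h | h
  · convert @MeasurableSet.univ _ (M.info lam t)
    ext ω
    simp [h]
  · convert info_claimTime (M := M) (lam := lam) h.le n MeasurableSet.univ using 1
    ext ω
    simp [h]

theorem info_min_catTime (n : ℕ) (t : ℝ) :
    Measurable[M.info lam t] fun ω => min (catTime ω n) t := by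
  refine measurable_of_Iic fun a => ?_
  rcases le_or_gt t a with h | h
  · convert @MeasurableSet.univ _ (M.info lam t)
    ext ω
    simp [h]
  · convert info_catTime (M := M) (lam := lam) h.le n MeasurableSet.univ using 1
    ext ω
    simp [h]

theorem info_claimSize (n : ℕ) (t : ℝ) :
    Measurable[M.info lam t] ({ω | M.claimTime lam ω n ≤ t}.indicator fun ω => claimSize ω n) := by
  intro B hB
  -- Outside the event the indicator is `0`. If `0 ∈ B`, the preimage contains that whole part, and
  -- its complement is a generator.
  by_cases h0 : (0 : ℝ) ∈ B
  · convert @MeasurableSet.compl _ _ (M.info lam t)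
      (info_claimTime (M := M) (lam := lam) le_rfl n hB.compl) using 1
    ext ω
    by_cases h : M.claimTime lam ω n ≤ t <;> simp [h, h0]
  · convert info_claimTime (M := M) (lam := lam) le_rfl n hB using 1
    ext ω
    by_cases h : M.claimTime lam ω n ≤ t <;> simp [h, h0]

theorem info_surplus (hlam : M.lamBase ≤ lam) (x t : ℝ) :
    Measurable[M.info lam t] fun ω => M.surplus x lam ω t := by
  have h1 : Measurable[M.info lam t] fun ω => x + M.p * t -
      ∑ j ∈ Finset.range (M.claimCount lam ω t),
        {ω | M.claimTime lam ω j ≤ t}.indicator (fun ω => claimSize ω j) ω := by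
    refine Measurable.const_sub ?_ _
    refine measurable_apply_nat (f := fun n ω => ∑ j ∈ Finset.range n,
        {ω | M.claimTime lam ω j ≤ t}.indicator (fun ω => claimSize ω j) ω) (fun n => ?_)
      (info_claimCount hlam t)
    exact Finset.measurable_fun_sum _ fun j _ => info_claimSize j t
  refine info_measurable_congr h1 ?_
  filter_upwards [ae_good (M := M)] with ω hω
  unfold Model.surplus
  congr 1
  refine Finset.sum_congr rfl fun j hj => indicator_of_mem ?_ _
  exact ((hω.regular hlam).lt_claimCount t j).1 (Finset.mem_range.1 hj)

theorem info_lastEvent (hlam : M.lamBase ≤ lam) (t : ℝ) :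
    Measurable[M.info lam t] fun ω => M.lastEvent lam ω t := by
  have h1 : Measurable[M.info lam t] fun ω =>
      max (lastOf (fun n => min (M.claimTime lam ω n) t) (M.claimCount lam ω t))
        (lastOf (fun n => min (catTime ω n) t) (catCount ω t)) := by
    refine Measurable.max ?_ ?_
    · refine measurable_apply_nat (f := fun n ω => lastOf (fun n => min (M.claimTime lam ω n) t) n)
        (fun n => ?_) (info_claimCount hlam t)
      cases n with
      | zero => exact measurable_const
      | succ n => exact info_min_claimTime n t
    · refine measurable_apply_nat (f := fun n ω => lastOf (fun n => min (catTime ω n) t) n)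
        (fun n => ?_) (info_catCount t)
      cases n with
      | zero => exact measurable_const
      | succ n => exact info_min_catTime n t
  refine info_measurable_congr h1 ?_
  filter_upwards [ae_good (M := M)] with ω hω
  have hR := hω.regular hlam
  unfold Model.lastEvent
  congr 1
  · cases h : M.claimCount lam ω t with
    | zero => rfl
    | succ n => exact min_eq_left ((hR.lt_claimCount t n).1 (by omega))
  · cases h : catCount ω t with
    | zero => rfl
    | succ n => exact min_eq_left ((hR.lt_catCount t n).1 (by omega))

theorem info_epoch (hlam : M.lamBase ≤ lam) (t : ℝ) :
    Measurable[M.info lam t] fun ω => M.epoch lam δ ω t := by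
  have h := info_lastEvent hlam t
  unfold Model.epoch
  refine h.add (Measurable.mul_const ?_ _)
  exact (measurable_from_top (f := fun n : ℕ => (n : ℝ))).comp
    (Nat.measurable_floor.comp ((h.const_sub t).div_const δ))

section grid

variable {G : Sample → ℝ → ℝ}

theorem info_tracking (hlam : M.lamBase ≤ lam) (hδ : 0 < δ)
    (hGa : ∀ t, 0 ≤ t → Measurable[M.info lam t] fun ω => G ω t)
    (hGc : ∀ ω t, 0 ≤ t → ContinuousWithinAt (G ω) (Ici t) t) (ht : 0 ≤ t) :
    Measurable[M.info lam t] fun ω => M.tracking x lam δ (G ω) ω t := by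
  -- The clamping to `[0, t]` changes nothing on good samples; it makes the bounds on the random
  -- time hold everywhere.
  have hS : Measurable[M.info lam t] fun ω => max 0 (min (M.epoch lam δ ω t) t) :=
    Measurable.max measurable_const ((info_epoch hlam t).min measurable_const)
  -- The surplus at the epoch is recovered from the surplus at `t`, since only premiums arrive in
  -- between.
  have hX : Measurable[M.info lam t] fun ω =>
      M.surplus x lam ω t - M.p * (t - M.epoch lam δ ω t) :=
    (info_surplus hlam x t).sub (((info_epoch hlam t).const_sub t).const_mul _)
  have hG : Measurable[M.info lam t] fun ω => G ω (max 0 (min (M.epoch lam δ ω t) t)) :=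
    measurable_apply_of_rightContinuous (fun u hu hut => (hGa u hu).mono (info_mono hut) le_rfl)
      hGc hS (fun ω => le_max_left _ _) (fun ω => max_le ht (min_le_right _ _))
  have hn : Measurable[M.info lam t] fun ω => (M.eventCount lam ω t : ℝ) :=
    (measurable_from_top (f := fun n : ℕ => (n : ℝ))).comp (info_eventCount hlam t)
  have hfl : Measurable (M.gridFloor δ) := by
    have h : Measurable fun x : ℝ => x / (M.p * δ) := by fun_prop
    exact ((measurable_from_top (f := fun n : ℕ => (n : ℝ))).comp
      (Nat.measurable_floor.comp h)).mul_const _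
  refine info_measurable_congr
    (hX.sub (hfl.comp (hX.sub (hG.add (hn.mul_const (M.p * δ)))))) ?_
  filter_upwards [ae_good (M := M)] with ω hω
  have hR := hω.regular hlam
  have h1 := hR.surplus_epoch hδ x ht
  have h2 : max 0 (min (M.epoch lam δ ω t) t) = M.epoch lam δ ω t := by
    rw [min_eq_left (hR.epoch_le hδ ht), max_eq_right (hR.epoch_nonneg hδ t)]
  have h3 : M.surplus x lam ω t - M.p * (t - M.epoch lam δ ω t)
      = M.surplus x lam ω (M.epoch lam δ ω t) := by linarith
  simp only [Pi.sub_apply, Pi.add_apply, Function.comp_apply, Model.tracking, Model.gridTarget, h2,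
    h3]

/-- The first time can be moved to a rational on its right because `tracking` is locally constant
there, the second because the surplus is right-continuous and the inequality strict. The time `t`
itself admits no shift to the right, whence the separate clause. -/
theorem Model.Regular.overdrawn_iff_rat (hR : M.Regular lam ω) (hδ : 0 < δ) {g : ℝ → ℝ} (t : ℝ) :
    M.Overdrawn x lam δ g ω t ↔ ∃ u : ℚ, (0 : ℝ) ≤ u ∧
      ((∃ v : ℚ, (u : ℝ) < v ∧ (v : ℝ) ≤ t ∧ M.surplus x lam ω v < M.tracking x lam δ g ω u) ∨
        ((u : ℝ) < t ∧ M.surplus x lam ω t < M.tracking x lam δ g ω u)) := by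
  constructor
  · rintro ⟨u, v, hu, huv, hvt, hlt⟩
    obtain ⟨t', hut', hconst⟩ := hR.exists_tracking_const (x := x) (G := g) hδ hu
    obtain ⟨u', hu1, hu2⟩ := exists_rat_btwn (lt_min hut' huv)
    have hC := hconst u' hu1.le (hu2.trans_le (min_le_left _ _))
    have hu'v := hu2.trans_le (min_le_right _ _)
    refine ⟨u', hu.trans hu1.le, ?_⟩
    rcases hvt.lt_or_eq with hvt | rfl
    · left
      have hp := M.p_pos
      obtain ⟨v', hv1, hv2⟩ := exists_rat_btwn (lt_min (lt_min hvt (hR.lt_nextEvent v))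
        (show v < v + (M.tracking x lam δ g ω u - M.surplus x lam ω v) / M.p by
          have : 0 < (M.tracking x lam δ g ω u - M.surplus x lam ω v) / M.p :=
            div_pos (by linarith) hp
          linarith))
      have h1 := hv2.trans_le ((min_le_left _ _).trans (min_le_left _ _))
      have h2 := hv2.trans_le ((min_le_left _ _).trans (min_le_right _ _))
      have h3 := hv2.trans_le (min_le_right _ _)
      refine ⟨v', hu'v.trans hv1, h1.le, ?_⟩
      rw [hC, Model.Regular.surplus_eq_add x (hR.claimCount_eq hv1.le
        (hR.eventCount_of_lt_nextEvent hv1.le h2))]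
      rw [← sub_lt_iff_lt_add', lt_div_iff₀ hp] at h3
      linarith
    · right
      exact ⟨hu'v, by rwa [hC]⟩
  · rintro ⟨u, hu, ⟨v, huv, hvt, hlt⟩ | ⟨hut, hlt⟩⟩
    · exact ⟨u, v, hu, huv, hvt, hlt⟩
    · exact ⟨u, t, hu, hut, le_rfl, hlt⟩

theorem info_overdrawn (hlam : M.lamBase ≤ lam) (hδ : 0 < δ)
    (hGa : ∀ t, 0 ≤ t → Measurable[M.info lam t] fun ω => G ω t)
    (hGc : ∀ ω t, 0 ≤ t → ContinuousWithinAt (G ω) (Ici t) t) (t : ℝ) :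
    MeasurableSet[M.info lam t] {ω | M.Overdrawn x lam δ (G ω) ω t} := by
  have hC : ∀ u : ℝ, 0 ≤ u → u ≤ t →
      Measurable[M.info lam t] fun ω => M.tracking x lam δ (G ω) ω u := fun u hu hut =>
    (info_tracking hlam hδ hGa hGc hu).mono (info_mono hut) le_rfl
  have hX : ∀ u : ℝ, u ≤ t → Measurable[M.info lam t] fun ω => M.surplus x lam ω u := fun u hut =>
    (info_surplus hlam x u).mono (info_mono hut) le_rfl
  have key : MeasurableSet[M.info lam t] (⋃ u : ℚ,
      (⋃ v : ℚ, {ω | 0 ≤ (u : ℝ) ∧ (u : ℝ) < v ∧ (v : ℝ) ≤ t ∧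
        M.surplus x lam ω v < M.tracking x lam δ (G ω) ω u}) ∪
      {ω | 0 ≤ (u : ℝ) ∧ (u : ℝ) < t ∧
        M.surplus x lam ω t < M.tracking x lam δ (G ω) ω u}) := by
    refine MeasurableSet.iUnion fun u => MeasurableSet.union (MeasurableSet.iUnion fun v => ?_) ?_
    · by_cases h : 0 ≤ (u : ℝ) ∧ (u : ℝ) < v ∧ (v : ℝ) ≤ t
      · convert measurableSet_lt (hX v h.2.2) (hC u h.1 (h.2.1.le.trans h.2.2)) using 1
        ext ω; simp only [mem_ofPred_eq]; tauto
      · convert @MeasurableSet.empty _ (M.info lam t) using 1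
        ext ω; simp only [mem_ofPred_eq, mem_empty_iff_false]; tauto
    · by_cases h : 0 ≤ (u : ℝ) ∧ (u : ℝ) < t
      · convert measurableSet_lt (hX t le_rfl) (hC u h.1 h.2.le) using 1
        ext ω; simp only [mem_ofPred_eq]; tauto
      · convert @MeasurableSet.empty _ (M.info lam t) using 1
        ext ω; simp only [mem_ofPred_eq, mem_empty_iff_false]; tauto
  refine info_congr key ?_
  filter_upwards [ae_good (M := M)] with ω hω
  have h := (hω.regular hlam).overdrawn_iff_rat (x := x) (g := G ω) hδ t
  simp only [mem_iUnion, mem_union, mem_ofPred_eq]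
  rw [h]
  constructor
  · rintro ⟨u, ⟨v, h1, h2, h3, h4⟩ | ⟨h1, h2, h3⟩⟩
    · exact ⟨u, h1, Or.inl ⟨v, h2, h3, h4⟩⟩
    · exact ⟨u, h1, Or.inr ⟨h2, h3⟩⟩
  · rintro ⟨u, h1, ⟨v, h2, h3, h4⟩ | ⟨h2, h3⟩⟩
    · exact ⟨u, Or.inl ⟨v, h1, h2, h3, h4⟩⟩
    · exact ⟨u, Or.inr ⟨h1, h2, h3⟩⟩

open scoped Classical in
-- Replaces the supremum by a countable one, for measurability. The value `tracking … 0` serves as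
-- default for excluded rationals: it always belongs to the set.
theorem Model.Regular.gridPath_eq_ite (hR : M.Regular lam ω) (hδ : 0 < δ) {g : ℝ → ℝ}
    (hg : MonotoneOn g (Ici 0)) (ht : 0 ≤ t) :
    M.gridPath x lam δ g ω t = if M.Overdrawn x lam δ g ω t then
      ⨆ u : ℚ, (if 0 ≤ (u : ℝ) ∧ (u : ℝ) ≤ t ∧ ¬ M.Overdrawn x lam δ g ω u then
        M.tracking x lam δ g ω u else M.tracking x lam δ g ω 0)
      else M.tracking x lam δ g ω t := by
  split_ifs with h
  · have hle : ∀ u : ℚ, (if 0 ≤ (u : ℝ) ∧ (u : ℝ) ≤ t ∧ ¬ M.Overdrawn x lam δ g ω u then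
        M.tracking x lam δ g ω u else M.tracking x lam δ g ω 0)
        ≤ M.gridPath x lam δ g ω t := fun u => by
      split_ifs with hu
      · exact hR.le_gridPath hδ hu.1 hu.2.1 hu.2.2
      · exact hR.le_gridPath hδ le_rfl ht Model.Regular.not_overdrawn_zero
    refine le_antisymm (Model.Regular.gridPath_le ht fun u hu hut hnu => ?_) (ciSup_le hle)
    rcases hR.overdrawn_dichotomy hδ x g with hn | ⟨n, hn, -⟩
    · exact absurd h (hn t)
    have hun : u < M.claimTime lam ω n := not_le.1 fun hc => hnu ((hn u).2 hc)
    obtain ⟨t', hut', hconst⟩ := hR.exists_tracking_const (x := x) (G := g) hδ hu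
    obtain ⟨u', hu1, hu2⟩ := exists_rat_btwn (lt_min hut' hun)
    rw [← hconst u' hu1.le (hu2.trans_le (min_le_left _ _))]
    have hu3 := hu2.trans_le (min_le_right _ _)
    refine le_trans (le_of_eq ?_) (le_ciSup ⟨_, forall_mem_range.2 hle⟩ u')
    rw [if_pos ⟨hu.trans hu1.le, hu3.le.trans ((hn t).1 h),
      fun hc => absurd ((hn u').1 hc) (not_le.2 hu3)⟩]
  · exact hR.gridPath_eq hδ hg ht h

variable {hx : 0 ≤ x} {hδ : 0 < δ} {hG : ∀ ω, MonotoneOn (G ω) (Ici 0)}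
  {hG0 : ∀ ω t, 0 ≤ t → 0 ≤ G ω t}

theorem info_gridDividends (hlam : M.lamBase ≤ lam)
    (hGa : ∀ t, 0 ≤ t → Measurable[M.info lam t] fun ω => G ω t)
    (hGc : ∀ ω t, 0 ≤ t → ContinuousWithinAt (G ω) (Ici t) t) (ht : 0 ≤ t) :
    Measurable[M.info lam t] fun ω => M.gridDividends x lam δ hx hδ G hG hG0 ω t := by
  classical
  have hC : ∀ u : ℝ, 0 ≤ u → u ≤ t →
      Measurable[M.info lam t] fun ω => M.tracking x lam δ (G ω) ω u := fun u hu hut =>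
    (info_tracking hlam hδ hGa hGc hu).mono (info_mono hut) le_rfl
  have hO : ∀ u : ℝ, u ≤ t →
      MeasurableSet[M.info lam t] {ω | M.Overdrawn x lam δ (G ω) ω u} := fun u hut =>
    info_mono hut _ (info_overdrawn hlam hδ hGa hGc u)
  have key : Measurable[M.info lam t] fun ω => if M.Overdrawn x lam δ (G ω) ω t then
      ⨆ u : ℚ, (if 0 ≤ (u : ℝ) ∧ (u : ℝ) ≤ t ∧ ¬ M.Overdrawn x lam δ (G ω) ω u then
        M.tracking x lam δ (G ω) ω u else M.tracking x lam δ (G ω) ω 0)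
      else M.tracking x lam δ (G ω) ω t := by
    refine Measurable.ite (hO t le_rfl) (Measurable.iSup fun u => ?_) (hC t ht le_rfl)
    by_cases h : 0 ≤ (u : ℝ) ∧ (u : ℝ) ≤ t
    · refine Measurable.ite ?_ (hC u h.1 h.2) (hC 0 le_rfl ht)
      convert @MeasurableSet.compl _ _ (M.info lam t) (hO u h.2) using 1
      ext ω
      simp only [mem_ofPred_eq, mem_compl_iff]
      tauto
    · have : ∀ ω, ¬ (0 ≤ (u : ℝ) ∧ (u : ℝ) ≤ t ∧ ¬ M.Overdrawn x lam δ (G ω) ω u) := by tauto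
      simp only [this, if_false]
      exact hC 0 le_rfl ht
  refine info_measurable_congr key ?_
  filter_upwards [ae_good (M := M)] with ω hω
  have hR := hω.regular hlam
  rw [gridDividends_apply hR ht, hR.gridPath_eq_ite hδ (hG ω) ht]

theorem isGridStrategy_gridDividends (hlam : M.lamBase ≤ lam)
    (hGa : ∀ t, 0 ≤ t → Measurable[M.info lam t] fun ω => G ω t)
    (hGc : ∀ ω t, 0 ≤ t → ContinuousWithinAt (G ω) (Ici t) t) :
    M.IsGridStrategy δ x lam (M.gridDividends x lam δ hx hδ G hG hG0) fun _ => ⊤ := by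
  refine ⟨⟨⟨fun ω t ht => gridDividends_of_neg ht, fun t ht => info_gridDividends hlam hGa hGc ht,
    ?_⟩, fun t _ => ?_⟩, ?_⟩
  · filter_upwards [ae_good (M := M)] with ω hω t ht hlt
    have hR := hω.regular hlam
    have hno : ¬ M.Overdrawn x lam δ (G ω) ω t := fun hc =>
      absurd ((overdrawn_iff_ruinTime_le hR ht).1 hc) (not_le.2 hlt)
    rw [gridDividends_apply hR ht, hR.gridPath_eq hδ (hG ω) ht hno]
    exact hR.tracking_le_surplus hδ ht
  · convert @MeasurableSet.empty _ (M.info lam t) using 1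
    ext ω
    simp
  · filter_upwards [ae_good (M := M)] with ω hω
    have hR := hω.regular hlam
    exact ⟨_, hR.follows_gridPath hδ (hG ω) (hG0 ω) fun t ht => gridDividends_apply hR ht⟩

end grid

/-- The same pair of dividends and closing time is admitted for both steps; only the sequence of
actions producing it changes. -/
theorem gridV_half_le (hlam : M.lamBase ≤ lam) (hδ : 0 < δ) :
    M.gridV δ x lam ≤ M.gridV (δ / 2) x lam := by
  refine iSup_le fun L => iSup_le fun F => iSup_le fun h => ?_
  refine le_iSup_of_le L (le_iSup_of_le F (le_iSup_of_le ⟨h.1, ?_⟩ le_rfl))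
  filter_upwards [h.2, ae_good (M := M)] with ω ⟨a, ha⟩ hω
  exact ha.half (hω.regular hlam) hδ

end

/-! ### Closing the business brings no advantage over `V` -/

section

variable {M : Model} {x lam δ t : ℝ} {ω : Sample}

section stoppedPath

variable {f : ℝ → ℝ} {τ : ℝ≥0∞}

theorem stoppedPath_of_lt (h : ENNReal.ofReal t < τ) : stoppedPath f τ t = f t := if_pos h

/-- A bound for the path before `τ` passes to the left limit at `τ`. The condition `0 ≤ c` covers
negative times, which alone matter if `τ = 0`. -/
theorem stoppedPath_le (hf : Monotone f) (hf0 : ∀ t < 0, f t = 0) {c : ℝ} (hc : 0 ≤ c)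
    (ht : 0 ≤ t) (h : ∀ u, 0 ≤ u → u ≤ t → ENNReal.ofReal u < τ → f u ≤ c) :
    stoppedPath f τ t ≤ c := by
  unfold stoppedPath
  split_ifs with hτ
  · exact h t ht le_rfl hτ
  · have hle : τ.toReal ≤ t := ENNReal.toReal_le_of_le_ofReal ht (not_lt.1 hτ)
    refine le_of_tendsto (hf.tendsto_leftLim τ.toReal) ?_
    filter_upwards [self_mem_nhdsWithin] with u hu
    rcases lt_or_ge u 0 with h0 | h0
    · rw [hf0 u h0]; exact hc
    · refine h u h0 (hu.le.trans hle) ?_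
      exact (ENNReal.ofReal_lt_iff_lt_toReal h0
        (ne_top_of_le_ne_top ENNReal.ofReal_ne_top (not_lt.1 hτ))).2 hu

theorem le_stoppedPath (hf : Monotone f) {u : ℝ} (hu : 0 ≤ u) (hut : u ≤ t)
    (h : ENNReal.ofReal u < τ) : f u ≤ stoppedPath f τ t := by
  unfold stoppedPath
  split_ifs with hτ
  · exact hf hut
  · refine hf.le_leftLim ?_
    exact (ENNReal.ofReal_lt_iff_lt_toReal hu
        (ne_top_of_le_ne_top ENNReal.ofReal_ne_top (not_lt.1 hτ))).1 h

theorem stoppedPath_mono (hf : Monotone f) :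
    MonotoneOn (stoppedPath f τ) (Ici 0) := by
  intro s hs t ht hst
  by_cases h : ENNReal.ofReal s < τ
  · rw [stoppedPath_of_lt h]
    exact le_stoppedPath hf hs hst h
  · have h' : ¬ ENNReal.ofReal t < τ := fun h' => h ((ENNReal.ofReal_le_ofReal hst).trans_lt h')
    simp only [stoppedPath, if_neg h, if_neg h', le_refl]

end stoppedPath

theorem Dividends.nonneg {L : StieltjesFunction ℝ} (h : ∀ t < 0, L t = 0) (t : ℝ) : 0 ≤ L t := by
  rw [← h (min t (-1)) (by simp)]
  exact L.mono (min_le_left _ _)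

theorem Model.Regular.eventually_surplus_eq (hR : M.Regular lam ω) (x t : ℝ) :
    ∀ᶠ u in 𝓝[≥] t, M.surplus x lam ω u = M.surplus x lam ω t + M.p * (u - t) := by
  filter_upwards [self_mem_nhdsWithin, mem_nhdsWithin_of_mem_nhds (Iio_mem_nhds (hR.lt_nextEvent t))]
    with u hu1 hu2
  exact Model.Regular.surplus_eq_add x (hR.claimCount_eq hu1 (hR.eventCount_of_lt_nextEvent hu1 hu2))

theorem Model.Regular.surplus_rightContinuous (hR : M.Regular lam ω) (x t : ℝ) :
    ContinuousWithinAt (M.surplus x lam ω) (Ici t) t := by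
  have h : ContinuousWithinAt (fun u => M.surplus x lam ω t + M.p * (u - t)) (Ici t) t := by
    fun_prop
  exact h.congr_of_eventuallyEq (hR.eventually_surplus_eq x t) (by simp)

theorem J_eq {L : Dividends} (hL : ∀ ω, ∀ t < 0, L ω t = 0) :
    M.J x lam L = ∫⁻ ω, ∫⁻ t, ENNReal.ofReal (stoppedPath (L ω) (M.ruinTime x lam L ω) t)
      ∂M.killing ∂M.P :=
  lintegral_congr fun ω => lintegral_discount_lt (L ω) (hL ω) _

section closing

variable {L : Dividends} {F : Sample → ℝ≥0∞}

/-- The dividends `L`, replaced from the time `F` on by the payment of the whole surplus. -/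
def Model.closing (M : Model) (x lam : ℝ) (L : Dividends) (F : Sample → ℝ≥0∞) : Dividends :=
  fun ω =>
  open scoped Classical in
  { toFun := fun t => if 0 ≤ t ∧ F ω ≤ ENNReal.ofReal t then
      max (L ω (F ω).toReal) (M.surplus x lam ω (F ω).toReal) else L ω t
    mono' := by
      intro s t hst
      dsimp only
      split_ifs with h1 h2 h2
      · exact le_rfl
      · exact absurd ⟨h1.1.trans hst, h1.2.trans (ENNReal.ofReal_le_ofReal hst)⟩ h2
      · refine le_trans ((L ω).mono ?_) (le_max_left _ _)
        rcases lt_or_ge s 0 with h0 | h0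
        · exact h0.le.trans ENNReal.toReal_nonneg
        · have : ENNReal.ofReal s < F ω := by
            by_contra! hc
            exact h1 ⟨h0, hc⟩
          exact ((ENNReal.ofReal_lt_iff_lt_toReal h0
            (ne_top_of_le_ne_top ENNReal.ofReal_ne_top h2.2)).1 this).le
      · exact (L ω).mono hst
    right_continuous' := by
      intro t
      by_cases h : 0 ≤ t ∧ F ω ≤ ENNReal.ofReal t
      · refine (continuousWithinAt_const (b := max (L ω (F ω).toReal)
          (M.surplus x lam ω (F ω).toReal))).congr (fun u hu => ?_) (if_pos h)
        exact if_pos ⟨h.1.trans hu, h.2.trans (ENNReal.ofReal_le_ofReal hu)⟩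
      · refine ((L ω).right_continuous t).congr_of_eventuallyEq ?_ (if_neg h)
        have h' : ∀ᶠ u in 𝓝 t, ¬ (0 ≤ u ∧ F ω ≤ ENNReal.ofReal u) := by
          rcases lt_or_ge t 0 with h0 | h0
          · filter_upwards [Iio_mem_nhds h0] with u hu hc
            exact absurd hc.1 (not_le.2 hu)
          · have hlt : ENNReal.ofReal t < F ω := by
              by_contra! hc
              exact h ⟨h0, hc⟩
            filter_upwards [(ENNReal.continuous_ofReal.tendsto t).eventually_lt_const hlt]
              with u hu hc
            exact absurd hc.2 (not_le.2 hu)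
        filter_upwards [mem_nhdsWithin_of_mem_nhds h'] with u hu
        exact if_neg hu }

theorem closing_of_lt (h : ENNReal.ofReal t < F ω) : M.closing x lam L F ω t = L ω t :=
  if_neg fun hc => absurd hc.2 (not_le.2 h)

theorem closing_of_neg (h : t < 0) : M.closing x lam L F ω t = L ω t :=
  if_neg fun hc => absurd hc.1 (not_le.2 h)

theorem closing_of_le (ht : 0 ≤ t) (h : F ω ≤ ENNReal.ofReal t) : M.closing x lam L F ω t
    = max (L ω (F ω).toReal) (M.surplus x lam ω (F ω).toReal) :=
  if_pos ⟨ht, h⟩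

theorem leftLim_closing (h : ENNReal.ofReal t ≤ F ω) :
    Function.leftLim (M.closing x lam L F ω) t = Function.leftLim (L ω) t := by
  refine leftLim_eq_of_tendsto ?_
  refine ((L ω).mono.tendsto_leftLim t).congr' ?_
  filter_upwards [self_mem_nhdsWithin] with u hu
  rcases lt_or_ge u 0 with h0 | h0
  · exact (closing_of_neg h0).symm
  · refine (closing_of_lt (lt_of_lt_of_le ?_ h)).symm
    exact (ENNReal.ofReal_lt_ofReal_iff_of_nonneg h0).2 hu

theorem leftLim_closing_of_lt (h : F ω < ENNReal.ofReal t) :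
    Function.leftLim (M.closing x lam L F ω) t
      = max (L ω (F ω).toReal) (M.surplus x lam ω (F ω).toReal) := by
  refine leftLim_eq_of_tendsto ?_
  refine tendsto_const_nhds.congr' ?_
  have hlt := (ENNReal.lt_ofReal_iff_toReal_lt (ne_top_of_lt h)).1 h
  filter_upwards [Ioo_mem_nhdsLT hlt] with u hu
  refine (closing_of_le (ENNReal.toReal_nonneg.trans hu.1.le) ?_).symm
  exact ((ENNReal.lt_ofReal_iff_toReal_lt (ne_top_of_lt h)).2 hu.1).le

/-- After `F` the payments are constant, so exceeding the surplus at a later time means being ruined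
already. The delicate time is `F` itself, where `L` might overshoot. -/
theorem isAdmissible_closing (hlam : M.lamBase ≤ lam) (h : M.IsExtAdmissible x lam L F) :
    M.IsAdmissible x lam (M.closing x lam L F) := by
  classical
  obtain ⟨⟨h1, h2, h3⟩, h4⟩ := h
  refine ⟨fun ω t ht => (closing_of_neg ht).trans (h1 ω t ht), fun t ht => ?_, ?_⟩
  · have hS : Measurable[M.info lam t] fun ω => (min (F ω) (ENNReal.ofReal t)).toReal := by
      refine measurable_of_Iic fun u => ?_
      rcases lt_or_ge u 0 with hu | hu
      · convert @MeasurableSet.empty _ (M.info lam t) using 1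
        ext ω
        simpa using hu.trans_le ENNReal.toReal_nonneg
      · have heq : (fun ω => (min (F ω) (ENNReal.ofReal t)).toReal) ⁻¹' Iic u
            = {ω | min (F ω) (ENNReal.ofReal t) ≤ ENNReal.ofReal u} := by
          ext ω
          exact (ENNReal.le_ofReal_iff_toReal_le
            (ne_top_of_le_ne_top ENNReal.ofReal_ne_top (min_le_right _ _)) hu).symm
        rw [heq]
        rcases le_or_gt t u with htu | htu
        · convert @MeasurableSet.univ _ (M.info lam t)
          ext ω
          simp [ENNReal.ofReal_le_ofReal htu]
        · convert info_mono htu.le _ (h4 u hu) using 1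
          ext ω
          simp [(ENNReal.ofReal_lt_ofReal_iff_of_nonneg hu).2 htu]
    -- The surplus is right-continuous on good samples only, so it is set to `0` elsewhere before
    -- being evaluated at the random time.
    have hX : Measurable[M.info lam t] fun ω =>
        max (L ω (min (F ω) (ENNReal.ofReal t)).toReal)
          ((fun u => if Good ω then M.surplus x lam ω u else 0)
            (min (F ω) (ENNReal.ofReal t)).toReal) := by
      have hSt : ∀ ω, (min (F ω) (ENNReal.ofReal t)).toReal ≤ t := fun ω =>
        ENNReal.toReal_le_of_le_ofReal ht (min_le_right _ _)
      refine Measurable.max ?_ ?_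
      · exact measurable_apply_of_rightContinuous (Z := fun ω u => L ω u)
          (fun u hu hut => (h2 u hu).mono (info_mono hut) le_rfl)
          (fun ω u _ => (L ω).right_continuous u) hS (fun ω => ENNReal.toReal_nonneg) hSt
      · refine measurable_apply_of_rightContinuous
          (Z := fun ω u => if Good ω then M.surplus x lam ω u else 0)
          (fun u hu hut => ?_) (fun ω u _ => ?_) hS (fun ω => ENNReal.toReal_nonneg) hSt
        · refine info_measurable_congr
            ((info_surplus hlam x u).mono (info_mono hut) le_rfl) ?_
          filter_upwards [ae_good (M := M)] with ω hω
          rw [if_pos hω]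
        · by_cases hω : Good ω
          · simp only [if_pos hω]
            exact (hω.regular hlam).surplus_rightContinuous x u
          · simp only [if_neg hω]
            exact continuousWithinAt_const
    have key := @Measurable.ite _ _ _ _ (M.info lam t) _ _ (fun _ => Classical.dec _) (h4 t ht) hX (h2 t ht)
    refine info_measurable_congr key ?_
    filter_upwards [ae_good (M := M)] with ω hω
    by_cases hF : F ω ≤ ENNReal.ofReal t
    · rw [if_pos hF, closing_of_le ht hF, min_eq_left hF]
      simp only [if_pos hω]
    · rw [if_neg hF, closing_of_lt (not_le.1 hF)]
  · filter_upwards [h3, ae_good (M := M)] with ω hadm hω t ht hlt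
    have hR := hω.regular hlam
    have hmem : ∀ u, 0 ≤ u → M.surplus x lam ω u
        < Function.leftLim (M.closing x lam L F ω) u → ¬ ENNReal.ofReal u ≤ ENNReal.ofReal t := by
      intro u hu hlt' hle
      have hle' : M.ruinTime x lam (M.closing x lam L F) ω ≤ ENNReal.ofReal u :=
        sInf_le ⟨u, hu, by linarith, rfl⟩
      exact absurd (hle'.trans hle) (not_le.2 hlt)
    rcases lt_or_ge (ENNReal.ofReal t) (F ω) with hF | hF
    · rw [closing_of_lt hF]
      refine hadm t ht ?_
      by_contra! hτ
      obtain ⟨s, ⟨r, hr0, hr1, rfl⟩, hr2⟩ := sInf_lt_iff.1 (hτ.trans_lt (lt_min hlt hF))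
      have hle' : M.ruinTime x lam (M.closing x lam L F) ω ≤ ENNReal.ofReal r := by
        refine sInf_le ⟨r, hr0, ?_, rfl⟩
        rw [leftLim_closing (hr2.le.trans (min_le_right _ _))]
        exact hr1
      exact absurd hle' (not_le.2 (hr2.trans_le (min_le_left _ _)))
    · rw [closing_of_le ht hF]
      rcases hF.lt_or_eq with hF' | hF'
      · by_contra! hc
        exact hmem t ht (by rwa [leftLim_closing_of_lt hF']) le_rfl
      · rw [hF', ENNReal.toReal_ofReal ht]
        refine max_le ?_ le_rfl
        by_contra! hc
        have hp := M.p_pos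
        -- If `L` overshoots the surplus at `t = F`, premiums cannot repair this within a short
        -- time, so ruin occurs arbitrarily soon after `t`, and the ruin time is at most `t`.
        have hev : ∀ᶠ u in 𝓝[>] t, M.ruinTime x lam (M.closing x lam L F) ω
            ≤ ENNReal.ofReal u := by
          have hε : t < t + (L ω t - M.surplus x lam ω t) / M.p := by
            have : 0 < (L ω t - M.surplus x lam ω t) / M.p := div_pos (by linarith) hp
            linarith
          filter_upwards [Ioo_mem_nhdsGT hε] with u hu
          have hu0 : 0 ≤ u := ht.trans hu.1.le
          refine sInf_le ⟨u, hu0, ?_, rfl⟩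
          have hlt' : F ω < ENNReal.ofReal u := by
            rw [hF']; exact (ENNReal.ofReal_lt_ofReal_iff_of_nonneg ht).2 hu.1
          rw [leftLim_closing_of_lt hlt', hF', ENNReal.toReal_ofReal ht, max_eq_left hc.le]
          have h5 := hR.surplus_le_add x hu.1.le
          have h6 := hu.2
          rw [← sub_lt_iff_lt_add', lt_div_iff₀ hp] at h6
          linarith
        have hten : Tendsto (fun u => ENNReal.ofReal u) (𝓝[>] t) (𝓝 (ENNReal.ofReal t)) :=
          (ENNReal.continuous_ofReal.tendsto t).mono_left nhdsWithin_le_nhds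
        exact absurd (ge_of_tendsto hten hev) (not_le.2 hlt)

/-- If `L` is ruined no later than `F`, both strategies agree before that ruin and the new one is
ruined no earlier. If `F` comes first, the new strategy survives beyond `F` and collects `L_F` plus
the rest; the discounted closing payment is that rest times the probability of a killing time at
least `F`. -/
theorem extJ_le_J_closing (hlam : M.lamBase ≤ lam) (h : M.IsExtAdmissible x lam L F) :
    M.extJ x lam L F ≤ M.J x lam (M.closing x lam L F) := by
  obtain ⟨⟨h1, -, h3⟩, -⟩ := h
  have h1' : ∀ ω, ∀ t < 0, M.closing x lam L F ω t = 0 := fun ω t ht =>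
    (closing_of_neg ht).trans (h1 ω t ht)
  rw [J_eq h1']
  refine lintegral_mono_ae ?_
  filter_upwards [h3, ae_good (M := M)] with ω hadm hω
  have hR := hω.regular hlam
  set τ := M.ruinTime x lam L ω with hτ
  set τ' := M.ruinTime x lam (M.closing x lam L F) ω with hτ'
  have hτ_of : ∀ r, 0 ≤ r → M.surplus x lam ω r - Function.leftLim (M.closing x lam L F ω) r < 0 →
      ENNReal.ofReal r ≤ F ω → τ ≤ ENNReal.ofReal r := fun r hr0 hr1 hrF => by
    rw [leftLim_closing hrF] at hr1
    exact sInf_le ⟨r, hr0, hr1, rfl⟩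
  rcases le_or_gt τ (F ω) with hF | hF
  · have hS : {t : ℝ | 0 ≤ t ∧ ENNReal.ofReal t < τ ∧ ENNReal.ofReal t ≤ F ω}
        = {t : ℝ | 0 ≤ t ∧ ENNReal.ofReal t < τ} := by
      ext t
      exact ⟨fun h => ⟨h.1, h.2.1⟩, fun h => ⟨h.1, h.2, h.2.le.trans hF⟩⟩
    rw [hS, indicator_of_notMem (by simpa using hF), add_zero, lintegral_discount_lt _ (h1 ω)]
    refine lintegral_mono_ae ?_
    filter_upwards [ae_killing_pos (M := M)] with t ht
    have hle : τ ≤ τ' := by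
      refine le_sInf ?_
      rintro s ⟨r, hr0, hr1, rfl⟩
      rcases le_or_gt (ENNReal.ofReal r) (F ω) with hrF | hrF
      · exact hτ_of r hr0 hr1 hrF
      · exact hF.trans hrF.le
    refine ENNReal.ofReal_le_ofReal (stoppedPath_le (L ω).mono (h1 ω) ?_ ht.le fun u hu hut hlt => ?_)
    · rcases lt_or_ge 0 τ' with h0 | h0
      · exact (Dividends.nonneg (h1' ω) 0).trans
          (le_stoppedPath (StieltjesFunction.mono _) le_rfl ht.le (by simpa using h0))
      · have h0' : τ' = 0 := le_antisymm h0 bot_le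
        simp [stoppedPath, h0', leftLim_eq_zero (h1' ω)]
    · rw [← closing_of_lt (M := M) (x := x) (lam := lam) (hlt.trans_le hF)]
      exact le_stoppedPath (StieltjesFunction.mono _) hu hut (hlt.trans_le hle)
  · have hFtop : F ω ≠ ⊤ := ne_top_of_lt hF
    set f := (F ω).toReal with hf
    have hf0 : 0 ≤ f := ENNReal.toReal_nonneg
    have hfF : F ω = ENNReal.ofReal f := (ENNReal.ofReal_toReal hFtop).symm
    have hLX : L ω f ≤ M.surplus x lam ω f := hadm f hf0 (by rwa [← hfF])
    -- After paying out everything at `F`, the strategy is safe until the next event, since the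
    -- surplus only grows.
    have hFτ' : F ω < τ' := by
      have hnext := hR.lt_nextEvent f
      refine lt_of_lt_of_le (b := ENNReal.ofReal (M.nextEvent lam ω f)) ?_ (le_sInf ?_)
      · rw [hfF]; exact (ENNReal.ofReal_lt_ofReal_iff_of_nonneg hf0).2 hnext
      · rintro s ⟨r, hr0, hr1, rfl⟩
        refine ENNReal.ofReal_le_ofReal ?_
        by_contra! hr
        rcases le_or_gt (ENNReal.ofReal r) (F ω) with hrF | hrF
        · exact absurd (hτ_of r hr0 hr1 hrF) (not_le.2 (hrF.trans_lt hF))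
        · rw [leftLim_closing_of_lt hrF, ← hf, max_eq_right hLX] at hr1
          have hfr : f ≤ r := by
            rw [hfF] at hrF
            exact (ENNReal.ofReal_lt_ofReal_iff_of_nonneg hf0).1 hrF |>.le
          have := Model.Regular.surplus_le_of_claimCount_eq x hfr
            (hR.claimCount_eq hfr (hR.eventCount_of_lt_nextEvent hfr hr))
          linarith
    have hS : {t : ℝ | 0 ≤ t ∧ ENNReal.ofReal t < τ ∧ ENNReal.ofReal t ≤ F ω} = Icc 0 f := by
      ext t
      constructor
      · rintro ⟨h, -, h'⟩
        rw [hfF, ENNReal.ofReal_le_ofReal_iff hf0] at h'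
        exact ⟨h, h'⟩
      · rintro ⟨h, h'⟩
        have : ENNReal.ofReal t ≤ F ω := by rw [hfF]; exact ENNReal.ofReal_le_ofReal h'
        exact ⟨h, this.trans_lt hF, this⟩
    rw [hS, indicator_of_mem (by simpa using hF), lintegral_discount_le _ (h1 ω),
      ← lintegral_Ici_killing_const hf0, ← lintegral_add_right _
        (measurable_const.indicator measurableSet_Ici)]
    refine lintegral_mono_ae ?_
    filter_upwards [ae_killing_pos (M := M)] with t ht
    rcases lt_or_ge t f with htf | htf
    · rw [indicator_of_notMem (by simpa using htf), add_zero, min_eq_right htf.le]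
      refine ENNReal.ofReal_le_ofReal ?_
      have htF : ENNReal.ofReal t < F ω := by
        rw [hfF]; exact (ENNReal.ofReal_lt_ofReal_iff_of_nonneg ht.le).2 htf
      rw [← closing_of_lt (M := M) (x := x) (lam := lam) htF]
      exact le_stoppedPath (StieltjesFunction.mono _) ht.le le_rfl (htF.trans hFτ')
    · rw [indicator_of_mem (by simpa using htf), min_eq_left htf,
        ← ENNReal.ofReal_add (Dividends.nonneg (h1 ω) f) (by linarith)]
      refine ENNReal.ofReal_le_ofReal ?_
      have := le_stoppedPath (f := M.closing x lam L F ω) (τ := τ') (t := t)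
        (StieltjesFunction.mono _) hf0 htf (by rwa [← hfF])
      rw [closing_of_le hf0 hfF.le, ← hf, max_eq_right hLX] at this
      linarith

end closing

theorem gridV_le_V (hlam : M.lamBase ≤ lam) : M.gridV δ x lam ≤ M.V x lam := by
  refine iSup_le fun L => iSup_le fun F => iSup_le fun h => ?_
  exact (extJ_le_J_closing hlam h.1).trans
    (le_iSup₂_of_le _ (isAdmissible_closing hlam h.1) le_rfl)

end

/-! ### Bounds for `V` and `V^δ`, and large initial intensities -/

section

variable {M : Model} {x lam δ t : ℝ} {ω : Sample}

theorem exists_measure_gt_le {Ω : Type*} [MeasurableSpace Ω] (P : Measure Ω) [IsFiniteMeasure P]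
    {f : Ω → ℝ} (hf : AEMeasurable f P) {ε : ℝ≥0∞} (hε : 0 < ε) :
    ∃ K, P {ω | K < f ω} ≤ ε := by
  have h : Tendsto (fun n : ℕ => P {ω | (n : ℝ) < f ω}) atTop
      (𝓝 (P (⋂ n : ℕ, {ω | (n : ℝ) < f ω}))) := by
    refine tendsto_measure_iInter_atTop (fun n => nullMeasurableSet_lt aemeasurable_const hf)
      (fun m n hmn ω (hω : (n : ℝ) < f ω) => lt_of_le_of_lt (by exact_mod_cast hmn) hω)
      ⟨0, measure_ne_top _ _⟩
  have h0 : (⋂ n : ℕ, {ω | (n : ℝ) < f ω}) = ∅ := by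
    ext ω
    obtain ⟨n, hn⟩ := exists_nat_ge (f ω)
    simp only [mem_iInter, mem_ofPred_eq, mem_empty_iff_false, iff_false, not_forall, not_lt]
    exact ⟨n, hn⟩
  rw [h0, measure_empty] at h
  obtain ⟨n, hn⟩ := (h.eventually_le_const hε).exists
  exact ⟨n, hn⟩

theorem exists_measure_sum_claim_lt_le (c : ℝ) {ε : ℝ≥0∞} (hε : 0 < ε) :
    ∃ n : ℕ, M.P {ω | Good ω ∧ ∑ j ∈ Finset.range n, claimSize ω j < c} ≤ ε := by
  have hg := measurableSet_good
  have h : Tendsto (fun n : ℕ => M.P {ω | Good ω ∧ ∑ j ∈ Finset.range n, claimSize ω j < c}) atTop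
      (𝓝 (M.P (⋂ n : ℕ, {ω | Good ω ∧ ∑ j ∈ Finset.range n, claimSize ω j < c}))) := by
    refine tendsto_measure_iInter_atTop (fun n => ?_) (fun m n hmn ω hω => ⟨hω.1, ?_⟩)
      ⟨0, measure_ne_top _ _⟩
    · exact (hg.inter (measurableSet_lt (Finset.measurable_fun_sum _ fun j _ =>
        measurable_claimSize j) measurable_const)).nullMeasurableSet
    · exact ((hω.1.regular (M := M) le_rfl).sum_claims_mono hmn).trans_lt hω.2
  have h0 : (⋂ n : ℕ, {ω | Good ω ∧ ∑ j ∈ Finset.range n, claimSize ω j < c}) = ∅ := by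
    ext ω
    simp only [mem_iInter, mem_ofPred_eq, mem_empty_iff_false, iff_false, not_forall, not_and,
      not_lt]
    by_cases hω : Good ω
    · obtain ⟨n, hn⟩ := (hω.sum_claim.eventually_ge_atTop c).exists
      exact ⟨n, fun _ => hn⟩
    · exact ⟨0, fun h => absurd h hω⟩
  rw [h0, measure_empty] at h
  exact (h.eventually_le_const hε).exists

theorem lintegral_killing_affine {a : ℝ} (ha : 0 ≤ a) :
    ∫⁻ t, ENNReal.ofReal (a + M.p * t) ∂M.killing = ENNReal.ofReal (a + M.p / M.q) := by
  have hp := M.p_pos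
  have hq := M.q_pos
  have h : ∫⁻ t, ENNReal.ofReal (a + M.p * t) ∂M.killing
      = ∫⁻ t, (ENNReal.ofReal a + ENNReal.ofReal M.p * ENNReal.ofReal t) ∂M.killing := by
    refine lintegral_congr_ae ?_
    filter_upwards [ae_killing_pos (M := M)] with t ht
    rw [ENNReal.ofReal_add ha (by positivity), ENNReal.ofReal_mul hp.le]
  rw [h, lintegral_add_left measurable_const, lintegral_const, measure_univ, mul_one,
    lintegral_const_mul _ ENNReal.measurable_ofReal]
  unfold Model.killing
  rw [lintegral_id_expMeasure hq, ← ENNReal.ofReal_mul hp.le, ← ENNReal.ofReal_add ha (by positivity),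
    mul_one_div]

section bound

variable {L : Dividends}

theorem Model.Regular.stoppedPath_le_of_admissible (hR : M.Regular lam ω) (hx : 0 ≤ x)
    (hL0 : ∀ t < 0, L ω t = 0)
    (hL : ∀ t, 0 ≤ t → ENNReal.ofReal t < M.ruinTime x lam L ω → L ω t ≤ M.surplus x lam ω t)
    (ht : 0 ≤ t) : stoppedPath (L ω) (M.ruinTime x lam L ω) t ≤ x + M.p * t := by
  have hp := M.p_pos
  refine stoppedPath_le (L ω).mono hL0 (by positivity) ht fun u hu hut hlt => ?_
  have h1 := hL u hu hlt
  have h2 := hR.surplus_le x u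
  nlinarith

theorem J_le (hx : 0 ≤ x) (hlam : M.lamBase ≤ lam) (hL : M.IsAdmissible x lam L) :
    M.J x lam L ≤ ENNReal.ofReal (x + M.p / M.q) := by
  rw [J_eq hL.1]
  calc _ ≤ ∫⁻ _, ENNReal.ofReal (x + M.p / M.q) ∂M.P := by
        refine lintegral_mono_ae ?_
        filter_upwards [hL.2.2, ae_good (M := M)] with ω hadm hω
        rw [← lintegral_killing_affine hx]
        refine lintegral_mono_ae ?_
        filter_upwards [ae_killing_pos (M := M)] with t ht
        exact ENNReal.ofReal_le_ofReal
          ((hω.regular hlam).stoppedPath_le_of_admissible hx (hL.1 ω) hadm ht.le)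
    _ = _ := by simp

theorem V_le (hx : 0 ≤ x) (hlam : M.lamBase ≤ lam) :
    M.V x lam ≤ ENNReal.ofReal (x + M.p / M.q) :=
  iSup₂_le fun _ hL => J_le hx hlam hL

theorem V_ne_top (hx : 0 ≤ x) (hlam : M.lamBase ≤ lam) : M.V x lam ≠ ⊤ :=
  ne_top_of_le_ne_top ENNReal.ofReal_ne_top (V_le hx hlam)

/-- If the claims up to time `h` are large, then almost nothing can be paid beyond the initial
surplus. -/
theorem Model.Regular.lintegral_stoppedPath_le (hR : M.Regular lam ω) (hx : 0 ≤ x)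
    (hL0 : ∀ t < 0, L ω t = 0)
    (hL : ∀ t, 0 ≤ t → ENNReal.ofReal t < M.ruinTime x lam L ω → L ω t ≤ M.surplus x lam ω t)
    {h c : ℝ} (hh : 0 ≤ h) (hc : Real.exp (-M.q * h) * c = M.p / M.q) (hc0 : 0 ≤ c)
    (hS : c ≤ ∑ j ∈ Finset.range (M.claimCount lam ω h), claimSize ω j) :
    ∫⁻ t, ENNReal.ofReal (stoppedPath (L ω) (M.ruinTime x lam L ω) t) ∂M.killing
      ≤ ENNReal.ofReal (x + M.p * h) := by
  have hp := M.p_pos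
  rcases le_or_gt (M.ruinTime x lam L ω) (ENNReal.ofReal h) with hτ | hτ
  · calc _ ≤ ∫⁻ _, ENNReal.ofReal (x + M.p * h) ∂M.killing := by
          refine lintegral_mono_ae ?_
          filter_upwards [ae_killing_pos (M := M)] with t ht
          refine ENNReal.ofReal_le_ofReal (stoppedPath_le (L ω).mono hL0 (by positivity) ht.le
            fun u hu hut hlt => ?_)
          have h1 := hL u hu hlt
          have h2 := hR.surplus_le x u
          have h3 := (ENNReal.ofReal_lt_ofReal_iff_of_nonneg hu).1 (hlt.trans_le hτ)
          nlinarith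
      _ = _ := by simp
  · have hX : ∀ u, h ≤ u → M.surplus x lam ω u + c ≤ x + M.p * u := fun u hu => by
      have := hR.sum_claims_mono (hR.claimCount_mono hu)
      unfold Model.surplus
      linarith
    have h0 := Dividends.nonneg hL0
    have hLh := hL h hh hτ
    have hxc : 0 ≤ x + M.p * h - c := by linarith [hX h le_rfl, h0 h]
    -- When ruin comes after `h`, claims of total at least `c` lower the affine bound by `c` from
    -- time `h` on. The discounted value of this reduction is `e^{-qh} c = p / q`, which cancels the
    -- value of all premiums.
    have key : ∫⁻ t, ENNReal.ofReal (stoppedPath (L ω) (M.ruinTime x lam L ω) t) ∂M.killing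
        + ENNReal.ofReal (M.p / M.q) ≤ ENNReal.ofReal x + ENNReal.ofReal (M.p / M.q) := by
      have hq := M.q_pos
      rw [← ENNReal.ofReal_add hx (by positivity), ← lintegral_killing_affine hx, ← hc,
        ← lintegral_Ici_killing_const hh, ← lintegral_add_right _
          (measurable_const.indicator measurableSet_Ici)]
      refine lintegral_mono_ae ?_
      filter_upwards [ae_killing_pos (M := M)] with t ht
      rcases lt_or_ge t h with hth | hth
      · rw [indicator_of_notMem (by simpa using hth), add_zero]
        exact ENNReal.ofReal_le_ofReal (hR.stoppedPath_le_of_admissible hx hL0 hL ht.le)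
      · rw [indicator_of_mem (by simpa using hth)]
        have hle : stoppedPath (L ω) (M.ruinTime x lam L ω) t ≤ x + M.p * t - c := by
          refine stoppedPath_le (L ω).mono hL0 (by nlinarith) ht.le fun u hu hut hlt => ?_
          rcases le_total h u with hu' | hu'
          · have h1 := hX u hu'
            have h2 := hL u hu hlt
            nlinarith
          · have h1 := hX h le_rfl
            have h2 := (L ω).mono hu'
            nlinarith
        have h1 : 0 ≤ stoppedPath (L ω) (M.ruinTime x lam L ω) t :=
          (h0 h).trans (le_stoppedPath (L ω).mono hh hth hτ)
        rw [← ENNReal.ofReal_add h1 hc0]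
        exact ENNReal.ofReal_le_ofReal (by linarith)
    refine (ENNReal.le_of_add_le_add_right ENNReal.ofReal_ne_top key).trans
      (ENNReal.ofReal_le_ofReal ?_)
    nlinarith

end bound

/-- For a large initial intensity the value hardly exceeds the initial surplus. -/
theorem exists_forall_V_le (M : Model) {ε : ℝ} (hε : 0 < ε) :
    ∃ lam₀, M.lamBase ≤ lam₀ ∧ ∀ x lam, 0 ≤ x → lam₀ ≤ lam →
      M.V x lam ≤ ENNReal.ofReal x + ENNReal.ofReal ε := by
  have hp := M.p_pos
  have hq := M.q_pos
  -- The premiums up to `h` amount to `ε / 2`; `c` is chosen so that its value discounted from `h`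
  -- is `p / q`. The other `ε / 2` pays for two exceptional events of probability at most `η`: small
  -- claims, and a slow Poisson clock.
  set h := ε / (2 * M.p) with hh
  have hh0 : 0 < h := by positivity
  set c := Real.exp (M.q * h) * (M.p / M.q) with hc
  have hc0 : 0 < c := by positivity
  have hcexp : Real.exp (-M.q * h) * c = M.p / M.q := by
    rw [hc, ← mul_assoc, ← Real.exp_add]
    simp
  set η := ENNReal.ofReal (ε / 4 / (M.p / M.q)) with hη
  have hη0 : 0 < η := ENNReal.ofReal_pos.2 (by positivity)
  obtain ⟨n, hn⟩ := exists_measure_sum_claim_lt_le (M := M) c hη0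
  obtain ⟨K, hK⟩ := exists_measure_gt_le M.P (measurable_clockTime n).aemeasurable hη0
  have hr := ramp_pos (M := M) hh0
  -- From this intensity on, the integrated intensity at `h` is at least `K`, so outside the
  -- exceptional event the `n`-th claim has arrived by `h`.
  refine ⟨M.lamBase + max K 0 / M.ramp h, by
    have : 0 ≤ max K 0 / M.ramp h := by positivity
    linarith, fun x lam hx hlam => ?_⟩
  have hlam' : M.lamBase ≤ lam := by
    have : 0 ≤ max K 0 / M.ramp h := by positivity
    linarith
  have hKle : K ≤ (lam - M.lamBase) * M.ramp h := by
    refine (le_max_left K 0).trans ?_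
    rw [← div_le_iff₀ hr]
    linarith
  refine iSup₂_le fun L hL => ?_
  set A := {ω | Good ω ∧ ∑ j ∈ Finset.range n, claimSize ω j < c} ∪ {ω | K < clockTime ω n} with hA
  have hAm : MeasurableSet A := by
    refine MeasurableSet.union (measurableSet_good.inter (measurableSet_lt
      (Finset.measurable_fun_sum _ fun j _ => measurable_claimSize j) measurable_const)) ?_
    exact measurableSet_lt measurable_const (measurable_clockTime n)
  have hPA : M.P A ≤ ENNReal.ofReal (ε / 2 / (M.p / M.q)) := by
    refine (measure_union_le _ _).trans ((add_le_add hn hK).trans ?_)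
    rw [← ENNReal.ofReal_add (by positivity) (by positivity)]
    refine ENNReal.ofReal_le_ofReal (le_of_eq ?_)
    field_simp
    norm_num
  rw [J_eq hL.1]
  calc _ ≤ ∫⁻ ω, (ENNReal.ofReal (x + M.p * h) +
        A.indicator (fun _ => ENNReal.ofReal (M.p / M.q)) ω) ∂M.P := by
        refine lintegral_mono_ae ?_
        filter_upwards [hL.2.2, ae_good (M := M)] with ω hadm hω
        have hR := hω.regular hlam'
        by_cases hωA : ω ∈ A
        · rw [indicator_of_mem hωA, ← ENNReal.ofReal_add (by positivity) (by positivity)]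
          calc _ ≤ ∫⁻ t, ENNReal.ofReal (x + M.p * t) ∂M.killing := by
                refine lintegral_mono_ae ?_
                filter_upwards [ae_killing_pos (M := M)] with t ht
                exact ENNReal.ofReal_le_ofReal
                  (hR.stoppedPath_le_of_admissible hx (hL.1 ω) hadm ht.le)
            _ ≤ _ := by
                rw [lintegral_killing_affine hx]
                refine ENNReal.ofReal_le_ofReal ?_
                have : 0 ≤ M.p * h := by positivity
                linarith
        · rw [indicator_of_notMem hωA, add_zero]
          simp only [hA, mem_union, mem_ofPred_eq, not_or, not_and, not_lt] at hωA
          refine hR.lintegral_stoppedPath_le hx (hL.1 ω) hadm hh0.le hcexp hc0.le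
            ((hωA.1 hω).trans (hR.sum_claims_mono ?_))
          refine le_of_lt ((hR.lt_claimCount h n).2 ((hω.claimTime_le_iff hlam' n hh0.le).2 ?_))
          exact hωA.2.trans (hKle.trans (hω.ramp_le_cumIntensity hlam' hh0.le))
    _ = ENNReal.ofReal (x + M.p * h) + ENNReal.ofReal (M.p / M.q) * M.P A := by
        rw [lintegral_add_left measurable_const, lintegral_const, measure_univ, mul_one,
          lintegral_indicator_const hAm]
    _ ≤ ENNReal.ofReal (x + M.p * h) + ENNReal.ofReal (M.p / M.q) *
          ENNReal.ofReal (ε / 2 / (M.p / M.q)) := by gcongr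
    _ = ENNReal.ofReal x + ENNReal.ofReal ε := by
        rw [← ENNReal.ofReal_mul (by positivity), ← ENNReal.ofReal_add (by positivity)
          (by positivity), ← ENNReal.ofReal_add hx hε.le]
        congr 1
        rw [hh]
        field_simp
        ring

theorem extJ_top (L : Dividends) : M.extJ x lam L (fun _ => ⊤) = M.J x lam L := by
  unfold Model.extJ Model.J
  refine lintegral_congr fun ω => ?_
  simp

section grid

variable {G : Sample → ℝ → ℝ} {hx : 0 ≤ x} {hδ : 0 < δ} {hG : ∀ ω, MonotoneOn (G ω) (Ici 0)}
  {hG0 : ∀ ω t, 0 ≤ t → 0 ≤ G ω t}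

theorem J_gridDividends_le_gridV (hlam : M.lamBase ≤ lam)
    (hGa : ∀ t, 0 ≤ t → Measurable[M.info lam t] fun ω => G ω t)
    (hGc : ∀ ω t, 0 ≤ t → ContinuousWithinAt (G ω) (Ici t) t) :
    M.J x lam (M.gridDividends x lam δ hx hδ G hG hG0) ≤ M.gridV δ x lam := by
  rw [← extJ_top]
  exact le_iSup_of_le _ (le_iSup_of_le _ (le_iSup_of_le
    (isGridStrategy_gridDividends hlam hGa hGc) le_rfl))

theorem Model.Regular.le_stoppedPath_gridDividends (hR : M.Regular lam ω) {u t : ℝ} (hu : 0 ≤ u)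
    (hut : u ≤ t) (h : ENNReal.ofReal u < M.ruinTime x lam
      (M.gridDividends x lam δ hx hδ G hG hG0) ω) :
    min (M.gridTarget lam δ (G ω) ω u) (M.surplus x lam ω (M.epoch lam δ ω u)) ≤
      stoppedPath (M.gridDividends x lam δ hx hδ G hG hG0 ω)
        (M.ruinTime x lam (M.gridDividends x lam δ hx hδ G hG hG0) ω) t := by
  refine (Model.Regular.min_le_tracking hδ u).trans ?_
  have hno : ¬ M.Overdrawn x lam δ (G ω) ω u := fun hc =>
    absurd ((overdrawn_iff_ruinTime_le hR hu).1 hc) (not_le.2 h)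
  rw [← hR.gridPath_eq hδ (hG ω) hu hno,
    ← gridDividends_apply (hx := hx) (hδ := hδ) (hG := hG) (hG0 := hG0) hR hu]
  exact le_stoppedPath (StieltjesFunction.mono _) hu hut h

theorem Model.Regular.ruinTime_gridDividends_pos (hR : M.Regular lam ω) :
    0 < M.ruinTime x lam (M.gridDividends x lam δ hx hδ G hG hG0) ω := by
  by_contra! hc
  exact Model.Regular.not_overdrawn_zero
    ((overdrawn_iff_ruinTime_le hR le_rfl).2 (by simpa using hc))

end grid

/-- Tracking a target that is never below the surplus pays out everything at time `0`. -/
theorem le_gridV (hx : 0 ≤ x) (hδ : 0 < δ) (hlam : M.lamBase ≤ lam) :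
    ENNReal.ofReal x ≤ M.gridV δ x lam := by
  have hp := M.p_pos
  have hG : ∀ _ : Sample, MonotoneOn (fun t => x + M.p * t) (Ici 0) := fun ω s _ t _ hst => by
    dsimp only; gcongr
  have hG0 : ∀ (_ : Sample) (t : ℝ), 0 ≤ t → 0 ≤ (fun t => x + M.p * t) t := fun ω t ht => by
    positivity
  refine le_trans ?_ (J_gridDividends_le_gridV (hx := hx) (hδ := hδ) (hG := hG) (hG0 := hG0) hlam
    (fun t _ => measurable_const) (fun ω t _ => by fun_prop))
  rw [J_eq fun ω t ht => gridDividends_of_neg ht]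
  calc _ = ∫⁻ _, ∫⁻ _, ENNReal.ofReal x ∂M.killing ∂M.P := by simp
    _ ≤ _ := by
      refine lintegral_mono_ae ?_
      filter_upwards [ae_good (M := M)] with ω hω
      have hR := hω.regular hlam
      refine lintegral_mono_ae ?_
      filter_upwards [ae_killing_pos (M := M)] with t ht
      refine ENNReal.ofReal_le_ofReal (le_trans (le_min ?_ ?_)
        (hR.le_stoppedPath_gridDividends le_rfl ht.le
          (by simpa using hR.ruinTime_gridDividends_pos)))
      · unfold Model.gridTarget
        have h1 := hR.epoch_nonneg hδ 0
        have : 0 ≤ M.p * M.epoch lam δ ω 0 + M.eventCount lam ω 0 * (M.p * δ) := by positivity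
        linarith
      · rw [hR.epoch_zero, hR.surplus_zero]

end

/-! ### Pathwise comparison of a strategy with its grid approximation -/

section

variable {M : Model} {x lam δ B b t : ℝ} {ω : Sample} {L : Dividends}

/-- The path `f`, raised to `x - B` and cut off at `x + p t`. -/
def Model.truncation (M : Model) (x B : ℝ) (f : ℝ → ℝ) (t : ℝ) : ℝ :=
  min (max (f t) (x - B)) (x + M.p * t)

theorem truncation_mono {f : ℝ → ℝ} (hf : Monotone f) : Monotone (M.truncation x B f) := by
  intro s t hst
  have := hf hst
  have hp := M.p_pos
  unfold Model.truncation
  gcongr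

theorem truncation_rightContinuous {f : ℝ → ℝ} (hf : ContinuousWithinAt f (Ici t) t) :
    ContinuousWithinAt (M.truncation x B f) (Ici t) t := by
  have h : ContinuousWithinAt (fun t => x + M.p * t) (Ici t) t := by fun_prop
  exact (hf.max continuousWithinAt_const).min h

theorem le_truncation {f : ℝ → ℝ} (hB : 0 ≤ B) (hx : 0 ≤ x) (ht : 0 ≤ t) (hf : 0 ≤ f t) :
    max (x - B) 0 ≤ M.truncation x B f t := by
  have := M.p_pos
  have : 0 ≤ M.p * t := by positivity
  exact le_min (max_le (le_max_right _ _) (hf.trans (le_max_left _ _)))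
    (max_le (by linarith) (by linarith))

/-- Together with `le_truncation`: above the level `max (x - B) 0` the truncated dividends vary
within bounds free of `x`, which is the source of the uniformity in the surplus. -/
theorem truncation_sub_le {f : ℝ → ℝ} (t : ℝ) :
    M.truncation x B f t - max (x - B) 0 ≤ B + M.p * t := by
  have h1 : M.truncation x B f t ≤ x + M.p * t := min_le_right _ _
  linarith [le_max_left (x - B) 0]

theorem truncation_sub_monotoneOn (f : StieltjesFunction ℝ) :
    MonotoneOn (fun t => max (M.truncation x B f t - b) 0) (Ici 0) := by
  intro s _ t _ hst
  have := truncation_mono (M := M) (x := x) (B := B) f.mono hst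
  dsimp only
  gcongr

/-- A grid strategy that follows the dividends `L`, reduced by `b`. -/
def Model.gridApprox (M : Model) (x lam δ B b : ℝ) (hx : 0 ≤ x) (hδ : 0 < δ) (L : Dividends) :
    Dividends :=
  M.gridDividends x lam δ hx hδ (fun ω t => max (M.truncation x B (L ω) t - b) 0)
    (fun ω => truncation_sub_monotoneOn (L ω)) (fun _ _ _ => le_max_right _ _)

theorem J_gridApprox_le_gridV (hx : 0 ≤ x) (hδ : 0 < δ) (hlam : M.lamBase ≤ lam)
    (hL : ∀ t, 0 ≤ t → Measurable[M.info lam t] fun ω => L ω t) :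
    M.J x lam (M.gridApprox x lam δ B b hx hδ L) ≤ M.gridV δ x lam := by
  refine J_gridDividends_le_gridV hlam (fun t ht => ?_) fun ω t _ => ?_
  · unfold Model.truncation
    exact ((((hL t ht).max measurable_const).min measurable_const).sub_const b).max
      measurable_const
  · exact ((truncation_rightContinuous ((L ω).right_continuous t)).sub
      continuousWithinAt_const).max continuousWithinAt_const

section comparison

variable (hx : 0 ≤ x) (hδ : 0 < δ)

/-- The time `t` precedes every claim at or after the ruin time of `L`. -/
def Model.BeforeClaim (M : Model) (x lam : ℝ) (L : Dividends) (ω : Sample) (t : ℝ) : Prop :=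
  ∀ n, M.ruinTime x lam L ω ≤ ENNReal.ofReal (M.claimTime lam ω n) → t < M.claimTime lam ω n

/-- The dividends of `L` paid before its ruin. -/
def Model.paid (M : Model) (x lam : ℝ) (L : Dividends) (ω : Sample) (t : ℝ) : ℝ :=
  stoppedPath (L ω) (M.ruinTime x lam L ω) t

/-- The properties of an admissible strategy along a sample. -/
structure Model.AdmissibleAt (M : Model) (x lam : ℝ) (L : Dividends) (ω : Sample) : Prop where
  regular : M.Regular lam ω
  zero : ∀ t < 0, L ω t = 0
  le_surplus : ∀ t, 0 ≤ t → ENNReal.ofReal t < M.ruinTime x lam L ω →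
    L ω t ≤ M.surplus x lam ω t

namespace Model.AdmissibleAt

theorem nonneg (h : M.AdmissibleAt x lam L ω) (t : ℝ) : 0 ≤ L ω t := Dividends.nonneg h.zero t

include hx in
theorem paid_le_add (h : M.AdmissibleAt x lam L ω) (ht : 0 ≤ t) :
    M.paid x lam L ω t ≤ x + M.p * t :=
  h.regular.stoppedPath_le_of_admissible hx h.zero h.le_surplus ht

theorem paid_le (h : M.AdmissibleAt x lam L ω) (ht : 0 ≤ t) : M.paid x lam L ω t ≤ L ω t :=
  stoppedPath_le (L ω).mono h.zero (h.nonneg t) ht fun _ _ hut _ => (L ω).mono hut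

include hx in
theorem paid_le_truncation (h : M.AdmissibleAt x lam L ω) (ht : 0 ≤ t) :
    M.paid x lam L ω t ≤ M.truncation x B (L ω) t :=
  le_min ((h.paid_le ht).trans (le_max_left _ _)) (h.paid_le_add hx ht)

include hx in
-- The ruin of `L` need not happen at a claim, as `L` may overpay. Until the next claim at or after
-- it the bound persists: the payments were covered at the last claim and the surplus has only grown
-- since.
theorem paid_le_surplus (h : M.AdmissibleAt x lam L ω) (ht : 0 ≤ t)
    (hb : M.BeforeClaim x lam L ω t) : M.paid x lam L ω t ≤ M.surplus x lam ω t := by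
  have hR := h.regular
  have hp := M.p_pos
  rcases lt_or_ge (ENNReal.ofReal t) (M.ruinTime x lam L ω) with hτ | hτ
  · rw [Model.paid, stoppedPath_of_lt hτ]
    exact h.le_surplus t ht hτ
  cases hm : M.claimCount lam ω t with
  | zero =>
    have hX : M.surplus x lam ω t = x + M.p * t := by simp [Model.surplus, hm]
    rw [hX]
    exact h.paid_le_add hx ht
  | succ k =>
    have hk : M.claimTime lam ω k ≤ t := (hR.lt_claimCount t k).1 (by omega)
    have hk0 : 0 ≤ M.claimTime lam ω k := (hR.claim_pos k).le
    have hkτ : ENNReal.ofReal (M.claimTime lam ω k) < M.ruinTime x lam L ω := by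
      by_contra! hc
      exact absurd (hb k hc) (not_lt.2 hk)
    have hu : ∀ u, M.claimTime lam ω k ≤ u → u ≤ t →
        M.surplus x lam ω u ≤ M.surplus x lam ω t := fun u hu hut => by
      refine Model.Regular.surplus_le_of_claimCount_eq x hut ?_
      have h1 := hR.claimCount_mono hut
      have h2 := (hR.lt_claimCount u k).2 hu
      omega
    refine stoppedPath_le (L ω).mono h.zero ?_ ht fun u hu0 hut hlt => ?_
    · exact (h.nonneg _).trans ((h.le_surplus _ hk0 hkτ).trans (hu _ le_rfl hk))
    · rcases le_total (M.claimTime lam ω k) u with hku | hku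
      · exact (h.le_surplus u hu0 hlt).trans (hu u hku hut)
      · exact ((L ω).mono hku).trans ((h.le_surplus _ hk0 hkτ).trans (hu _ le_rfl hk))

/-- Until the first claim after the ruin of `L`, the grid strategy pays almost as much as `L`. -/
theorem min_le_paid_gridApprox (h : M.AdmissibleAt x lam L ω) {u : ℝ} (hu : 0 ≤ u) (hut : u ≤ t)
    (hr : ENNReal.ofReal u < M.ruinTime x lam (M.gridApprox x lam δ B b hx hδ L) ω)
    (hb : M.BeforeClaim x lam L ω u) :
    min (M.truncation x B (L ω) (max (u - δ) 0) - b) (M.paid x lam L ω u - M.p * δ)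
      ≤ M.paid x lam (M.gridApprox x lam δ B b hx hδ L) ω t := by
  have hR := h.regular
  have hp := M.p_pos
  have hep := Model.Regular.lt_epoch_add (M := M) (lam := lam) (ω := ω) hδ u
  refine le_trans (min_le_min ?_ ?_) (hR.le_stoppedPath_gridDividends hu hut hr)
  · unfold Model.gridTarget
    have h1 : M.truncation x B (L ω) (max (u - δ) 0)
        ≤ M.truncation x B (L ω) (M.epoch lam δ ω u) :=
      truncation_mono (L ω).mono (max_le (by linarith) (hR.epoch_nonneg hδ u))
    have h2 : 0 ≤ (M.eventCount lam ω u : ℝ) * (M.p * δ) := by positivity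
    have h3 := le_max_left (M.truncation x B (L ω) (M.epoch lam δ ω u) - b) 0
    linarith
  · have h1 := h.paid_le_surplus hx hu hb
    rw [hR.surplus_epoch hδ x hu] at h1
    nlinarith

/-- While neither strategy has met its ruinous claim, the loss consists of the reduction `b`, one
grid step and the payments of the last period `δ`, because the target is read at an epoch at most
`δ` ago. -/
theorem paid_le_of_lt (h : M.AdmissibleAt x lam L ω) (hb0 : 0 ≤ b) (ht : 0 ≤ t)
    (hr : ENNReal.ofReal t < M.ruinTime x lam (M.gridApprox x lam δ B b hx hδ L) ω)
    (hb : M.BeforeClaim x lam L ω t) :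
    M.paid x lam L ω t ≤ M.paid x lam (M.gridApprox x lam δ B b hx hδ L) ω t + (b + M.p * δ)
      + (M.truncation x B (L ω) t - M.truncation x B (L ω) (max (t - δ) 0)) := by
  have h1 := h.min_le_paid_gridApprox hx hδ ht le_rfl hr hb
  have h2 := h.paid_le_truncation (B := B) hx ht
  have h3 : M.truncation x B (L ω) (max (t - δ) 0) ≤ M.truncation x B (L ω) t :=
    truncation_mono (L ω).mono (max_le (by linarith) ht)
  have hp : 0 < M.p * δ := mul_pos M.p_pos hδ
  rcases min_le_iff.1 h1 with h4 | h4 <;> linarith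

/-- If the grid strategy is ruined by a claim that `L` survives, then only the premiums after this
claim are lost. -/
theorem paid_le_of_ruin (h : M.AdmissibleAt x lam L ω) {n : ℕ}
    (hX : M.surplus x lam ω (M.claimTime lam ω n)
      ≤ M.paid x lam (M.gridApprox x lam δ B b hx hδ L) ω t)
    (hτ : ENNReal.ofReal (M.claimTime lam ω n) < M.ruinTime x lam L ω)
    (ht : M.claimTime lam ω n ≤ t) :
    M.paid x lam L ω t ≤ M.paid x lam (M.gridApprox x lam δ B b hx hδ L) ω t
      + M.p * (t - M.claimTime lam ω n) := by
  have hR := h.regular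
  have hp := M.p_pos
  have hn0 := (hR.claim_pos n).le
  have hLn := h.le_surplus _ hn0 hτ
  have h0 : 0 ≤ M.p * (t - M.claimTime lam ω n) := mul_nonneg hp.le (by linarith)
  refine stoppedPath_le (L ω).mono h.zero ?_ (hn0.trans ht) fun u hu0 hut hlt => ?_
  · linarith [h.nonneg (M.claimTime lam ω n)]
  · rcases le_total (M.claimTime lam ω n) u with hu | hu
    · have h1 := h.le_surplus u hu0 hlt
      have h2 := hR.surplus_le_add x hu
      nlinarith
    · have := (L ω).mono hu
      linarith

include hδ in
/-- A claim that ruins the grid strategy, but not `L`, leaves a surplus in `[0, b)`. -/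
theorem surplus_lt_of_ruin (h : M.AdmissibleAt x lam L ω) {n K : ℕ} (hb : b = K * (M.p * δ))
    {u : ℝ} (hu : 0 ≤ u) (hun : u < M.claimTime lam ω n)
    (hX : M.surplus x lam ω (M.claimTime lam ω n) < M.tracking x lam δ
      (fun t => max (M.truncation x B (L ω) t - b) 0) ω u)
    (hτ : ENNReal.ofReal (M.claimTime lam ω n) < M.ruinTime x lam L ω)
    (hK : M.eventCount lam ω (M.claimTime lam ω n) ≤ K)
    (hS : ∑ j ∈ Finset.range (M.claimCount lam ω (M.claimTime lam ω n)), claimSize ω j ≤ B) :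
    0 ≤ M.surplus x lam ω (M.claimTime lam ω n) ∧
      M.surplus x lam ω (M.claimTime lam ω n) < b := by
  have hR := h.regular
  have hp := M.p_pos
  have hn0 := (hR.claim_pos n).le
  have hLn := h.le_surplus _ hn0 hτ
  have hL0 := h.nonneg (M.claimTime lam ω n)
  refine ⟨hL0.trans hLn, ?_⟩
  have h1 := Model.Regular.tracking_lt (M := M) (x := x) (lam := lam) (ω := ω)
    (G := fun t => max (M.truncation x B (L ω) t - b) 0) hδ u
  -- The ruinous claim is itself an event after `u`; this leaves one grid step for the rounding in
  -- `tracking_lt`.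
  have hcount : M.eventCount lam ω u + 1 ≤ K := by
    refine le_trans ?_ hK
    unfold Model.eventCount
    have h2 : M.claimCount lam ω u ≤ n := by
      by_contra! hc
      exact absurd ((hR.lt_claimCount u n).1 hc) (not_le.2 hun)
    have h3 := (hR.lt_claimCount (M.claimTime lam ω n) n).2 le_rfl
    have h4 := hR.catCount_mono hun.le
    omega
  have hcb : (M.eventCount lam ω u : ℝ) * (M.p * δ) + M.p * δ ≤ b := by
    have : ((M.eventCount lam ω u : ℝ) + 1) ≤ K := by exact_mod_cast hcount
    rw [hb]
    have hg : 0 < M.p * δ := mul_pos hp hδ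
    nlinarith
  unfold Model.gridTarget at h1
  -- If the reduced target is `0`, the grid strategy has paid less than `b`, so the surplus is below
  -- `b`. Otherwise the event steps are outweighed by the reduction, so it has paid less than the
  -- truncated `L`, hence less than the surplus, and is not ruined.
  rcases le_total (M.truncation x B (L ω) (M.epoch lam δ ω u) - b) 0 with h2 | h2
  · simp only [max_eq_right h2] at h1
    linarith
  · simp only [max_eq_left h2] at h1
    exfalso
    have h3 : M.truncation x B (L ω) (M.epoch lam δ ω u)
        ≤ max (L ω (M.epoch lam δ ω u)) (x - B) := min_le_left _ _
    have h4 := (L ω).mono ((hR.epoch_le hδ hu).trans hun.le)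
    have h5 : x - B ≤ M.surplus x lam ω (M.claimTime lam ω n) := by
      unfold Model.surplus
      have : 0 ≤ M.p * M.claimTime lam ω n := by positivity
      linarith
    have h6 : max (L ω (M.epoch lam δ ω u)) (x - B) ≤ M.surplus x lam ω (M.claimTime lam ω n) :=
      max_le (h4.trans hLn) h5
    linarith

/-- If `L` is ruined first, then the loss is bounded. -/
theorem paid_le_of_ruin_le (h : M.AdmissibleAt x lam L ω) (hB : 0 ≤ B) (hb0 : 0 ≤ b) {n : ℕ}
    (hr : ENNReal.ofReal (M.claimTime lam ω n)
      ≤ M.ruinTime x lam (M.gridApprox x lam δ B b hx hδ L) ω)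
    (hτ : M.ruinTime x lam L ω ≤ ENNReal.ofReal (M.claimTime lam ω n))
    (ht : M.claimTime lam ω n ≤ t) :
    M.paid x lam L ω t ≤ M.paid x lam (M.gridApprox x lam δ B b hx hδ L) ω t
      + (b + (B + M.p * M.claimTime lam ω n)) := by
  have hR := h.regular
  have hp := M.p_pos
  have hn0 := (hR.claim_pos n)
  have h1 : min (M.gridTarget lam δ (fun t => max (M.truncation x B (L ω) t - b) 0) ω 0)
      (M.surplus x lam ω (M.epoch lam δ ω 0))
        ≤ M.paid x lam (M.gridApprox x lam δ B b hx hδ L) ω t :=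
    hR.le_stoppedPath_gridDividends le_rfl (hn0.le.trans ht)
      (hr.trans_lt' (by simpa using hn0))
  have h2 : x - B - b ≤ M.paid x lam (M.gridApprox x lam δ B b hx hδ L) ω t := by
    refine le_trans (le_min ?_ ?_) h1
    · unfold Model.gridTarget
      have h3 := le_truncation (M := M) (f := L ω) hB hx (hR.epoch_nonneg hδ 0) (h.nonneg _)
      have h4 := le_max_left (x - B) 0
      have h5 := le_max_left (M.truncation x B (L ω) (M.epoch lam δ ω 0) - b) 0
      have h6 : 0 ≤ (M.eventCount lam ω 0 : ℝ) * (M.p * δ) := by positivity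
      linarith
    · rw [hR.epoch_zero, hR.surplus_zero]
      linarith
  have h3 : M.paid x lam L ω t ≤ x + M.p * M.claimTime lam ω n := by
    refine stoppedPath_le (L ω).mono h.zero (by positivity) (hn0.le.trans ht)
      fun u hu0 hut hlt => ?_
    have h4 := h.le_surplus u hu0 hlt
    have h5 := hR.surplus_le x u
    have h6 := (ENNReal.ofReal_lt_ofReal_iff_of_nonneg hu0).1 (hlt.trans_le hτ)
    nlinarith
  linarith

end Model.AdmissibleAt

/-- The supremum of the truncated dividends, less `max (x - B) 0`, up to the `n`-th claim and up
to the time `T`, delayed by `δ`. -/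
def Model.delayedSup (M : Model) (x lam B T δ : ℝ) (L : Dividends) (n : ℕ) (ω : Sample) : ℝ≥0∞ :=
  ⨆ (u : ℚ) (_ : 0 ≤ (u : ℝ) ∧ (u : ℝ) < M.claimTime lam ω n),
    ENNReal.ofReal (M.truncation x B (L ω) (min (max (u - δ) 0) T) - max (x - B) 0)

theorem delayedSup_le_delayedSup {T : ℝ} (n : ℕ) (hδ : 0 ≤ δ) :
    M.delayedSup x lam B T δ L n ω ≤ M.delayedSup x lam B T 0 L n ω := by
  refine iSup₂_mono fun u hu => ENNReal.ofReal_le_ofReal (sub_le_sub_right ?_ _)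
  refine truncation_mono (L ω).mono (min_le_min_right _ (max_le_max_right _ (by linarith)))

theorem delayedSup_le {T : ℝ} (n : ℕ) :
    M.delayedSup x lam B T δ L n ω ≤ ENNReal.ofReal (B + M.p * T) := by
  refine iSup₂_le fun u hu => ENNReal.ofReal_le_ofReal ((truncation_sub_le _).trans ?_)
  have := M.p_pos
  have : M.p * min (max ((u : ℝ) - δ) 0) T ≤ M.p * T := by gcongr; exact min_le_right _ _
  linarith

/-- If `L` is ruined first, by the `n`-th claim, then the loss is at most the amount that `L`
pays in the last period of length `δ`. -/
theorem Model.AdmissibleAt.ofReal_paid_le_of_ruin_le (h : M.AdmissibleAt x lam L ω) (hB : 0 ≤ B)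
    (hb0 : 0 ≤ b) {n : ℕ} {T : ℝ}
    (hr : ENNReal.ofReal (M.claimTime lam ω n)
      ≤ M.ruinTime x lam (M.gridApprox x lam δ B b hx hδ L) ω)
    (hτ : M.ruinTime x lam L ω ≤ ENNReal.ofReal (M.claimTime lam ω n))
    (hmin : ∀ m < n, ENNReal.ofReal (M.claimTime lam ω m) < M.ruinTime x lam L ω)
    (hnT : M.claimTime lam ω n ≤ T) (ht : M.claimTime lam ω n ≤ t) :
    ENNReal.ofReal (M.paid x lam L ω t)
      ≤ ENNReal.ofReal (M.paid x lam (M.gridApprox x lam δ B b hx hδ L) ω t)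
        + ENNReal.ofReal (b + M.p * δ)
        + (M.delayedSup x lam B T 0 L n ω - M.delayedSup x lam B T δ L n ω) := by
  have hR := h.regular
  have hp := M.p_pos
  have hg : 0 < M.p * δ := mul_pos hp hδ
  have hn0 := (hR.claim_pos n)
  have hbefore : ∀ u, u < M.claimTime lam ω n → M.BeforeClaim x lam L ω u := fun u hu m hm => by
    refine hu.trans_le (hR.claim_mono.monotone ?_)
    by_contra! hc
    exact absurd (hmin m hc) (not_lt.2 hm)
  have hru : ∀ u, 0 ≤ u → u < M.claimTime lam ω n →
      ENNReal.ofReal u < M.ruinTime x lam (M.gridApprox x lam δ B b hx hδ L) ω := fun u hu0 hu =>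
    ((ENNReal.ofReal_lt_ofReal_iff_of_nonneg hu0).2 hu).trans_le hr
  set w' := M.paid x lam (M.gridApprox x lam δ B b hx hδ L) ω t with hw'
  have hlow : ∀ u, 0 ≤ u → u < M.claimTime lam ω n →
      min (M.truncation x B (L ω) (max (u - δ) 0) - b) (M.paid x lam L ω u - M.p * δ) ≤ w' :=
    fun u hu0 hu => h.min_le_paid_gridApprox hx hδ hu0 (hu.le.trans ht) (hru u hu0 hu)
      (hbefore u hu)
  have hpaid_mono : ∀ u v, 0 ≤ u → u ≤ v → M.paid x lam L ω u ≤ M.paid x lam L ω v :=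
    fun u v hu huv => stoppedPath_mono (L ω).mono hu (hu.trans huv) huv
  have hbase : ∀ u, 0 ≤ u → max (x - B) 0 ≤ M.truncation x B (L ω) u := fun u hu =>
    le_truncation hB hx hu (h.nonneg u)
  have hlt_claim : ∀ u, 0 ≤ u → ENNReal.ofReal u < M.ruinTime x lam L ω →
      u < M.claimTime lam ω n := fun u hu0 hlt =>
    (ENNReal.ofReal_lt_ofReal_iff_of_nonneg hu0).1 (hlt.trans_le hτ)
  -- Either the grid strategy stays within one grid step of `L` up to the claim, or at some `u₀` it
  -- falls behind. From then on the delayed truncated dividends, and not the surplus, limit it,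
  -- which bounds them by its payments plus `b`.
  by_cases hcase : ∀ u, 0 ≤ u → u < M.claimTime lam ω n → M.paid x lam L ω u - M.p * δ ≤ w'
  · refine le_trans ?_ le_self_add
    refine le_trans (ENNReal.ofReal_le_ofReal (q := w' + (b + M.p * δ)) ?_) ENNReal.ofReal_add_le
    refine stoppedPath_le (L ω).mono h.zero ?_ (hn0.le.trans ht) fun u hu0 hut hlt => ?_
    · have h1 := hcase 0 le_rfl hn0
      have h2 : 0 ≤ M.paid x lam L ω 0 := by
        unfold Model.paid stoppedPath
        split_ifs with h3
        · exact h.nonneg 0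
        · have h0 : M.ruinTime x lam L ω = 0 := by simpa using h3
          rw [h0, ENNReal.toReal_zero, leftLim_eq_zero h.zero]
      linarith
    · have h1 := hcase u hu0 (hlt_claim u hu0 hlt)
      rw [Model.paid, stoppedPath_of_lt hlt] at h1
      linarith
  · push Not at hcase
    obtain ⟨u₀, hu₀, hu₀n, hlt₀⟩ := hcase
    have hup : ∀ u, 0 ≤ u → u < M.claimTime lam ω n →
        M.truncation x B (L ω) (max (u - δ) 0) ≤ w' + b := fun u hu0 hu => by
      -- At times from `u₀` on the second entry of the minimum exceeds `w'`, so the first one must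
      -- be the smaller; monotonicity extends this to earlier `u`.
      have h1 := hlow (max u u₀) (hu0.trans (le_max_left _ _)) (max_lt hu hu₀n)
      have h2 := hpaid_mono u₀ (max u u₀) hu₀ (le_max_right _ _)
      have h3 := truncation_mono (M := M) (x := x) (B := B) (L ω).mono
        (max_le_max_right 0 (sub_le_sub_right (le_max_left u u₀) δ))
      rcases min_le_iff.1 h1 with h4 | h4 <;> linarith
    have hwb : max (x - B) 0 ≤ w' + b :=
      (hbase _ (le_max_right _ _)).trans (hup 0 le_rfl hn0)
    have hchi : M.delayedSup x lam B T δ L n ω ≤ ENNReal.ofReal (w' + b - max (x - B) 0) := by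
      refine iSup₂_le fun u hu => ENNReal.ofReal_le_ofReal (sub_le_sub_right ?_ _)
      exact (truncation_mono (L ω).mono (min_le_left _ _)).trans (hup u hu.1 hu.2)
    have hpsi : ENNReal.ofReal (M.paid x lam L ω t)
        ≤ ENNReal.ofReal (max (x - B) 0) + M.delayedSup x lam B T 0 L n ω := by
      have hfin : M.delayedSup x lam B T 0 L n ω ≠ ⊤ :=
        ne_top_of_le_ne_top ENNReal.ofReal_ne_top (delayedSup_le n)
      rw [← ENNReal.ofReal_toReal hfin,
        ← ENNReal.ofReal_add (le_max_right _ _) ENNReal.toReal_nonneg]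
      refine ENNReal.ofReal_le_ofReal (stoppedPath_le (L ω).mono h.zero
        (add_nonneg (le_max_right _ _) ENNReal.toReal_nonneg) (hn0.le.trans ht)
        fun u hu0 hut hlt => ?_)
      obtain ⟨v, huv, hvn⟩ := exists_rat_btwn (hlt_claim u hu0 hlt)
      have hv0 := hu0.trans huv.le
      have h1 : ENNReal.ofReal (M.truncation x B (L ω) v - max (x - B) 0)
          ≤ M.delayedSup x lam B T 0 L n ω := by
        refine le_trans (le_of_eq ?_) (le_iSup₂ (f := fun (u : ℚ)
          (_ : 0 ≤ (u : ℝ) ∧ (u : ℝ) < M.claimTime lam ω n) => ENNReal.ofReal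
            (M.truncation x B (L ω) (min (max (u - 0) 0) T) - max (x - B) 0)) v ⟨hv0, hvn⟩)
        rw [sub_zero, max_eq_left hv0, min_eq_left (hvn.le.trans hnT)]
      have h2 := (ENNReal.ofReal_le_iff_le_toReal hfin).1 h1
      have h3 : L ω u ≤ M.truncation x B (L ω) v := by
        refine le_min (((L ω).mono huv.le).trans (le_max_left _ _)) ?_
        have h4 := h.le_surplus u hu0 hlt
        have h5 := hR.surplus_le x u
        nlinarith
      linarith
    have hsub : M.delayedSup x lam B T 0 L n ω = M.delayedSup x lam B T δ L n ω
        + (M.delayedSup x lam B T 0 L n ω - M.delayedSup x lam B T δ L n ω) :=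
      (add_tsub_cancel_of_le (delayedSup_le_delayedSup n hδ.le)).symm
    rw [hsub, ← add_assoc] at hpsi
    refine hpsi.trans (add_le_add_left ?_ _)
    refine (add_le_add_right hchi _).trans ?_
    rw [← ENNReal.ofReal_add (le_max_right _ _) (by linarith)]
    refine le_trans (ENNReal.ofReal_le_ofReal ?_) ENNReal.ofReal_add_le
    linarith

end comparison

end

/-! ### Comparison of the discounted dividends along a sample -/

section

variable {M : Model} {x lam δ B b t : ℝ} {ω : Sample} {L : Dividends}

/-- By lack of memory, a delay by `δ` keeps at least the fraction `e^{-qδ}` of the discounted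
amount. Subtracting the base level first makes that amount at most `B + p / q`. -/
theorem lintegral_truncation_sub_le (hx : 0 ≤ x) (hB : 0 ≤ B) (hδ : 0 < δ)
    (f : StieltjesFunction ℝ) (hf : ∀ t, 0 ≤ f t) :
    ∫⁻ t, ENNReal.ofReal (M.truncation x B f t - M.truncation x B f (max (t - δ) 0)) ∂M.killing
      ≤ ENNReal.ofReal ((1 - Real.exp (-M.q * δ)) * (B + M.p / M.q)) := by
  have hp := M.p_pos
  have hq := M.q_pos
  have hm := truncation_mono (M := M) (x := x) (B := B) f.mono
  set F : ℝ → ℝ≥0∞ := fun t => ENNReal.ofReal (M.truncation x B f t - max (x - B) 0) with hF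
  have hFm : Monotone F := fun s t hst =>
    ENNReal.ofReal_le_ofReal (sub_le_sub_right (hm hst) _)
  have hdm : Monotone fun t : ℝ => max (t - δ) 0 := fun s t hst => by dsimp only; gcongr
  have hFle : ∫⁻ t, F t ∂M.killing ≤ ENNReal.ofReal (B + M.p / M.q) := by
    rw [← lintegral_killing_affine hB]
    exact lintegral_mono fun t => ENNReal.ofReal_le_ofReal (truncation_sub_le t)
  have hdelay : ENNReal.ofReal (Real.exp (-M.q * δ)) * ∫⁻ t, F t ∂M.killing
      ≤ ∫⁻ t, F (max (t - δ) 0) ∂M.killing := by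
    have h1 := lintegral_Ici_expMeasure (r := M.q) hδ.le (f := fun t => F (max (t - δ) 0))
      (hFm.comp hdm).measurable
    have h2 : ∫⁻ t, F (max (t + δ - δ) 0) ∂M.killing = ∫⁻ t, F t ∂M.killing := by
      refine lintegral_congr_ae ?_
      filter_upwards [ae_killing_pos (M := M)] with t ht
      rw [add_sub_cancel_right, max_eq_left ht.le]
    unfold Model.killing at h2 ⊢
    rw [← h2, ← h1]
    exact setLIntegral_le_lintegral _ _
  have hsum : ∫⁻ t, ENNReal.ofReal (M.truncation x B f t - M.truncation x B f (max (t - δ) 0))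
      ∂M.killing + ∫⁻ t, F (max (t - δ) 0) ∂M.killing = ∫⁻ t, F t ∂M.killing := by
    have h1 : Measurable fun t => F (max (t - δ) 0) := (hFm.comp hdm).measurable
    rw [← lintegral_add_right _ h1]
    refine lintegral_congr_ae ?_
    filter_upwards [ae_killing_pos (M := M)] with t ht
    have h1 := le_truncation (M := M) hB hx (le_max_right (t - δ) 0) (hf (max (t - δ) 0))
    have h2 : M.truncation x B f (max (t - δ) 0) ≤ M.truncation x B f t :=
      hm (max_le (by linarith) ht.le)
    rw [hF, ← ENNReal.ofReal_add (by linarith) (by linarith)]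
    congr 1
    ring
  have hfin : ∫⁻ t, F t ∂M.killing ≠ ⊤ := ne_top_of_le_ne_top ENNReal.ofReal_ne_top hFle
  have he : Real.exp (-M.q * δ) ≤ 1 := Real.exp_le_one_iff.2 (by nlinarith)
  have h1 : ∫⁻ t, ENNReal.ofReal (M.truncation x B f t - M.truncation x B f (max (t - δ) 0))
      ∂M.killing + ENNReal.ofReal (Real.exp (-M.q * δ)) * ∫⁻ t, F t ∂M.killing
      ≤ ∫⁻ t, F t ∂M.killing := by
    conv_rhs => rw [← hsum]
    gcongr
  have h2 : ∫⁻ t, F t ∂M.killing = ENNReal.ofReal (1 - Real.exp (-M.q * δ))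
      * ∫⁻ t, F t ∂M.killing + ENNReal.ofReal (Real.exp (-M.q * δ)) * ∫⁻ t, F t ∂M.killing := by
    rw [← add_mul, ← ENNReal.ofReal_add (by linarith) (Real.exp_nonneg _), sub_add_cancel,
      ENNReal.ofReal_one, one_mul]
  have h3 := h2 ▸ h1
  rw [ENNReal.ofReal_mul (by linarith)]
  refine le_trans (ENNReal.le_of_add_le_add_right ?_ (h1.trans h2.le)) (by gcongr)
  exact ENNReal.mul_ne_top ENNReal.ofReal_ne_top hfin

theorem lintegral_Ici_killing_affine {c : ℝ} (hc : 0 ≤ c) :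
    ∫⁻ t, (Ici c).indicator (fun t => ENNReal.ofReal (M.p * (t - c))) t ∂M.killing
      = ENNReal.ofReal (Real.exp (-M.q * c) * (M.p / M.q)) := by
  have h1 := lintegral_Ici_expMeasure (r := M.q) hc
    (f := fun t => ENNReal.ofReal (M.p * (t - c))) (by fun_prop)
  have h2 := lintegral_killing_affine (M := M) le_rfl
  simp only [zero_add] at h2
  unfold Model.killing at h2 ⊢
  rw [lintegral_indicator measurableSet_Ici, h1, ENNReal.ofReal_mul (Real.exp_nonneg _), ← h2]
  simp

theorem lintegral_le_of_forall_pos {f g h : ℝ → ℝ} {c : ℝ≥0∞} {k : ℝ → ℝ≥0∞}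
    (hh : Measurable h) (hk : Measurable k)
    (hle : ∀ t, 0 < t → ENNReal.ofReal (f t)
      ≤ ENNReal.ofReal (g t) + (c + ENNReal.ofReal (h t)) + k t) :
    ∫⁻ t, ENNReal.ofReal (f t) ∂M.killing ≤ ∫⁻ t, ENNReal.ofReal (g t) ∂M.killing
      + (c + ∫⁻ t, ENNReal.ofReal (h t) ∂M.killing) + ∫⁻ t, k t ∂M.killing := by
  have h1 : ∫⁻ t, (c + ENNReal.ofReal (h t)) ∂M.killing
      = c + ∫⁻ t, ENNReal.ofReal (h t) ∂M.killing := by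
    rw [lintegral_add_left measurable_const, lintegral_const, measure_univ, mul_one]
  rw [← h1, ← lintegral_add_right _ (by fun_prop), ← lintegral_add_right _ hk]
  exact lintegral_mono_ae ((ae_killing_pos (M := M)).mono hle)

variable (hx : 0 ≤ x) (hδ : 0 < δ)

/-- The comparison of the discounted dividends along a sample. Here `ρ` bounds the losses by the
ruin of the grid strategy and at the ruin of `L`. -/
theorem Model.AdmissibleAt.lintegral_paid_le (h : M.AdmissibleAt x lam L ω) (hB : 0 ≤ B)
    (hb0 : 0 ≤ b) {T : ℝ} {ρ : ℝ≥0∞}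
    (h1 : ∀ n u, 0 ≤ u → u < M.claimTime lam ω n →
      M.surplus x lam ω (M.claimTime lam ω n) < M.tracking x lam δ
        (fun t => max (M.truncation x B (L ω) t - b) 0) ω u →
      ENNReal.ofReal (M.claimTime lam ω n) < M.ruinTime x lam L ω →
      ENNReal.ofReal (Real.exp (-M.q * M.claimTime lam ω n) * (M.p / M.q)) ≤ ρ)
    (h2 : ∀ n, ENNReal.ofReal (Real.exp (-M.q * M.claimTime lam ω n)
        * (B + M.p * M.claimTime lam ω n)) ≤ ρ ∨
      (M.claimTime lam ω n ≤ T ∧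
        M.delayedSup x lam B T 0 L n ω - M.delayedSup x lam B T δ L n ω ≤ ρ)) :
    ∫⁻ t, ENNReal.ofReal (M.paid x lam L ω t) ∂M.killing
      ≤ ∫⁻ t, ENNReal.ofReal (M.paid x lam (M.gridApprox x lam δ B b hx hδ L) ω t) ∂M.killing
        + (ENNReal.ofReal (b + M.p * δ)
          + ENNReal.ofReal ((1 - Real.exp (-M.q * δ)) * (B + M.p / M.q))) + ρ := by
  classical
  have hR := h.regular
  have hp := M.p_pos
  set r := M.ruinTime x lam (M.gridApprox x lam δ B b hx hδ L) ω with hr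
  set Q := M.truncation x B (L ω) with hQ
  have hQm : Measurable fun t => Q t - Q (max (t - δ) 0) := by
    have h3 := truncation_mono (M := M) (x := x) (B := B) (L ω).mono
    exact h3.measurable.sub (h3.measurable.comp (by fun_prop))
  have hover : ∀ t, 0 ≤ t → (M.Overdrawn x lam δ
      (fun t => max (M.truncation x B (L ω) t - b) 0) ω t ↔ r ≤ ENNReal.ofReal t) :=
    fun t ht => overdrawn_iff_ruinTime_le (hx := hx) (hδ := hδ)
      (G := fun ω t => max (M.truncation x B (L ω) t - b) 0)
      (hG := fun ω => truncation_sub_monotoneOn (L ω)) (hG0 := fun _ _ _ => le_max_right _ _) hR ht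
  have hI : ∀ t, 0 ≤ t → ENNReal.ofReal t < r → M.BeforeClaim x lam L ω t →
      ENNReal.ofReal (M.paid x lam L ω t)
        ≤ ENNReal.ofReal (M.paid x lam (M.gridApprox x lam δ B b hx hδ L) ω t)
          + (ENNReal.ofReal (b + M.p * δ) + ENNReal.ofReal (Q t - Q (max (t - δ) 0))) :=
    fun t ht htr hbc => by
      rw [← add_assoc]
      refine (ENNReal.ofReal_le_ofReal (h.paid_le_of_lt hx hδ hb0 ht htr hbc)).trans ?_
      exact ENNReal.ofReal_add_le.trans (add_le_add_left ENNReal.ofReal_add_le _)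
  -- It suffices to exhibit a loss `k` of mean at most `ρ` that covers the times after the ruin of
  -- the grid strategy or after the ruinous claim of `L`; at other times only delay and rounding
  -- count.
  have key : ∀ k : ℝ → ℝ≥0∞, Measurable k → ∫⁻ t, k t ∂M.killing ≤ ρ →
      (∀ t, 0 < t → (ENNReal.ofReal t < r ∧ M.BeforeClaim x lam L ω t) ∨
        ENNReal.ofReal (M.paid x lam L ω t)
          ≤ ENNReal.ofReal (M.paid x lam (M.gridApprox x lam δ B b hx hδ L) ω t)
            + ENNReal.ofReal (b + M.p * δ) + k t) →
      ∫⁻ t, ENNReal.ofReal (M.paid x lam L ω t) ∂M.killing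
        ≤ ∫⁻ t, ENNReal.ofReal (M.paid x lam (M.gridApprox x lam δ B b hx hδ L) ω t) ∂M.killing
          + (ENNReal.ofReal (b + M.p * δ)
            + ENNReal.ofReal ((1 - Real.exp (-M.q * δ)) * (B + M.p / M.q))) + ρ := by
    intro k hk hkρ hk'
    refine (lintegral_le_of_forall_pos (c := ENNReal.ofReal (b + M.p * δ)) hQm hk
      fun t ht => ?_).trans (add_le_add (add_le_add_right (add_le_add_right
        (lintegral_truncation_sub_le hx hB hδ (L ω) h.nonneg) _) _) hkρ)
    rcases hk' t ht with h3 | h3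
    · exact (hI t ht.le h3.1 h3.2).trans le_self_add
    · refine h3.trans ?_
      gcongr
      exact le_self_add
  have hruin : ∀ n u, (∀ t, M.Overdrawn x lam δ
      (fun t => max (M.truncation x B (L ω) t - b) 0) ω t ↔ M.claimTime lam ω n ≤ t) →
      0 ≤ u → u < M.claimTime lam ω n →
      M.surplus x lam ω (M.claimTime lam ω n) < M.tracking x lam δ
        (fun t => max (M.truncation x B (L ω) t - b) 0) ω u →
      ENNReal.ofReal (M.claimTime lam ω n) < M.ruinTime x lam L ω →
      (∀ t, t < M.claimTime lam ω n → M.BeforeClaim x lam L ω t) →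
      ∫⁻ t, ENNReal.ofReal (M.paid x lam L ω t) ∂M.killing
        ≤ ∫⁻ t, ENNReal.ofReal (M.paid x lam (M.gridApprox x lam δ B b hx hδ L) ω t) ∂M.killing
          + (ENNReal.ofReal (b + M.p * δ)
            + ENNReal.ofReal ((1 - Real.exp (-M.q * δ)) * (B + M.p / M.q))) + ρ := by
    intro n u hn hu hun hX hτ hbefore
    have hn0 := hR.claim_pos n
    have hlt : ∀ t, 0 ≤ t → t < M.claimTime lam ω n → ENNReal.ofReal t < r := fun t ht htn =>
      not_le.1 fun hc => absurd ((hn t).1 ((hover t ht).2 hc)) (not_le.2 htn)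
    refine key ((Ici (M.claimTime lam ω n)).indicator fun t =>
      ENNReal.ofReal (M.p * (t - M.claimTime lam ω n)))
      (Measurable.indicator (by fun_prop) measurableSet_Ici)
      (by rw [lintegral_Ici_killing_affine hn0.le]; exact h1 n u hu hun hX hτ) fun t ht => ?_
    rcases lt_or_ge t (M.claimTime lam ω n) with htn | htn
    · exact Or.inl ⟨hlt t ht.le htn, hbefore t htn⟩
    · right
      rw [indicator_of_mem (by simpa using htn), add_assoc]
      have hX' : M.surplus x lam ω (M.claimTime lam ω n)
          ≤ M.paid x lam (M.gridApprox x lam δ B b hx hδ L) ω t := by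
        have hnu : ¬ M.Overdrawn x lam δ (fun t => max (M.truncation x B (L ω) t - b) 0) ω u :=
          fun hc => absurd ((hn u).1 hc) (not_le.2 hun)
        refine hX.le.trans ?_
        rw [← hR.gridPath_eq hδ (truncation_sub_monotoneOn (L ω)) hu hnu]
        refine (gridDividends_apply (hx := hx) (hδ := hδ)
          (G := fun ω t => max (M.truncation x B (L ω) t - b) 0)
          (hG := fun ω => truncation_sub_monotoneOn (L ω)) (hG0 := fun _ _ _ => le_max_right _ _)
          hR hu).ge.trans ?_
        exact le_stoppedPath (StieltjesFunction.mono _) hu (hun.le.trans htn) (hlt u hu hun)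
      refine (ENNReal.ofReal_le_ofReal (h.paid_le_of_ruin hx hδ hX' hτ htn)).trans
        (ENNReal.ofReal_add_le.trans ?_)
      exact add_le_add_right le_add_self _
  by_cases hN : ∃ m, M.ruinTime x lam L ω ≤ ENNReal.ofReal (M.claimTime lam ω m)
  -- Claim `N` is the first at or after the ruin of `L`. Only the order of this claim and the ruin
  -- of the grid strategy matters.
  · set N := Nat.find hN with hNdef
    have hτN := Nat.find_spec hN
    have hmin : ∀ m < N, ENNReal.ofReal (M.claimTime lam ω m) < M.ruinTime x lam L ω :=
      fun m hm => not_le.1 (Nat.find_min hN hm)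
    have hbefore : ∀ u, u < M.claimTime lam ω N → M.BeforeClaim x lam L ω u := fun u hu m hm =>
      hu.trans_le (hR.claim_mono.monotone (Nat.find_min' hN hm))
    have hNpos := hR.claim_pos N
    have hsecond : (∀ t, t < M.claimTime lam ω N → ¬ M.Overdrawn x lam δ
        (fun t => max (M.truncation x B (L ω) t - b) 0) ω t) →
        ∫⁻ t, ENNReal.ofReal (M.paid x lam L ω t) ∂M.killing
        ≤ ∫⁻ t, ENNReal.ofReal (M.paid x lam (M.gridApprox x lam δ B b hx hδ L) ω t) ∂M.killing
          + (ENNReal.ofReal (b + M.p * δ)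
            + ENNReal.ofReal ((1 - Real.exp (-M.q * δ)) * (B + M.p / M.q))) + ρ := by
      intro hno
      have hlt : ∀ u, 0 ≤ u → u < M.claimTime lam ω N → ENNReal.ofReal u < r := fun u hu0 hu =>
        not_le.1 fun hc => hno u hu ((hover u hu0).2 hc)
      have hrN : ENNReal.ofReal (M.claimTime lam ω N) ≤ r := by
        by_contra! hc
        have hfin := ne_top_of_lt hc
        have h3 := (ENNReal.lt_ofReal_iff_toReal_lt hfin).1 hc
        have h4 := hlt _ ENNReal.toReal_nonneg h3
        rw [ENNReal.ofReal_toReal hfin] at h4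
        exact lt_irrefl _ h4
      -- Late or exceptional claims use the crude loss `B + p τ_N`, discounted from `τ_N`; the
      -- others use the payments of `L` in the last period before the claim.
      rcases h2 N with h3 | ⟨hNT, h3⟩
      · refine key ((Ici (M.claimTime lam ω N)).indicator fun _ =>
          ENNReal.ofReal (B + M.p * M.claimTime lam ω N))
          (measurable_const.indicator measurableSet_Ici)
          (by rwa [lintegral_Ici_killing_const hNpos.le]) fun t ht => ?_
        rcases lt_or_ge t (M.claimTime lam ω N) with htN | htN
        · exact Or.inl ⟨hlt t ht.le htN, hbefore t htN⟩
        · right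
          rw [indicator_of_mem (by simpa using htN), add_assoc]
          have h4 := h.paid_le_of_ruin_le hx hδ hB hb0 hrN hτN htN
          refine (ENNReal.ofReal_le_ofReal h4).trans (ENNReal.ofReal_add_le.trans ?_)
          refine add_le_add_right (ENNReal.ofReal_add_le.trans ?_) _
          gcongr
          have : 0 ≤ M.p * δ := by positivity
          linarith
      · refine key (fun _ => ρ) measurable_const (by simp) fun t ht => ?_
        rcases lt_or_ge t (M.claimTime lam ω N) with htN | htN
        · exact Or.inl ⟨hlt t ht.le htN, hbefore t htN⟩
        · right
          exact (h.ofReal_paid_le_of_ruin_le hx hδ hB hb0 hrN hτN hmin hNT htN).trans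
            (add_le_add_right h3 _)
    rcases hR.overdrawn_dichotomy hδ x (fun t => max (M.truncation x B (L ω) t - b) 0)
      with hn | ⟨n, hn, u, hu, hun, hX⟩
    · exact hsecond fun t _ => hn t
    rcases le_or_gt N n with hNn | hNn
    · refine hsecond fun t ht hc => ?_
      exact absurd (ht.trans_le (hR.claim_mono.monotone hNn)) (not_lt.2 ((hn t).1 hc))
    · exact hruin n u hn hu hun hX (hmin n hNn) fun t ht =>
        hbefore t (ht.trans (hR.claim_mono hNn))
  · push Not at hN
    have hbefore : ∀ t, M.BeforeClaim x lam L ω t := fun t m hm =>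
      absurd hm (not_le.2 (hN m))
    rcases hR.overdrawn_dichotomy hδ x (fun t => max (M.truncation x B (L ω) t - b) 0)
      with hn | ⟨n, hn, u, hu, hun, hX⟩
    · refine key 0 measurable_zero (by simp) fun t ht => Or.inl ⟨?_, hbefore t⟩
      exact not_le.1 fun hc => hn t ((hover t ht.le).2 hc)
    · exact hruin n u hn hu hun hX (hN n) fun t _ => hbefore t

end

/-! ### Resampling and shifting one increment of the Poisson clock -/

section

variable {M : Model} {lam t : ℝ} {ω : Sample} {n : ℕ} {e : ℝ}

/-- Resampling one coordinate of an infinite product. -/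
theorem measurePreserving_update {α β : Type*} [MeasurableSpace α] [MeasurableSpace β]
    (μ : Measure α) [IsProbabilityMeasure μ] (ν : Measure β) [IsProbabilityMeasure ν]
    {g : α × β → α} (hg : MeasurePreserving g (μ.prod ν) μ) (n : ℕ) :
    MeasurePreserving (fun z : (ℕ → α) × β => Function.update z.1 n (g (z.1 n, z.2)))
      ((Measure.infinitePi fun _ : ℕ => μ).prod ν) (Measure.infinitePi fun _ : ℕ => μ) := by
  have hm : Measurable fun z : (ℕ → α) × β => Function.update z.1 n (g (z.1 n, z.2)) := by
    have := hg.measurable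
    refine measurable_pi_iff.2 fun i => ?_
    by_cases hi : i = n
    · subst hi
      simp only [Function.update_self]
      fun_prop
    · simp only [Function.update_of_ne hi]
      fun_prop
  refine ⟨hm, Measure.eq_infinitePi _ fun s t ht => ?_⟩
  have hbox : MeasurableSet (Set.pi (s : Set ℕ) t) :=
    MeasurableSet.pi s.countable_toSet fun i _ => ht i
  rw [Measure.map_apply hm hbox]
  by_cases hn : n ∈ s
  · have hfib : ∀ y : β, (Measure.infinitePi fun _ : ℕ => μ) ((fun x => (x, y)) ⁻¹'
        ((fun z : (ℕ → α) × β => Function.update z.1 n (g (z.1 n, z.2))) ⁻¹' (Set.pi s t)))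
        = (∏ i ∈ s.erase n, μ (t i)) * μ ((fun x => (x, y)) ⁻¹' (g ⁻¹' t n)) := by
      intro y
      have hset : ((fun x => (x, y)) ⁻¹'
        ((fun z : (ℕ → α) × β => Function.update z.1 n (g (z.1 n, z.2))) ⁻¹' (Set.pi s t)))
        = Set.pi s (Function.update t n ((fun x => (x, y)) ⁻¹' (g ⁻¹' t n))) := by
        ext x
        simp only [mem_preimage, Set.mem_pi, Finset.mem_coe]
        refine forall₂_congr fun i hi => ?_
        by_cases hin : i = n
        · subst hin
          simp
        · simp [Function.update_of_ne hin]
      rw [hset, Measure.infinitePi_pi, ← Finset.mul_prod_erase s _ hn, mul_comm]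
      · congr 1
        · refine Finset.prod_congr rfl fun i hi => ?_
          rw [Function.update_of_ne (Finset.ne_of_mem_erase hi)]
        · rw [Function.update_self]
      · intro i _
        by_cases hin : i = n
        · subst hin
          rw [Function.update_self]
          exact measurable_prodMk_right (hg.measurable (ht i))
        · rw [Function.update_of_ne hin]
          exact ht i
    rw [Measure.prod_apply_symm (hm hbox)]
    simp_rw [hfib]
    rw [lintegral_const_mul _ (measurable_measure_prodMk_right (hg.measurable (ht n))),
      ← Measure.prod_apply_symm (hg.measurable (ht n)),
      hg.measure_preimage (ht n).nullMeasurableSet, mul_comm]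
    exact Finset.mul_prod_erase s (fun i => μ (t i)) hn
  · have hset : (fun z : (ℕ → α) × β => Function.update z.1 n (g (z.1 n, z.2))) ⁻¹' (Set.pi s t)
        = Set.pi (s : Set ℕ) t ×ˢ univ := by
      ext z
      simp only [mem_preimage, Set.mem_pi, Finset.mem_coe, mem_prod, mem_univ, and_true]
      refine forall₂_congr fun i hi => ?_
      rw [Function.update_of_ne (by rintro rfl; exact hn hi)]
    rw [hset, Measure.prod_prod, measure_univ, mul_one, Measure.infinitePi_pi _ fun i _ => ht i]

/-- Replace the `n`-th increment of the Poisson clock by `e`. -/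
def setClock (n : ℕ) (ω : Sample) (e : ℝ) : Sample :=
  Function.update ω n ((ω n).1, (ω n).2.1, e, (ω n).2.2.2)

/-- Increase the `n`-th increment of the Poisson clock by `c`. -/
def shiftClock (n : ℕ) (c : ℝ) (ω : Sample) : Sample := setClock n ω ((ω n).2.2.1 + c)

/-- The increment is independent of everything else, so a fresh exponential variable may take its
place. -/
theorem measurePreserving_setClock (n : ℕ) :
    MeasurePreserving (fun z : Sample × ℝ => setClock n z.1 z.2) (M.P.prod (expMeasure 1)) M.P := by
  have hg : MeasurePreserving
      (fun z : (ℝ × ℝ × ℝ × ℝ) × ℝ => (z.1.1, z.1.2.1, z.2, z.1.2.2.2))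
      (M.entryLaw.prod (expMeasure 1)) M.entryLaw := by
    unfold Model.entryLaw
    have h3 : MeasurePreserving (fun z : (ℝ × ℝ) × ℝ => (z.2, z.1.2))
        (((expMeasure 1).prod M.claimLaw).prod (expMeasure 1))
        ((expMeasure 1).prod M.claimLaw) :=
      (Measure.measurePreserving_swap (μ := M.claimLaw) (ν := expMeasure 1)).comp
        ((measurePreserving_snd (μ := expMeasure 1) (ν := M.claimLaw)).prod
          (MeasurePreserving.id (expMeasure 1)))
    have h2 : MeasurePreserving (fun z : (ℝ × ℝ × ℝ) × ℝ => (z.1.1, z.2, z.1.2.2))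
        ((M.jumpLaw.prod ((expMeasure 1).prod M.claimLaw)).prod (expMeasure 1))
        (M.jumpLaw.prod ((expMeasure 1).prod M.claimLaw)) :=
      ((MeasurePreserving.id M.jumpLaw).prod h3).comp
        (measurePreserving_prodAssoc M.jumpLaw ((expMeasure 1).prod M.claimLaw) (expMeasure 1))
    exact ((MeasurePreserving.id (expMeasure M.β)).prod h2).comp
        (measurePreserving_prodAssoc (expMeasure M.β)
          (M.jumpLaw.prod ((expMeasure 1).prod M.claimLaw)) (expMeasure 1))
  exact measurePreserving_update M.entryLaw (expMeasure 1) hg n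

@[simp]
theorem setClock_fst (i : ℕ) : (setClock n ω e i).1 = (ω i).1 := by
  unfold setClock
  by_cases h : i = n
  · subst h; simp
  · simp [Function.update_of_ne h]

@[simp]
theorem jumpSize_setClock (i : ℕ) : jumpSize (setClock n ω e) i = jumpSize ω i := by
  unfold setClock jumpSize
  by_cases h : i = n
  · subst h; simp
  · simp [Function.update_of_ne h]

@[simp]
theorem claimSize_setClock (i : ℕ) : claimSize (setClock n ω e) i = claimSize ω i := by
  unfold setClock claimSize
  by_cases h : i = n
  · subst h; simp
  · simp [Function.update_of_ne h]

theorem setClock_clock (i : ℕ) :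
    (setClock n ω e i).2.2.1 = (ω i).2.2.1 + if i = n then e - (ω n).2.2.1 else 0 := by
  unfold setClock
  by_cases h : i = n
  · subst h; simp
  · simp [h]

@[simp]
theorem catTime_setClock : catTime (setClock n ω e) = catTime ω := by
  ext k
  simp [catTime]

@[simp]
theorem catCount_setClock : catCount (setClock n ω e) = catCount ω := by
  ext t
  simp [catCount]

@[simp]
theorem rateBound_setClock (T : ℝ) : rateBound lam (setClock n ω e) T = rateBound lam ω T := by
  simp [rateBound]

@[simp]
theorem cumIntensity_setClock (t : ℝ) :
    M.cumIntensity lam (setClock n ω e) t = M.cumIntensity lam ω t := by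
  simp [Model.cumIntensity, Model.intensity]

theorem sum_setClock (N : ℕ) : ∑ i ∈ Finset.range N, (setClock n ω e i).2.2.1
    = (∑ i ∈ Finset.range N, (ω i).2.2.1) + if n < N then e - (ω n).2.2.1 else 0 := by
  simp only [setClock_clock, Finset.sum_add_distrib, Finset.sum_ite_eq', Finset.mem_range]

theorem claimTime_setClock {m : ℕ} (hm : m < n) :
    M.claimTime lam (setClock n ω e) m = M.claimTime lam ω m := by
  have h : ¬ n < m + 1 := by omega
  simp [Model.claimTime, sum_setClock, h]

theorem clockTime_shiftClock (n : ℕ) (c : ℝ) :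
    clockTime (shiftClock n c ω) n = clockTime ω n + c := by
  unfold clockTime shiftClock
  rw [sum_setClock, if_pos (Nat.lt_succ_self n)]
  ring

theorem Good.setClock (h : Good ω) (he : 0 < e) : Good (setClock n ω e) where
  pos i := by
    have h1 := h.pos i
    unfold ShotNoise.setClock
    by_cases hi : i = n
    · subst hi; simpa [he] using ⟨h1.1, h1.2.1, h1.2.2.2⟩
    · simpa [Function.update_of_ne hi] using h1
  sum_wait := by simpa using h.sum_wait
  sum_jump := by
    simpa only [← jumpSize.eq_def, jumpSize_setClock] using h.sum_jump
  sum_clock := by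
    simp only [sum_setClock]
    refine (tendsto_atTop_add_const_right _ (e - (ω n).2.2.1) h.sum_clock).congr' ?_
    filter_upwards [eventually_gt_atTop n] with N hN
    rw [if_pos hN]
  sum_claim := by
    simpa only [← claimSize.eq_def, claimSize_setClock] using h.sum_claim

theorem Good.shiftClock (h : Good ω) {c : ℝ} (hc : 0 ≤ c) : Good (shiftClock n c ω) :=
  h.setClock (by linarith [(h.pos n).2.2.1])

theorem measurable_shiftClock (n : ℕ) (c : ℝ) : Measurable (shiftClock n c) := by
  refine measurable_pi_iff.2 fun i => ?_
  unfold shiftClock setClock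
  by_cases h : i = n
  · subst h
    simp only [Function.update_self]
    fun_prop
  · simp only [Function.update_of_ne h]
    fun_prop

/-- The law of the samples with an increased increment of the Poisson clock. -/
theorem map_shiftClock_le (n : ℕ) {c : ℝ} (hc : 0 ≤ c) :
    M.P.map (shiftClock n c) ≤ ENNReal.ofReal (Real.exp c) • M.P := by
  have hmp := measurePreserving_setClock (M := M) n
  have hsh := measurable_shiftClock n c
  refine Measure.le_iff.2 fun s hs => ?_
  have hs1 : MeasurableSet ((fun z : Sample × ℝ => setClock n z.1 z.2) ⁻¹' s) := hmp.measurable hs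
  have hcomp : ∀ (ω : Sample) (e : ℝ), shiftClock n c (setClock n ω e) = setClock n ω (e + c) := by
    intro ω e
    unfold shiftClock setClock
    simp
  -- Resampling first makes the shift act on a fresh exponential variable alone. Lack of memory
  -- bounds the law of that variable plus `c` by `e^c` times the exponential law.
  rw [Measure.map_apply hsh hs, Measure.smul_apply, smul_eq_mul,
    ← hmp.measure_preimage (hsh hs).nullMeasurableSet, ← hmp.measure_preimage hs.nullMeasurableSet,
    Measure.prod_apply (hmp.measurable (hsh hs)), Measure.prod_apply hs1,
    ← lintegral_const_mul _ (measurable_measure_prodMk_left hs1)]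
  refine lintegral_mono fun ω => ?_
  set A : Set ℝ := {e | setClock n ω e ∈ s} with hA
  have hAm : MeasurableSet A := measurable_prodMk_left hs1
  have h1 : Prod.mk ω ⁻¹' ((fun z : Sample × ℝ => setClock n z.1 z.2) ⁻¹'
      (shiftClock n c ⁻¹' s)) = {e | e + c ∈ A} := by
    ext e
    simp only [mem_preimage, hcomp, hA, mem_ofPred_eq]
  have h2 := lintegral_Ici_expMeasure (r := 1) hc (f := A.indicator 1)
    (measurable_one.indicator hAm)
  have h3 : ∫⁻ e, A.indicator (1 : ℝ → ℝ≥0∞) (e + c) ∂(expMeasure 1)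
      = expMeasure 1 {e | e + c ∈ A} := by
    have : (fun e => A.indicator (1 : ℝ → ℝ≥0∞) (e + c)) = {e | e + c ∈ A}.indicator 1 := by
      ext e
      rfl
    have hm : MeasurableSet {e | e + c ∈ A} := measurable_id.add_const c hAm
    rw [this, lintegral_indicator_one hm]
  rw [h3] at h2
  rw [h1]
  have h4 : expMeasure 1 {e | e + c ∈ A} = ENNReal.ofReal (Real.exp c)
      * ∫⁻ t in Ici c, A.indicator 1 t ∂(expMeasure 1) := by
    rw [h2, ← mul_assoc, ← ENNReal.ofReal_mul (Real.exp_nonneg _), ← Real.exp_add]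
    simp
  rw [h4]
  gcongr
  refine (setLIntegral_le_lintegral _ _).trans (le_of_eq ?_)
  rw [lintegral_indicator_one hAm]
  rfl

theorem absolutelyContinuous_shiftClock (n : ℕ) {c : ℝ} (hc : 0 ≤ c) :
    M.P.map (shiftClock n c) ≪ M.P :=
  (Measure.absolutelyContinuous_of_le (map_shiftClock_le n hc)).trans
    (Measure.smul_absolutelyContinuous)

theorem lintegral_shiftClock_le (n : ℕ) {c : ℝ} (hc : 0 ≤ c) {f : Sample → ℝ≥0∞}
    (hf : AEMeasurable f M.P) :
    ∫⁻ ω, f (shiftClock n c ω) ∂M.P ≤ ENNReal.ofReal (Real.exp c) * ∫⁻ ω, f ω ∂M.P := by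
  rw [← lintegral_map' (hf.mono_ac (absolutelyContinuous_shiftClock n hc))
    (measurable_shiftClock n c).aemeasurable]
  refine (lintegral_mono' (map_shiftClock_le n hc) le_rfl).trans (le_of_eq ?_)
  rw [lintegral_smul_measure, smul_eq_mul]

theorem Good.claimTime_le_claimTime_shiftClock (h : Good ω) (hlam : M.lamBase ≤ lam) {c : ℝ}
    (hc : 0 ≤ c) : M.claimTime lam ω n ≤ M.claimTime lam (ShotNoise.shiftClock n c ω) n := by
  have h' := h.shiftClock (n := n) hc
  have h0 := h'.claimTime_nonneg hlam n
  rw [h.claimTime_le_iff hlam n h0]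
  have h1 := h'.cumIntensity_claimTime hlam n
  rw [clockTime_shiftClock] at h1
  have h2 : M.cumIntensity lam (ShotNoise.shiftClock n c ω)
      (M.claimTime lam (ShotNoise.shiftClock n c ω) n)
      = M.cumIntensity lam ω (M.claimTime lam (ShotNoise.shiftClock n c ω) n) :=
    cumIntensity_setClock _
  linarith

/-- Before the `n`-th claim, the information does not depend on the `n`-th increment of the
Poisson clock. -/
theorem info_shiftClock (hlam : M.lamBase ≤ lam) {c : ℝ} (hc : 0 ≤ c) {A : Set Sample}
    (hA : MeasurableSet[M.info lam t] A) :
    ∀ᵐ ω ∂M.P, t < M.claimTime lam ω n → (ω ∈ A ↔ shiftClock n c ω ∈ A) := by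
  induction A, hA using MeasurableSpace.generateFrom_induction with
  | hC A hA _ =>
    rcases hA with (⟨k, s, B, hs, hB, rfl⟩ | ⟨k, s, B, hs, hB, rfl⟩) | h0
    · exact ae_of_all _ fun ω _ => by simp [shiftClock]
    · filter_upwards [ae_good (M := M)] with ω hω htn
      rcases lt_or_ge k n with hk | hk
      · simp [shiftClock, claimTime_setClock hk]
      -- The `k`-th claim with `k ≥ n` comes after `t` in both samples, so neither lies in the
      -- generator.
      · have h1 := (hω.regular hlam).claim_mono.monotone hk
        have h2 := ((hω.shiftClock (n := n) hc).regular hlam).claim_mono.monotone hk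
        have h3 := hω.claimTime_le_claimTime_shiftClock (n := n) hlam hc
        exact ⟨fun h => by linarith [h.1], fun h => by linarith [h.1]⟩
    · have h1 : M.P (shiftClock n c ⁻¹' A) = 0 :=
        ((Measure.QuasiMeasurePreserving.mk (measurable_shiftClock n c)
          (absolutelyContinuous_shiftClock n hc)).preimage_null h0)
      filter_upwards [measure_eq_zero_iff_ae_notMem.1 h0, measure_eq_zero_iff_ae_notMem.1 h1]
        with ω hω1 hω2 _
      exact ⟨fun h => absurd h hω1, fun h => absurd h hω2⟩
  | empty => simp
  | compl A _ ih =>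
    filter_upwards [ih] with ω hω ht
    exact not_congr (hω ht)
  | iUnion s _ ih =>
    filter_upwards [ae_all_iff.2 ih] with ω hω ht
    simp only [mem_iUnion]
    exact exists_congr fun i => hω i ht

theorem info_measurable_shiftClock (hlam : M.lamBase ≤ lam) {c : ℝ} (hc : 0 ≤ c) {f : Sample → ℝ}
    (hf : Measurable[M.info lam t] f) :
    ∀ᵐ ω ∂M.P, t < M.claimTime lam ω n → f ω = f (shiftClock n c ω) := by
  have h : ∀ᵐ ω ∂M.P, ∀ q : ℚ, t < M.claimTime lam ω n →
      (ω ∈ f ⁻¹' Iio (q : ℝ) ↔ shiftClock n c ω ∈ f ⁻¹' Iio (q : ℝ)) :=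
    ae_all_iff.2 fun q => info_shiftClock hlam hc (hf measurableSet_Iio)
  filter_upwards [h] with ω hω ht
  by_contra hne
  rcases lt_or_gt_of_ne hne with hlt | hlt
  · obtain ⟨q, h1, h2⟩ := exists_rat_btwn hlt
    exact absurd ((hω q ht).1 h1) (not_lt.2 h2.le)
  · obtain ⟨q, h1, h2⟩ := exists_rat_btwn hlt
    exact absurd ((hω q ht).2 h1) (not_lt.2 h2.le)

/-- Non-anticipation of `L`, with one null set for all times: agreement at rational times extends by
right-continuity. -/
theorem dividends_shiftClock {L : Dividends} (hlam : M.lamBase ≤ lam) {c : ℝ} (hc : 0 ≤ c)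
    (hL : ∀ t, 0 ≤ t → Measurable[M.info lam t] fun ω => L ω t) (n : ℕ) :
    ∀ᵐ ω ∂M.P, ∀ t, 0 ≤ t → t < M.claimTime lam ω n → L ω t = L (shiftClock n c ω) t := by
  have h : ∀ᵐ ω ∂M.P, ∀ q : ℚ, 0 ≤ (q : ℝ) → (q : ℝ) < M.claimTime lam ω n →
      L ω q = L (shiftClock n c ω) q := by
    refine ae_all_iff.2 fun q => ?_
    by_cases hq : 0 ≤ (q : ℝ)
    · filter_upwards [info_measurable_shiftClock (n := n) hlam hc (hL q hq)] with ω hω _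
      exact hω
    · exact ae_of_all _ fun ω h0 => absurd h0 hq
  filter_upwards [h] with ω hω t ht htn
  have h1 := (((L ω).right_continuous t).mono Ioi_subset_Ici_self).tendsto
  have h2 := (((L (shiftClock n c ω)).right_continuous t).mono Ioi_subset_Ici_self).tendsto
  have hfreq : ∃ᶠ u in 𝓝[>] t, L ω u = L (shiftClock n c ω) u := by
    intro hc
    obtain ⟨b, hb, hsub⟩ := mem_nhdsGT_iff_exists_Ioo_subset.1 hc
    obtain ⟨q, hq1, hq2⟩ := exists_rat_btwn (lt_min (mem_Ioi.1 hb) htn)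
    exact hsub ⟨hq1, hq2.trans_le (min_le_left _ _)⟩
      (hω q (ht.trans hq1.le) (hq2.trans_le (min_le_right _ _)))
  exact tendsto_nhds_unique_of_frequently_eq h1 h2 hfreq

end

/-! ### Two estimates: short intervals after a claim, and payments just before one -/

section

variable {M : Model} {x lam δ B b T R t : ℝ} {ω : Sample} {n : ℕ} {L : Dividends}

open scoped Classical in
theorem measurable_goodCatCount (T : ℝ) :
    Measurable fun ω : Sample => if Good ω then catCount ω T else 0 := by
  refine measurable_of_Ioi fun k => ?_
  convert measurableSet_good.inter (measurableSet_le (measurable_catTime k)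
    (measurable_const (a := T))) using 1
  ext ω
  by_cases hω : Good ω
  · simp [hω, hω.lt_catCount]
  · simp [hω]

open scoped Classical in
theorem measurable_goodRateBound (lam T : ℝ) :
    Measurable fun ω : Sample => if Good ω then rateBound lam ω T else lam := by
  have h : Measurable fun ω : Sample => lam + ∑ k ∈ Finset.range
      (if Good ω then catCount ω T else 0), jumpSize ω k := by
    refine Measurable.const_add ?_ _
    exact measurable_apply_nat (f := fun m ω => ∑ k ∈ Finset.range m, jumpSize ω k)
      (fun m => Finset.measurable_fun_sum _ fun k _ => measurable_jumpSize k)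
      (measurable_goodCatCount T)
  convert h using 2 with ω
  by_cases hω : Good ω <;> simp [hω, rateBound]

open scoped Classical in
theorem measurable_goodClaimTime (hlam : M.lamBase ≤ lam) (n : ℕ) :
    Measurable fun ω : Sample => if Good ω then M.claimTime lam ω n else 0 := by
  refine measurable_of_Iic fun s => ?_
  by_cases hs : 0 ≤ s
  · convert (measurableSet_claimTime_le hlam n s).union measurableSet_good.compl using 1
    ext ω
    by_cases hω : Good ω <;> simp [hω, hs]
  · convert measurableSet_claimTime_le hlam n s using 1
    ext ω
    by_cases hω : Good ω <;> simp [hω, hs]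

theorem aemeasurable_rateBound (lam T : ℝ) : AEMeasurable (fun ω => rateBound lam ω T) M.P := by
  classical
  refine ⟨_, measurable_goodRateBound lam T, ?_⟩
  filter_upwards [ae_good (M := M)] with ω hω
  rw [if_pos hω]

/-- The probability that a claim takes the surplus into a short interval. -/
theorem measure_surplus_claimTime_mem_le (hlam : M.lamBase ≤ lam) (hb : 0 ≤ b) (hR : 0 ≤ R)
    (x T : ℝ) (n : ℕ) :
    M.P {ω | Good ω ∧ rateBound lam ω T ≤ R ∧ M.claimTime lam ω n ≤ T ∧
      0 ≤ M.surplus x lam ω (M.claimTime lam ω n) ∧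
      M.surplus x lam ω (M.claimTime lam ω n) < b} ≤ ENNReal.ofReal (R * (b / M.p)) := by
  classical
  have hp := M.p_pos
  set A := {ω | Good ω ∧ rateBound lam ω T ≤ R ∧ M.claimTime lam ω n ≤ T ∧
      0 ≤ M.surplus x lam ω (M.claimTime lam ω n) ∧
      M.surplus x lam ω (M.claimTime lam ω n) < b} with hA
  have hX : ∀ ω, Good ω → M.surplus x lam ω (M.claimTime lam ω n)
      = x + M.p * M.claimTime lam ω n - ∑ j ∈ Finset.range (n + 1), claimSize ω j := by
    intro ω hω
    have hreg := hω.regular hlam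
    have h1 : M.claimCount lam ω (M.claimTime lam ω n) = n + 1 := by
      refine le_antisymm ?_ ((hreg.lt_claimCount _ n).2 le_rfl)
      by_contra! hc
      have h2 := (hreg.lt_claimCount _ (n + 1)).1 hc
      exact absurd (hreg.claim_mono (Nat.lt_succ_self n)) (not_lt.2 h2)
    unfold Model.surplus
    rw [h1]
  have hAm : MeasurableSet A := by
    have hT := measurable_goodClaimTime hlam n
    have hS : Measurable fun ω : Sample => ∑ j ∈ Finset.range (n + 1), claimSize ω j :=
      Finset.measurable_fun_sum _ fun j _ => measurable_claimSize j
    have hX' : Measurable fun ω : Sample => x + M.p * (if Good ω then M.claimTime lam ω n else 0)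
        - ∑ j ∈ Finset.range (n + 1), claimSize ω j := ((hT.const_mul _).const_add _).sub hS
    have heq : A = {ω | Good ω} ∩ ({ω | (if Good ω then rateBound lam ω T else lam) ≤ R} ∩
        ({ω | (if Good ω then M.claimTime lam ω n else 0) ≤ T} ∩
        ({ω | 0 ≤ x + M.p * (if Good ω then M.claimTime lam ω n else 0)
          - ∑ j ∈ Finset.range (n + 1), claimSize ω j} ∩
         {ω | x + M.p * (if Good ω then M.claimTime lam ω n else 0)
          - ∑ j ∈ Finset.range (n + 1), claimSize ω j < b}))) := by
      ext ω
      by_cases hω : Good ω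
      · simp [hA, hω, hX ω hω]
      · simp [hA, hω]
    rw [heq]
    exact measurableSet_good.inter ((measurableSet_le (measurable_goodRateBound lam T)
      measurable_const).inter ((measurableSet_le hT measurable_const).inter
      ((measurableSet_le measurable_const hX').inter (measurableSet_lt hX' measurable_const))))
  have hmp := measurePreserving_setClock (M := M) n
  rw [← hmp.measure_preimage hAm.nullMeasurableSet, Measure.prod_apply (hmp.measurable hAm)]
  calc _ ≤ ∫⁻ _, ENNReal.ofReal (R * (b / M.p)) ∂M.P := ?_
    _ = _ := by simp
  refine lintegral_mono fun ω => ?_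
  refine (expMeasure_one_le_volume _).trans ((Real.volume_le_diam _).trans
    (Metric.ediam_le fun e₁ h₁ e₂ h₂ => ?_))
  -- With all else fixed, two values of the increment in the event give surpluses at the claim less
  -- than `b` apart, hence claim times at most `b / p` apart. The clock runs at rate at most `R`, so
  -- the increments differ by at most `R b / p`.
  have key : ∀ e₁ e₂, setClock n ω e₁ ∈ A → setClock n ω e₂ ∈ A → e₂ - e₁ ≤ R * (b / M.p) := by
    rintro e₁ e₂ ⟨hg₁, -, hT₁, hX₁, hX₁'⟩ ⟨hg₂, hr₂, hT₂, hX₂, hX₂'⟩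
    rw [hX _ hg₁] at hX₁ hX₁'
    rw [hX _ hg₂] at hX₂ hX₂'
    simp only [claimSize_setClock] at hX₁ hX₁' hX₂ hX₂'
    have hc₁ := hg₁.cumIntensity_claimTime hlam n
    have hc₂ := hg₂.cumIntensity_claimTime hlam n
    have h0₁ := hg₁.claimTime_nonneg hlam n
    have h0₂ := hg₂.claimTime_nonneg hlam n
    set s₁ := M.claimTime lam (setClock n ω e₁) n
    set s₂ := M.claimTime lam (setClock n ω e₂) n
    have hclock : clockTime (setClock n ω e₂) n - clockTime (setClock n ω e₁) n = e₂ - e₁ := by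
      unfold clockTime
      rw [sum_setClock, sum_setClock, if_pos (Nat.lt_succ_self n), if_pos (Nat.lt_succ_self n)]
      ring
    rw [cumIntensity_setClock] at hc₁ hc₂
    rcases le_total s₁ s₂ with hs | hs
    · have h1 := hg₂.cumIntensity_sub_le hlam h0₁ hs hT₂
      rw [cumIntensity_setClock, cumIntensity_setClock] at h1
      have h2 : s₂ - s₁ ≤ b / M.p := by
        rw [le_div_iff₀ hp]
        linarith
      have h3 : rateBound lam (setClock n ω e₂) T * (s₂ - s₁) ≤ R * (b / M.p) :=
        mul_le_mul hr₂ h2 (by linarith) hR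
      linarith
    · have h1 := hg₂.cumIntensity_mono hlam h0₂ hs
      rw [cumIntensity_setClock, cumIntensity_setClock] at h1
      have : 0 ≤ R * (b / M.p) := by positivity
      linarith
  rw [edist_dist, Real.dist_eq]
  refine ENNReal.ofReal_le_ofReal (abs_le.2 ⟨?_, key e₂ e₁ h₂ h₁⟩)
  have := key e₁ e₂ h₁ h₂
  linarith

theorem aemeasurable_delayedSup (hlam : M.lamBase ≤ lam)
    (hL : ∀ t, 0 ≤ t → Measurable[M.info lam t] fun ω => L ω t) (hT : 0 ≤ T) (x B δ : ℝ) (n : ℕ) :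
    AEMeasurable (M.delayedSup x lam B T δ L n) M.P := by
  classical
  have h : ∀ u : ℚ, AEMeasurable (fun ω => ⨆ _ : 0 ≤ (u : ℝ) ∧ (u : ℝ) < M.claimTime lam ω n,
      ENNReal.ofReal (M.truncation x B (L ω) (min (max (u - δ) 0) T) - max (x - B) 0)) M.P := by
    intro u
    have hLu := aemeasurable_of_info hlam (hL (min (max (u - δ) 0) T) (le_min (le_max_right _ _) hT))
    have hQ : AEMeasurable (fun ω => ENNReal.ofReal
        (M.truncation x B (L ω) (min (max (u - δ) 0) T) - max (x - B) 0)) M.P := by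
      unfold Model.truncation
      exact (((hLu.max aemeasurable_const).min aemeasurable_const).sub_const _).ennreal_ofReal
    have hset : NullMeasurableSet {ω | 0 ≤ (u : ℝ) ∧ (u : ℝ) < M.claimTime lam ω n} M.P := by
      by_cases hu : 0 ≤ (u : ℝ)
      · have h1 := (nullMeasurableSet_of_info hlam (info_claimTime (M := M) (lam := lam)
          (le_refl (u : ℝ)) n MeasurableSet.univ)).compl
        convert h1 using 1
        ext ω
        simp [hu]
      · convert MeasurableSet.empty.nullMeasurableSet using 1
        ext ω
        simp [hu]
    refine (hQ.indicator₀ hset).congr (ae_of_all _ fun ω => ?_)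
    beta_reduce
    by_cases hω : 0 ≤ (u : ℝ) ∧ (u : ℝ) < M.claimTime lam ω n
    · rw [indicator_of_mem (by exact hω), iSup_pos hω]
    · rw [indicator_of_notMem (by exact hω), iSup_neg hω, bot_eq_zero]
  exact AEMeasurable.iSup h

/-- The expected amount that is paid in the last period of length `δ` before a claim. -/
theorem lintegral_delayedSup_sub_le (hlam : M.lamBase ≤ lam)
    (hL : ∀ t, 0 ≤ t → Measurable[M.info lam t] fun ω => L ω t) (hT : 0 ≤ T) (hδ : 0 ≤ δ)
    (hR : 0 ≤ R) (x B : ℝ) (n : ℕ) :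
    ∫⁻ ω, {ω | rateBound lam ω (T + δ) ≤ R}.indicator (fun ω =>
        M.delayedSup x lam B T 0 L n ω - M.delayedSup x lam B T δ L n ω) ω ∂M.P
      ≤ ENNReal.ofReal ((Real.exp (R * δ) - 1) * (B + M.p * T)) := by
  have hp := M.p_pos
  set A := {ω : Sample | rateBound lam ω (T + δ) ≤ R} with hA
  have hAm : NullMeasurableSet A M.P :=
    nullMeasurableSet_le (aemeasurable_rateBound lam (T + δ)) aemeasurable_const
  have hc : 0 ≤ R * δ := mul_nonneg hR hδ
  have hχ : AEMeasurable (A.indicator (M.delayedSup x lam B T δ L n)) M.P :=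
    (aemeasurable_delayedSup hlam hL hT x B δ n).indicator₀ hAm
  have hχle : ∫⁻ ω, A.indicator (M.delayedSup x lam B T δ L n) ω ∂M.P
      ≤ ENNReal.ofReal (B + M.p * T) := by
    calc _ ≤ ∫⁻ _, ENNReal.ofReal (B + M.p * T) ∂M.P :=
          lintegral_mono fun ω => (indicator_le_self' (fun _ _ => bot_le) ω).trans
            (delayedSup_le n)
      _ = _ := by simp
  have hle : ∀ᵐ ω ∂M.P, A.indicator (M.delayedSup x lam B T 0 L n) ω
      ≤ A.indicator (M.delayedSup x lam B T δ L n) (shiftClock n (R * δ) ω) := by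
    filter_upwards [ae_good (M := M), dividends_shiftClock hlam hc hL n] with ω hω hshift
    have hmem : shiftClock n (R * δ) ω ∈ A ↔ ω ∈ A := by
      simp only [hA, mem_ofPred_eq, shiftClock, rateBound_setClock]
    by_cases hωA : ω ∈ A
    · rw [indicator_of_mem hωA, indicator_of_mem (hmem.2 hωA)]
      refine iSup₂_le fun u hu => ?_
      rw [sub_zero, max_eq_left hu.1]
      set v := min (u : ℝ) T with hv
      have hv0 : 0 ≤ v := le_min hu.1 hT
      have hvn : v < M.claimTime lam ω n := (min_le_left _ _).trans_lt hu.2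
      have hg := hω.shiftClock (n := n) hc
      -- In a time `δ` the clock advances by at most `R δ`, the added length; the shifted claim
      -- therefore comes more than `δ` after any time before the original one.
      have hvδ : v + δ < M.claimTime lam (shiftClock n (R * δ) ω) n := by
        by_contra! hcon
        have h1 := (hg.claimTime_le_iff hlam n (by linarith)).1 hcon
        rw [clockTime_shiftClock] at h1
        have h2 : M.cumIntensity lam (shiftClock n (R * δ) ω) (v + δ)
            = M.cumIntensity lam ω (v + δ) := cumIntensity_setClock _
        have h3 : M.cumIntensity lam ω v < clockTime ω n := by
          by_contra! hcon'
          exact absurd ((hω.claimTime_le_iff hlam n hv0).2 hcon') (not_le.2 hvn)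
        have h4 := hω.cumIntensity_sub_le hlam hv0 (le_add_of_nonneg_right hδ)
          (add_le_add_left (min_le_right (u : ℝ) T) δ)
        have h5 : rateBound lam ω (T + δ) * (v + δ - v) ≤ R * δ := by
          rw [add_sub_cancel_left]
          exact mul_le_mul_of_nonneg_right hωA hδ
        linarith
      -- At `w` the delayed path of the shifted sample has already seen time `v`, where both samples
      -- have received the same dividends.
      obtain ⟨w, hw1, hw2⟩ := exists_rat_btwn hvδ
      have hL' : M.truncation x B (L ω) v = M.truncation x B (L (shiftClock n (R * δ) ω)) v := by
        unfold Model.truncation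
        rw [hshift v hv0 hvn]
      refine le_trans ?_ (le_iSup₂ (f := fun (u : ℚ)
        (_ : 0 ≤ (u : ℝ) ∧ (u : ℝ) < M.claimTime lam (shiftClock n (R * δ) ω) n) =>
          ENNReal.ofReal (M.truncation x B (L (shiftClock n (R * δ) ω)) (min (max (u - δ) 0) T)
            - max (x - B) 0)) w ⟨by linarith, hw2⟩)
      rw [hL']
      refine ENNReal.ofReal_le_ofReal (sub_le_sub_right
        (truncation_mono (StieltjesFunction.mono _) ?_) _)
      exact le_min (le_max_of_le_left (by linarith)) (min_le_right _ _)
    · rw [indicator_of_notMem hωA, indicator_of_notMem (fun h => hωA (hmem.1 h))]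
  have hsum : ∫⁻ ω, A.indicator (M.delayedSup x lam B T δ L n) ω ∂M.P
      + ∫⁻ ω, A.indicator (fun ω => M.delayedSup x lam B T 0 L n ω
        - M.delayedSup x lam B T δ L n ω) ω ∂M.P
      = ∫⁻ ω, A.indicator (M.delayedSup x lam B T 0 L n) ω ∂M.P := by
    rw [← lintegral_add_left' hχ]
    refine lintegral_congr fun ω => ?_
    by_cases hωA : ω ∈ A
    · simp only [indicator_of_mem hωA]
      exact add_tsub_cancel_of_le (delayedSup_le_delayedSup n hδ)
    · simp only [indicator_of_notMem hωA, add_zero]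
  have hbound := (lintegral_mono_ae hle).trans (lintegral_shiftClock_le n hc hχ)
  rw [← hsum] at hbound
  set I := ∫⁻ ω, A.indicator (M.delayedSup x lam B T δ L n) ω ∂M.P with hI
  have hexp : 1 ≤ Real.exp (R * δ) := Real.one_le_exp hc
  -- The undelayed mean is at most `e^{Rδ}` times the delayed mean `I`. Cancelling the finite `I`
  -- leaves the gain `(e^{Rδ} - 1) I`.
  have hsplit : ENNReal.ofReal (Real.exp (R * δ)) * I
      = I + ENNReal.ofReal (Real.exp (R * δ) - 1) * I := by
    conv_rhs => rw [← one_mul I, ← mul_assoc, mul_one, ← add_mul, ← ENNReal.ofReal_one,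
      ← ENNReal.ofReal_add zero_le_one (by linarith), add_sub_cancel]
  rw [hsplit] at hbound
  refine (ENNReal.le_of_add_le_add_left (ne_top_of_le_ne_top ENNReal.ofReal_ne_top hχle)
    hbound).trans ?_
  rw [ENNReal.ofReal_mul (by linarith)]
  gcongr

end

/-! ### The expected total loss -/

section

variable {M : Model} {x lam lam₀ δ B T₁ T₂ R : ℝ} {K : ℕ} {ω : Sample} {L : Dividends}

/-- The sum of the claims up to time `T`. -/
def Model.claimSum (M : Model) (lam T : ℝ) (ω : Sample) : ℝ :=
  ∑ j ∈ Finset.range (M.claimCount lam ω T), claimSize ω j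

theorem aemeasurable_claimSum (hlam : M.lamBase ≤ lam) (T : ℝ) :
    AEMeasurable (M.claimSum lam T) M.P := by
  have h := aemeasurable_of_info hlam (info_surplus hlam 0 T)
  convert h.const_sub (M.p * T) using 2 with ω
  simp [Model.claimSum, Model.surplus]

theorem aemeasurable_eventCount (hlam : M.lamBase ≤ lam) (T : ℝ) :
    AEMeasurable (fun ω => (M.eventCount lam ω T : ℝ)) M.P :=
  aemeasurable_of_info hlam ((measurable_from_top (f := fun n : ℕ => (n : ℝ))).comp
    (info_eventCount hlam T))

theorem Good.rateBound_mono (h : Good ω) (hle : lam ≤ lam₀) {S T : ℝ} (hST : S ≤ T) :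
    rateBound lam ω S ≤ rateBound lam₀ ω T := by
  refine add_le_add hle (Finset.sum_le_sum_of_subset_of_nonneg
    (Finset.range_mono (h.catCount_mono hST)) fun k _ _ => (h.jumpSize_pos k).le)

theorem Good.claimSum_mono (h : Good ω) (hlam : M.lamBase ≤ lam) (hle : lam ≤ lam₀) (T : ℝ) :
    M.claimSum lam T ω ≤ M.claimSum lam₀ T ω :=
  (h.regular hlam).sum_claims_mono (h.claimCount_mono_right hlam hle T)

/-- The random loss of the grid strategy that follows `L`. -/
def Model.loss (M : Model) (x lam lam₀ δ B T₁ T₂ R : ℝ) (K : ℕ) (c : ℝ) (L : Dividends)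
    (ω : Sample) : ℝ≥0∞ :=
  ENNReal.ofReal (Real.exp (-M.q * T₁) * (M.p / M.q)) + ENNReal.ofReal c
  + ∑ n ∈ Finset.range K, (toMeasurable M.P {ω | Good ω ∧ rateBound lam ω T₁ ≤ R ∧
      M.claimTime lam ω n ≤ T₁ ∧ 0 ≤ M.surplus x lam ω (M.claimTime lam ω n) ∧
      M.surplus x lam ω (M.claimTime lam ω n) < K * (M.p * δ)}).indicator
        (fun _ => ENNReal.ofReal (M.p / M.q)) ω
  + {ω | B < M.claimSum lam₀ T₁ ω}.indicator (fun _ => ENNReal.ofReal (M.p / M.q)) ω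
  + {ω | (K : ℝ) < M.eventCount lam₀ ω T₂}.indicator
      (fun _ => ENNReal.ofReal (B + M.p * T₂ + M.p / M.q)) ω
  + {ω | R < rateBound lam₀ ω (T₂ + 1)}.indicator
      (fun _ => ENNReal.ofReal (B + M.p * T₂ + M.p / M.q)) ω
  + ∑ n ∈ Finset.range K, {ω | rateBound lam ω (T₂ + δ) ≤ R}.indicator
      (fun ω => M.delayedSup x lam B T₂ 0 L n ω - M.delayedSup x lam B T₂ δ L n ω) ω

/-- Each possible loss is charged to one term: claims after `T₁` or `T₂` to the discount factor,
samples with large claims, many events or high rates to an indicator, and the rest to one of the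
first `K` claims. Since `δ ≤ 1`, the rate bound up to `T₂ + 1` suffices for every step. -/
theorem Model.AdmissibleAt.lintegral_paid_le_add_loss (hω : Good ω)
    (h : M.AdmissibleAt x lam L ω) (hx : 0 ≤ x) (hδ : 0 < δ) (hδ1 : δ ≤ 1)
    (hlam : M.lamBase ≤ lam) (hle : lam ≤ lam₀) (hB : 0 ≤ B) (hT₁ : 0 ≤ T₁) (hT : T₁ ≤ T₂)
    {c : ℝ} (hc : ∀ s, T₂ ≤ s → Real.exp (-M.q * s) * (B + M.p * s) ≤ c) :
    ∫⁻ t, ENNReal.ofReal (M.paid x lam L ω t) ∂M.killing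
      ≤ ∫⁻ t, ENNReal.ofReal (M.paid x lam
          (M.gridApprox x lam δ B (K * (M.p * δ)) hx hδ L) ω t) ∂M.killing
        + (ENNReal.ofReal (K * (M.p * δ) + M.p * δ)
          + ENNReal.ofReal ((1 - Real.exp (-M.q * δ)) * (B + M.p / M.q)))
        + M.loss x lam lam₀ δ B T₁ T₂ R K c L ω := by
  have hp := M.p_pos
  have hq := M.q_pos
  have hR := h.regular
  have hT₂ : 0 ≤ T₂ := hT₁.trans hT
  have hexp : ∀ s, 0 ≤ s → Real.exp (-M.q * s) ≤ 1 := fun s hs =>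
    Real.exp_le_one_iff.2 (by nlinarith)
  have hpq : 0 ≤ M.p / M.q := by positivity
  have hbig : ∀ {y z : ℝ}, y ≤ z → ∀ {g : ℝ≥0∞}, ENNReal.ofReal z ≤ g → ENNReal.ofReal y ≤ g :=
    fun hyz _ hz => (ENNReal.ofReal_le_ofReal hyz).trans hz
  have hlamlow : M.lamBase ≤ lam₀ := hlam.trans hle
  have hevent : ∀ s, s ≤ T₂ → M.eventCount lam ω s ≤ M.eventCount lam₀ ω T₂ := fun s hs =>
    (hR.eventCount_mono hs).trans
      (Nat.add_le_add_right (hω.claimCount_mono_right hlam hle T₂) _)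
  have hn : ∀ n, M.claimTime lam ω n ≤ T₂ → M.eventCount lam₀ ω T₂ ≤ K → n < K := fun n hn hK =>
    ((hR.lt_claimCount T₂ n).2 hn).trans_le
      (((Nat.le_add_right _ _).trans (hevent T₂ le_rfl)).trans hK)
  have hE : (K : ℝ) < M.eventCount lam₀ ω T₂ ∨ R < rateBound lam₀ ω (T₂ + 1) →
      ENNReal.ofReal (B + M.p * T₂ + M.p / M.q) ≤ M.loss x lam lam₀ δ B T₁ T₂ R K c L ω := by
    unfold Model.loss
    rintro (h1 | h1)
    · refine le_trans ?_ (le_self_add.trans le_self_add)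
      refine le_trans (le_of_eq ?_) le_add_self
      rw [indicator_of_mem (by exact h1)]
    · refine le_trans ?_ le_self_add
      refine le_trans (le_of_eq ?_) le_add_self
      rw [indicator_of_mem (by exact h1)]
  refine h.lintegral_paid_le hx hδ hB (by positivity) (T := T₂) (fun n u hu hun hX hτ => ?_)
    fun n => ?_
  · have hn0 := (hR.claim_pos n).le
    rcases lt_or_ge T₁ (M.claimTime lam ω n) with hnT | hnT
    · refine (ENNReal.ofReal_le_ofReal (q := Real.exp (-M.q * T₁) * (M.p / M.q)) ?_).trans ?_
      · refine mul_le_mul_of_nonneg_right (Real.exp_le_exp.2 ?_) hpq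
        nlinarith
      · unfold Model.loss
        simp only [add_assoc]
        exact le_self_add
    have h1 : Real.exp (-M.q * M.claimTime lam ω n) * (M.p / M.q) ≤ M.p / M.q :=
      mul_le_of_le_one_left hpq (hexp _ hn0)
    by_cases hD : (K : ℝ) < M.eventCount lam₀ ω T₂ ∨ R < rateBound lam₀ ω (T₂ + 1)
    · refine hbig (h1.trans ?_) (hE hD)
      have : 0 ≤ M.p * T₂ := by positivity
      linarith
    push Not at hD
    refine hbig h1 ?_
    by_cases hS : B < M.claimSum lam₀ T₁ ω
    · unfold Model.loss
      refine le_trans ?_ (le_self_add.trans (le_self_add.trans le_self_add))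
      refine le_trans (le_of_eq ?_) le_add_self
      rw [indicator_of_mem (by exact hS)]
    push Not at hS
    have hK : M.eventCount lam₀ ω T₂ ≤ K := by exact_mod_cast hD.1
    have h2 := h.surplus_lt_of_ruin hδ rfl hu hun hX hτ
      ((hevent _ (hnT.trans hT)).trans hK)
      ((hR.sum_claims_mono (hR.claimCount_mono hnT)).trans
        ((hω.claimSum_mono hlam hle T₁).trans hS))
    have hmem : ω ∈ toMeasurable M.P {ω | Good ω ∧ rateBound lam ω T₁ ≤ R ∧
      M.claimTime lam ω n ≤ T₁ ∧ 0 ≤ M.surplus x lam ω (M.claimTime lam ω n) ∧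
      M.surplus x lam ω (M.claimTime lam ω n) < K * (M.p * δ)} :=
      subset_toMeasurable _ _ ⟨hω, (hω.rateBound_mono hle (by linarith)).trans hD.2, hnT, h2⟩
    unfold Model.loss
    refine le_trans ?_ (le_self_add.trans (le_self_add.trans (le_self_add.trans le_self_add)))
    refine le_trans ?_ le_add_self
    refine le_trans (le_of_eq ?_) (Finset.single_le_sum (fun _ _ => bot_le)
      (Finset.mem_range.2 (hn n (hnT.trans hT) hK)))
    rw [indicator_of_mem hmem]
  · have hn0 := (hR.claim_pos n).le
    rcases lt_or_ge T₂ (M.claimTime lam ω n) with hnT | hnT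
    · left
      refine hbig (hc _ hnT.le) ?_
      unfold Model.loss
      simp only [add_assoc]
      exact le_add_left le_self_add
    by_cases hD : (K : ℝ) < M.eventCount lam₀ ω T₂ ∨ R < rateBound lam₀ ω (T₂ + 1)
    · left
      refine hbig ?_ (hE hD)
      have h1 : M.p * M.claimTime lam ω n ≤ M.p * T₂ := by gcongr
      have h2 : 0 ≤ M.p * M.claimTime lam ω n := by positivity
      have h3 := mul_le_of_le_one_left (show 0 ≤ B + M.p * M.claimTime lam ω n by linarith)
        (hexp _ hn0)
      linarith
    push Not at hD
    have hK : M.eventCount lam₀ ω T₂ ≤ K := by exact_mod_cast hD.1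
    refine Or.inr ⟨hnT, ?_⟩
    unfold Model.loss
    refine le_trans ?_ le_add_self
    refine le_trans (le_of_eq ?_) (Finset.single_le_sum (fun _ _ => bot_le)
      (Finset.mem_range.2 (hn n hnT hK)))
    rw [indicator_of_mem (by exact (hω.rateBound_mono hle (by linarith)).trans hD.2)]

theorem lintegral_loss_le (hlam : M.lamBase ≤ lam) (hle : lam ≤ lam₀)
    (hL : ∀ t, 0 ≤ t → Measurable[M.info lam t] fun ω => L ω t) (hδ : 0 < δ) (hR : 0 ≤ R)
    (hT₂ : 0 ≤ T₂) (x B T₁ c : ℝ) :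
    AEMeasurable (M.loss x lam lam₀ δ B T₁ T₂ R K c L) M.P ∧
    ∫⁻ ω, M.loss x lam lam₀ δ B T₁ T₂ R K c L ω ∂M.P ≤
      ENNReal.ofReal (Real.exp (-M.q * T₁) * (M.p / M.q)) + ENNReal.ofReal c
      + K * (ENNReal.ofReal (M.p / M.q) * ENNReal.ofReal (R * (K * (M.p * δ) / M.p)))
      + ENNReal.ofReal (M.p / M.q) * M.P {ω | B < M.claimSum lam₀ T₁ ω}
      + ENNReal.ofReal (B + M.p * T₂ + M.p / M.q)
        * M.P {ω | (K : ℝ) < M.eventCount lam₀ ω T₂}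
      + ENNReal.ofReal (B + M.p * T₂ + M.p / M.q) * M.P {ω | R < rateBound lam₀ ω (T₂ + 1)}
      + K * ENNReal.ofReal ((Real.exp (R * δ) - 1) * (B + M.p * T₂)) := by
  have hp := M.p_pos
  have hlam₀ := hlam.trans hle
  -- The measurable hull has the same measure as the event and makes its indicator measurable.
  have hA : ∀ n, AEMeasurable (fun ω => (toMeasurable M.P {ω | Good ω ∧ rateBound lam ω T₁ ≤ R ∧
      M.claimTime lam ω n ≤ T₁ ∧ 0 ≤ M.surplus x lam ω (M.claimTime lam ω n) ∧
      M.surplus x lam ω (M.claimTime lam ω n) < K * (M.p * δ)}).indicator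
        (fun _ => ENNReal.ofReal (M.p / M.q)) ω) M.P := fun n =>
    (measurable_const.indicator (measurableSet_toMeasurable _ _)).aemeasurable
  have hD₁ : NullMeasurableSet {ω | B < M.claimSum lam₀ T₁ ω} M.P :=
    nullMeasurableSet_lt aemeasurable_const (aemeasurable_claimSum hlam₀ T₁)
  have hD₂ : NullMeasurableSet {ω | (K : ℝ) < M.eventCount lam₀ ω T₂} M.P :=
    nullMeasurableSet_lt aemeasurable_const (aemeasurable_eventCount hlam₀ T₂)
  have hD₃ : NullMeasurableSet {ω | R < rateBound lam₀ ω (T₂ + 1)} M.P :=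
    nullMeasurableSet_lt aemeasurable_const (aemeasurable_rateBound lam₀ (T₂ + 1))
  have hG : NullMeasurableSet {ω | rateBound lam ω (T₂ + δ) ≤ R} M.P :=
    nullMeasurableSet_le (aemeasurable_rateBound lam (T₂ + δ)) aemeasurable_const
  have hΨ : ∀ n, AEMeasurable (fun ω => {ω | rateBound lam ω (T₂ + δ) ≤ R}.indicator
      (fun ω => M.delayedSup x lam B T₂ 0 L n ω - M.delayedSup x lam B T₂ δ L n ω) ω) M.P :=
    fun n => ((aemeasurable_delayedSup hlam hL hT₂ x B 0 n).sub
      (aemeasurable_delayedSup hlam hL hT₂ x B δ n)).indicator₀ hG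
  have m₁ := Finset.aemeasurable_fun_sum (Finset.range K) fun n _ => hA n
  have m₂ := (aemeasurable_const (b := ENNReal.ofReal (M.p / M.q)) (μ := M.P)).indicator₀ hD₁
  have m₃ := (aemeasurable_const (b := ENNReal.ofReal (B + M.p * T₂ + M.p / M.q))
    (μ := M.P)).indicator₀ hD₂
  have m₄ := (aemeasurable_const (b := ENNReal.ofReal (B + M.p * T₂ + M.p / M.q))
    (μ := M.P)).indicator₀ hD₃
  have m₅ := Finset.aemeasurable_fun_sum (Finset.range K) fun n _ => hΨ n
  unfold Model.loss
  refine ⟨((((aemeasurable_const.add m₁).add m₂).add m₃).add m₄).add m₅, ?_⟩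
  rw [lintegral_add_right' _ m₅, lintegral_add_right' _ m₄, lintegral_add_right' _ m₃,
    lintegral_add_right' _ m₂, lintegral_add_right' _ m₁, lintegral_const, measure_univ, mul_one,
    lintegral_finsetSum' _ fun n _ => hA n, lintegral_finsetSum' _ fun n _ => hΨ n]
  refine add_le_add (add_le_add (add_le_add (add_le_add (add_le_add le_rfl ?_) ?_) ?_) ?_) ?_
  · calc _ ≤ ∑ _n ∈ Finset.range K, ENNReal.ofReal (M.p / M.q)
          * ENNReal.ofReal (R * (K * (M.p * δ) / M.p)) := by
          refine Finset.sum_le_sum fun n _ => (lintegral_indicator_const_le _ _).trans ?_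
          rw [measure_toMeasurable]
          gcongr
          exact measure_surplus_claimTime_mem_le hlam (by positivity) hR x T₁ n
      _ = _ := by simp
  · exact lintegral_indicator_const_le _ _
  · exact lintegral_indicator_const_le _ _
  · exact lintegral_indicator_const_le _ _
  · calc _ ≤ ∑ _n ∈ Finset.range K, ENNReal.ofReal ((Real.exp (R * δ) - 1) * (B + M.p * T₂)) :=
          Finset.sum_le_sum fun n _ => lintegral_delayedSup_sub_le hlam hL hT₂ hδ.le hR x B n
      _ = _ := by simp

/-- The error depends neither on the strategy nor on `x`, and on the initial intensity only through
`lam₀`. -/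
theorem J_le_gridV_add (hL : M.IsAdmissible x lam L) (hx : 0 ≤ x) (hδ : 0 < δ) (hδ1 : δ ≤ 1)
    (hlam : M.lamBase ≤ lam) (hle : lam ≤ lam₀) (hB : 0 ≤ B) (hT₁ : 0 ≤ T₁) (hT : T₁ ≤ T₂)
    (hR : 0 ≤ R) (K : ℕ) {c : ℝ}
    (hc : ∀ s, T₂ ≤ s → Real.exp (-M.q * s) * (B + M.p * s) ≤ c) :
    M.J x lam L ≤ M.gridV δ x lam + (ENNReal.ofReal (K * (M.p * δ) + M.p * δ)
        + ENNReal.ofReal ((1 - Real.exp (-M.q * δ)) * (B + M.p / M.q)))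
      + (ENNReal.ofReal (Real.exp (-M.q * T₁) * (M.p / M.q)) + ENNReal.ofReal c
      + K * (ENNReal.ofReal (M.p / M.q) * ENNReal.ofReal (R * (K * (M.p * δ) / M.p)))
      + ENNReal.ofReal (M.p / M.q) * M.P {ω | B < M.claimSum lam₀ T₁ ω}
      + ENNReal.ofReal (B + M.p * T₂ + M.p / M.q)
        * M.P {ω | (K : ℝ) < M.eventCount lam₀ ω T₂}
      + ENNReal.ofReal (B + M.p * T₂ + M.p / M.q) * M.P {ω | R < rateBound lam₀ ω (T₂ + 1)}
      + K * ENNReal.ofReal ((Real.exp (R * δ) - 1) * (B + M.p * T₂))) := by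
  obtain ⟨hm, hint⟩ := lintegral_loss_le (K := K) hlam hle hL.2.1 hδ hR (hT₁.trans hT) x B T₁ c
  have hJ := J_gridApprox_le_gridV (B := B) (b := K * (M.p * δ)) hx hδ hlam hL.2.1
  rw [J_eq (show ∀ ω, ∀ t < 0, M.gridApprox x lam δ B (K * (M.p * δ)) hx hδ L ω t = 0 from
    fun ω t ht => gridDividends_of_neg ht)] at hJ
  rw [J_eq hL.1]
  refine le_trans ?_ (add_le_add (add_le_add_left hJ _) hint)
  have h1 : ∀ (f : Sample → ℝ≥0∞) (a : ℝ≥0∞), ∫⁻ ω, f ω ∂M.P + a = ∫⁻ ω, (f ω + a) ∂M.P := by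
    intro f a
    rw [lintegral_add_right _ measurable_const, lintegral_const, measure_univ, mul_one]
  rw [h1, ← lintegral_add_right' _ hm]
  refine lintegral_mono_ae ?_
  filter_upwards [ae_good (M := M), hL.2.2] with ω hω hadm
  exact Model.AdmissibleAt.lintegral_paid_le_add_loss hω ⟨hω.regular hlam, hL.1 ω, hadm⟩ hx hδ hδ1
    hlam hle hB hT₁ hT hc

end

section

/-! ### Choice of the parameters and uniform convergence -/

theorem exists_mul_measure_gt_le {Ω : Type*} [MeasurableSpace Ω] (P : Measure Ω)
    [IsProbabilityMeasure P] {f : Ω → ℝ} (hf : AEMeasurable f P) {C ε : ℝ≥0∞} (hC : C ≠ ⊤)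
    (hε : 0 < ε) : ∃ K, 0 ≤ K ∧ ∀ K', K ≤ K' → C * P {ω | K' < f ω} ≤ ε := by
  obtain ⟨K, hK⟩ := exists_measure_gt_le P hf (ENNReal.div_pos hε.ne' hC)
  refine ⟨max K 0, le_max_right _ _, fun K' hK' => ?_⟩
  refine le_trans ?_ (ENNReal.mul_div_le (a := C) (b := ε))
  gcongr
  refine (measure_mono fun ω hω => ?_).trans hK
  exact ((le_max_left _ _).trans hK').trans_lt hω

variable {M : Model}

theorem exists_forall_exp_mul_le (M : Model) (B : ℝ) {c : ℝ} (hc : 0 < c) :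
    ∃ T, ∀ s, T ≤ s → Real.exp (-M.q * s) * (B + M.p * s) ≤ c := by
  have h1 : Tendsto (fun s => Real.exp (-M.q * s)) atTop (𝓝 0) := by
    simpa using tendsto_rpow_mul_exp_neg_mul_atTop_nhds_zero 0 M.q M.q_pos
  have h2 : Tendsto (fun s => s * Real.exp (-M.q * s)) atTop (𝓝 0) := by
    simpa using tendsto_rpow_mul_exp_neg_mul_atTop_nhds_zero 1 M.q M.q_pos
  have h : Tendsto (fun s => Real.exp (-M.q * s) * (B + M.p * s)) atTop (𝓝 0) := by
    have := (h1.const_mul B).add (h2.const_mul M.p)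
    simp only [mul_zero, add_zero] at this
    refine this.congr fun s => ?_
    ring
  exact eventually_atTop.1 (h.eventually (Iic_mem_nhds hc))

/-- The order of the choices matters: `T₁` from `ε`, then `B` for the claims up to `T₁`, then `T₂`
for the discounted `B + p s`, then `K` and `R` for the events and rates up to `T₂`, and the step
last. The terms containing `δ` vanish with all other parameters fixed. -/
theorem exists_forall_V_le_gridV_add_of_le (M : Model) {lam₀ : ℝ} (hlam₀ : M.lamBase ≤ lam₀)
    {ε : ℝ} (hε : 0 < ε) :
    ∃ δ₀, 0 < δ₀ ∧ ∀ δ, 0 < δ → δ < δ₀ → ∀ x lam, 0 ≤ x → M.lamBase ≤ lam → lam ≤ lam₀ →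
      M.V x lam ≤ M.gridV δ x lam + ENNReal.ofReal ε := by
  have hp := M.p_pos
  have hq := M.q_pos
  -- One share for the four terms collected in `E δ`, and one for each choice of `T₁`, `T₂`, `B`,
  -- `K` and `R`.
  obtain ⟨η, hη, hηε⟩ : ∃ η, 0 < η ∧ 6 * η = ε := ⟨ε / 6, by positivity, by ring⟩
  have hη' := ENNReal.ofReal_pos.2 hη
  obtain ⟨T₁', hT₁'⟩ := exists_forall_exp_mul_le M (M.p / M.q) hη
  obtain ⟨T₁, hT₁, hT₁le⟩ : ∃ T, 0 ≤ T ∧ Real.exp (-M.q * T) * (M.p / M.q) ≤ η := by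
    refine ⟨max T₁' 0, le_max_right _ _, (mul_le_mul_of_nonneg_left ?_ (Real.exp_pos _).le).trans
      (hT₁' _ (le_max_left _ _))⟩
    have := mul_nonneg hp.le (le_max_right T₁' 0)
    linarith
  obtain ⟨B, hB, hBle⟩ := exists_mul_measure_gt_le M.P (aemeasurable_claimSum hlam₀ T₁)
    (C := ENNReal.ofReal (M.p / M.q)) ENNReal.ofReal_ne_top hη'
  obtain ⟨T₂', hT₂'⟩ := exists_forall_exp_mul_le M B hη
  obtain ⟨T₂, hT, hc⟩ : ∃ T₂, T₁ ≤ T₂ ∧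
      ∀ s, T₂ ≤ s → Real.exp (-M.q * s) * (B + M.p * s) ≤ η :=
    ⟨max T₁ T₂', le_max_left _ _, fun s hs => hT₂' s ((le_max_right _ _).trans hs)⟩
  obtain ⟨K', -, hK'⟩ := exists_mul_measure_gt_le M.P (aemeasurable_eventCount hlam₀ T₂)
    (C := ENNReal.ofReal (B + M.p * T₂ + M.p / M.q)) ENNReal.ofReal_ne_top hη'
  obtain ⟨K, hK⟩ := exists_nat_ge K'
  obtain ⟨R, hR, hRle⟩ := exists_mul_measure_gt_le M.P (aemeasurable_rateBound lam₀ (T₂ + 1))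
    (C := ENNReal.ofReal (B + M.p * T₂ + M.p / M.q)) ENNReal.ofReal_ne_top hη'
  obtain ⟨E, hE⟩ : ∃ E : ℝ → ℝ≥0∞, E = fun δ => ENNReal.ofReal (K * (M.p * δ) + M.p * δ)
        + ENNReal.ofReal ((1 - Real.exp (-M.q * δ)) * (B + M.p / M.q))
      + K * (ENNReal.ofReal (M.p / M.q) * ENNReal.ofReal (R * (K * (M.p * δ) / M.p)))
      + K * ENNReal.ofReal ((Real.exp (R * δ) - 1) * (B + M.p * T₂)) := ⟨_, rfl⟩
  have hcont : Continuous E := by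
    have h1 : Continuous fun δ => ENNReal.ofReal (K * (M.p * δ) + M.p * δ) :=
      ENNReal.continuous_ofReal.comp (by fun_prop)
    have h2 : Continuous fun δ =>
        ENNReal.ofReal ((1 - Real.exp (-M.q * δ)) * (B + M.p / M.q)) :=
      ENNReal.continuous_ofReal.comp (by fun_prop)
    have h3 : Continuous fun δ => ENNReal.ofReal (R * (K * (M.p * δ) / M.p)) :=
      ENNReal.continuous_ofReal.comp (by fun_prop)
    have h4 : Continuous fun δ => ENNReal.ofReal ((Real.exp (R * δ) - 1) * (B + M.p * T₂)) :=
      ENNReal.continuous_ofReal.comp (by fun_prop)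
    rw [hE]
    exact ((h1.add h2).add ((ENNReal.continuous_const_mul (ENNReal.natCast_ne_top K)).comp
      ((ENNReal.continuous_const_mul ENNReal.ofReal_ne_top).comp h3))).add
      ((ENNReal.continuous_const_mul (ENNReal.natCast_ne_top K)).comp h4)
  have hlim : Tendsto E (𝓝 0) (𝓝 0) := hcont.tendsto' 0 0 (by simp [hE])
  obtain ⟨r, hr, hball⟩ := Metric.eventually_nhds_iff.1 (hlim.eventually (Iic_mem_nhds hη'))
  refine ⟨min r 1, lt_min hr one_pos, fun δ hδ hδr x lam hx hlam hle => ?_⟩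
  have hEδ : E δ ≤ ENNReal.ofReal η := hball (by
    rw [Real.dist_eq, sub_zero, abs_of_pos hδ]
    exact hδr.trans_le (min_le_left _ _))
  refine iSup₂_le fun L hL => (J_le_gridV_add hL hx hδ (hδr.le.trans (min_le_right _ _)) hlam hle
    hB hT₁ hT hR K hc).trans ?_
  have hsum : ENNReal.ofReal ε = ENNReal.ofReal η + (ENNReal.ofReal η + ENNReal.ofReal η
      + ENNReal.ofReal η + ENNReal.ofReal η + ENNReal.ofReal η) := by
    rw [← hηε, ENNReal.ofReal_mul (by norm_num), ENNReal.ofReal_ofNat]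
    ring
  calc _ = M.gridV δ x lam + (E δ + (ENNReal.ofReal (Real.exp (-M.q * T₁) * (M.p / M.q))
        + ENNReal.ofReal η
        + ENNReal.ofReal (M.p / M.q) * M.P {ω | B < M.claimSum lam₀ T₁ ω}
        + ENNReal.ofReal (B + M.p * T₂ + M.p / M.q)
          * M.P {ω | (K : ℝ) < M.eventCount lam₀ ω T₂}
        + ENNReal.ofReal (B + M.p * T₂ + M.p / M.q)
          * M.P {ω | R < rateBound lam₀ ω (T₂ + 1)})) := by rw [hE]; ring
    _ ≤ _ := by
      rw [hsum]
      exact add_le_add le_rfl (add_le_add hEδ (add_le_add (add_le_add (add_le_add (add_le_add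
        (ENNReal.ofReal_le_ofReal hT₁le) le_rfl) (hBle B le_rfl)) (hK' K hK)) (hRle R le_rfl)))

theorem exists_forall_V_le_gridV_add (M : Model) {ε : ℝ} (hε : 0 < ε) :
    ∃ δ₀, 0 < δ₀ ∧ ∀ δ, 0 < δ → δ < δ₀ → ∀ x lam, 0 ≤ x → M.lamBase ≤ lam →
      M.V x lam ≤ M.gridV δ x lam + ENNReal.ofReal ε := by
  obtain ⟨lam₀, hlam₀, hlarge⟩ := exists_forall_V_le M hε
  obtain ⟨δ₀, hδ₀, hsmall⟩ := exists_forall_V_le_gridV_add_of_le M hlam₀ hε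
  refine ⟨δ₀, hδ₀, fun δ hδ hlt x lam hx hlam => ?_⟩
  rcases le_total lam lam₀ with hle | hge
  · exact hsmall δ hδ hlt x lam hx hlam hle
  · exact (hlarge x lam hx hge).trans (add_le_add_left (le_gridV hx hδ hlam) _)

theorem tendstoUniformlyOn_gridV (M : Model) {δ : ℕ → ℝ} (hδ : ∀ k, 0 < δ k)
    (hlim : Tendsto δ atTop (𝓝 0)) :
    TendstoUniformlyOn (fun (k : ℕ) (z : ℝ × ℝ) => (M.gridV (δ k) z.1 z.2).toReal)
      (fun z : ℝ × ℝ => (M.V z.1 z.2).toReal) atTop (Ici (0 : ℝ) ×ˢ Ici M.lamBase) := by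
  rw [Metric.tendstoUniformlyOn_iff]
  intro ε hε
  obtain ⟨δ₀, hδ₀, h⟩ := exists_forall_V_le_gridV_add M (half_pos hε)
  filter_upwards [hlim.eventually (Iio_mem_nhds hδ₀)] with k hk z hz
  have hV := V_ne_top hz.1 hz.2
  have hle : M.gridV (δ k) z.1 z.2 ≤ M.V z.1 z.2 := gridV_le_V hz.2
  have hG := ne_top_of_le_ne_top hV hle
  have h1 := ENNReal.toReal_mono hV hle
  have h2 := ENNReal.toReal_mono (ENNReal.add_ne_top.2 ⟨hG, ENNReal.ofReal_ne_top⟩)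
    (h (δ k) (hδ k) hk z.1 z.2 hz.1 hz.2)
  rw [ENNReal.toReal_add hG ENNReal.ofReal_ne_top, ENNReal.toReal_ofReal (half_pos hε).le] at h2
  rw [Real.dist_eq, abs_of_nonneg (sub_nonneg.2 h1)]
  linarith

end

end ShotNoise

end

theorem mainTheorem1 (M : ShotNoise.Model) (δ : ℝ) (hδ : 0 < δ) :
    (∀ x lam : ℝ, 0 ≤ x → M.lamBase ≤ lam →
      M.V x lam ≠ ⊤ ∧
      (∀ k : ℕ, M.gridV (δ / 2 ^ k) x lam ≤ M.gridV (δ / 2 ^ (k + 1)) x lam ∧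
        M.gridV (δ / 2 ^ k) x lam ≤ M.V x lam)) ∧
    TendstoUniformlyOn
      (fun (k : ℕ) (z : ℝ × ℝ) => (M.gridV (δ / 2 ^ k) z.1 z.2).toReal)
      (fun z : ℝ × ℝ => (M.V z.1 z.2).toReal) atTop
      (Ici (0 : ℝ) ×ˢ Ici M.lamBase) := by
  have hpos : ∀ k : ℕ, 0 < δ / 2 ^ k := fun k => by positivity
  refine ⟨fun x lam hx hlam => ⟨ShotNoise.V_ne_top hx hlam, fun k => ⟨?_,
    ShotNoise.gridV_le_V hlam⟩⟩, ShotNoise.tendstoUniformlyOn_gridV M hpos ?_⟩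
  · rw [pow_succ, ← div_div]
    exact ShotNoise.gridV_half_le hlam (hpos k)
  · exact tendsto_const_nhds.div_atTop (tendsto_pow_atTop_atTop_of_one_lt one_lt_two)
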